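/- **Setting.** Let $\Omega=(0,1)^{\mathbb Z}$ with its Borel $\sigma$-algebra, let $P$ be a probability measure on $\Omega$ (the law of the environment $\omega=(\omega_i)_{i\in\mathbb Z}$), and put $\rho_i=(1-\omega_i)/\omega_i$, $R(\omega)=1+\sum_{n\ge 0}\rho_0\rho_{-1}\cdots\rho_{-n}\in[1,\infty]$, $\mathcal F_0=\sigma(\omega_j:j>0)$. Given $\omega$, the *quenched law* $P_\omega$ governs the Markov chain $(X_n)_{n\ge0}$ on $\mathbb Z$ with $X_0=0$ that jumps from $i$ to $i+1$ with probability $\omega_i$ and to $i-1$ with probability $1-\omega_i$. It also governs the branching process $(Z_n)_{n\ge0}$ with $Z_0=0$ in which, given $Z_0,\dots,Z_n$, the variable $Z_{n+1}$ is the sum of $Z_n+1$ independent variables with the geometric law $k\mapsto\omega_{-n}(1-\omega_{-n})^k$, $k=0,1,2,\dots$. Let $\mathbb P$ be a probability measure on a space that carries $\omega$ with law $P$ and $X$, $Z$, each of which has, given $\omega$, its quenched law (no assumption is made on the joint law of $X$ and $Z$ given $\omega$). *Condition B.* The shift is measure preserving and ergodic for $P$; $P(\epsilon<\omega_0<1-\epsilon)=1$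 for some $\epsilon\in(0,1/2)$; for every $\beta>0$ the limit $\Lambda(\beta)=\lim_n\frac1n\log E_P\bigl(\prod_{i=0}^{n-1}\rho_i^\beta\bigr)$ exists in $\mathbb R$ and $\frac1n\log E_P\bigl(\prod_{k=0}^{n-1}\rho_{-k}^\beta\,\big|\,\mathcal F_0\bigr)\to\Lambda(\beta)$ $P$-a.s. with a rate that is uniform in $\omega$; there is a unique $\kappa>0$ with $\Lambda(\kappa)=0$, and $\Lambda(\beta)(\beta-\kappa)\ge0$ for all $\beta>0$. *Condition C$_\kappa$.* There are a strictly positive random variable $K(\omega)$ and constants $K_3,K_4,t_c>0$ such that, $P$-a.s., $t^\kappa P(R>t\mid\mathcal F_0)>K_3$ for all $t>t_c$, $t^\kappa P(R>t\mid\mathcal F_0)<K_4$ for all $t>0$, and $\lim_{t\to\infty}t^\kappa P(R>t\mid\mathcal F_0)=K(\omega)$ (with a regular version of the conditional probability). For $\kappa\in(0,2]$ and $b>0$ let $\mathcal L_{\kappa,b}$ be the stable law (and also its distribution function) with characteristic function $\exp\bigl(-b|t|^\kappa(1+i\frac t{|t|}f_\kappa(t))\bigr)$, where $f_\kappa(t)=-\tan(\pi\kappa/2)$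 for $\kappa\ne1$ and $f_1(t)=\frac2\pi\log|t|$. **Theorem.** Assume that $P$ satisfies Conditions B and C$_\kappa$ for the $\kappa$ of Condition B, and that $\kappa\le2$. Let $(\mathcal G_n)_{n\ge0}$ be a filtration with $\sigma(\omega_j:j>-n)\subset\mathcal G_n$ such that the conditional law of $(Z_0,\dots,Z_n)$ given $\mathcal G_n$ is its quenched law, for every $n$. Let $0=\eta_0\le\eta_1\le\eta_2\le\cdots$ be almost surely finite stopping times for the filtration $\overline{\mathcal F}_n=\sigma(Z_0,\dots,Z_n)\vee\mathcal G_n$ such that 1. for some $\mu>0$ and $\sigma\in\mathbb R$, $\eta_m/m\to\mu$ a.s. and $(\eta_m-m\mu)/\sqrt m\to N(0,\sigma^2)$ in distribution (where $N(0,0)$ is the unit mass at $0$); 2. for some $b_0>0$, $\frac1{B_m}\bigl(\sum_{i=1}^{\eta_m}Z_i-A_m\bigr)\to\mathcal L_{\kappa,b_0}$ in distribution, where $B_m=m^{1/\kappa}$ if $\kappa<2$ and $B_m=(m\log m)^{1/2}$ if $\kappa=2$, and where $A_m=0$ if $\kappa<1$, $A_m\sim c_1m\log m$ if $\kappa=1$,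 and $A_m=c_2m$ if $\kappa\in(1,2]$, for some constants $c_1,c_2>0$. Then there is $b>0$ such that: (i) if $\kappa\in(0,1)$, then $\lim_{n}\mathbb P(n^{-\kappa}X_n\le z)=1-\mathcal L_{\kappa,b}(z^{-1/\kappa})$ for all $z>0$; (ii) if $\kappa=1$, then there are $A_1>0$ and a sequence $\delta(n)\sim(A_1\log n)^{-1}n$ with $\lim_n\mathbb P\bigl(n^{-1}(\log n)^2(X_n-\delta(n))\le z\bigr)=1-\mathcal L_{1,b}(-z)$ for all $z\in\mathbb R$; (iii) if $\kappa\in(1,2)$, then the speed $v_P=\lim_nX_n/n$ exists $\mathbb P$-a.s. as a constant, and $\lim_n\mathbb P\bigl(n^{-1/\kappa}(X_n-nv_P)\le z\bigr)=1-\mathcal L_{\kappa,b}(-z)$ for all $z\in\mathbb R$; (iv) if $\kappa=2$, then $v_P=\lim_nX_n/n$ exists $\mathbb P$-a.s. as a constant, and $\lim_n\mathbb P\bigl((n\log n)^{-1/2}(X_n-nv_P)\le z\bigr)=\mathcal L_{2,b}(z)$ for all $z\in\mathbb R$. -/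

import Mathlib

open MeasureTheory ProbabilityTheory Filter
open scoped Topology ENNReal

namespace RWRE

noncomputable section

/-- The space of environments `Ω = (0,1)^ℤ`, with its product (Borel) σ-algebra. -/
abbrev Env : Type := ℤ → Set.Ioo (0 : ℝ) 1

instance instStandardBorelIoo : StandardBorelSpace (Set.Ioo (0 : ℝ) 1) :=
  measurableSet_Ioo.standardBorel

/-- The shift `(θ ω)_i = ω_{i+1}`. -/
def shift (ω : Env) : Env := fun i => ω (i + 1)

/-- `ρ_i = (1 - ω_i) / ω_i`. -/
def rho (ω : Env) (i : ℤ) : ℝ := (1 - (ω i : ℝ)) / (ω i : ℝ)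

/-- `R(ω) = 1 + ∑_{n ≥ 0} ρ_0 ρ_{-1} ⋯ ρ_{-n}`, with values in `[0, ∞]`. -/
def R (ω : Env) : ℝ≥0∞ :=
  1 + ∑' n : ℕ, ∏ i ∈ Finset.range (n + 1), ENNReal.ofReal (rho ω (-(i : ℤ)))

/-- The σ-algebra `σ(ω_j : j > -n)` on the space of environments. -/
@[reducible] def envSigma (n : ℕ) : MeasurableSpace Env :=
  ⨆ (j : ℤ) (_ : -(n : ℤ) < j), MeasurableSpace.comap (fun ω : Env => ω j) inferInstance

/-! ### Conditions on the law of the environment -/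

/-- Condition B, for the exponent `κ`, on the law `P` of the environment. The function `Λ` is
pinned down on `(0, ∞)` by `Λ(β) = lim (1/n) log E_P ∏_{i<n} ρ_i^β`; the conditional
version holds almost surely, with a rate that does not depend on the environment. -/
structure ConditionB (P : Measure Env) (κ : ℝ) : Prop where
  /-- stationarity and ergodicity -/
  ergodic : Ergodic shift P
  /-- ellipticity -/
  elliptic : ∃ ε ∈ Set.Ioo (0 : ℝ) (1 / 2),
    ∀ᵐ ω ∂P, ε < (ω 0 : ℝ) ∧ (ω 0 : ℝ) < 1 - ε
  kappa_pos : 0 < κ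
  moments : ∃ Λ : ℝ → ℝ,
    (∀ β : ℝ, 0 < β → Tendsto (fun n : ℕ => (1 / (n : ℝ)) *
        Real.log (∫ ω, ∏ i ∈ Finset.range n, (rho ω (i : ℤ)) ^ β ∂P)) atTop (𝓝 (Λ β))) ∧
    (∀ β : ℝ, 0 < β → ∀ ε : ℝ, 0 < ε → ∃ N : ℕ, ∀ n ≥ N, ∀ᵐ ω ∂P,
        |(1 / (n : ℝ)) * Real.log
            ((P[fun ω' => ∏ k ∈ Finset.range n, (rho ω' (-(k : ℤ))) ^ β | envSigma 0]) ω)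
          - Λ β| < ε) ∧
    Λ κ = 0 ∧
    (∀ β : ℝ, 0 < β → Λ β = 0 → β = κ) ∧
    (∀ β : ℝ, 0 < β → 0 ≤ Λ β * (β - κ))

/-- The conditional probability `P(R > t | σ(ω_j : j > 0))`, in its regular version. -/
def condTailR (P : Measure Env) [IsFiniteMeasure P] (t : ℝ) (ω : Env) : ℝ :=
  (condExpKernel P (envSigma 0) ω).real {ω' | ENNReal.ofReal t < R ω'}

/-- Condition `C_κ` on the law `P` of the environment. -/
def ConditionC (P : Measure Env) [IsFiniteMeasure P] (κ : ℝ) : Prop :=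
  ∃ K : Env → ℝ, Measurable K ∧ (∀ ω, 0 < K ω) ∧
    ∃ K₃ K₄ t_c : ℝ, 0 < K₃ ∧ 0 < K₄ ∧ 0 < t_c ∧
      ∀ᵐ ω ∂P,
        (∀ t : ℝ, t_c < t → K₃ < t ^ κ * condTailR P t ω) ∧
        (∀ t : ℝ, 0 < t → t ^ κ * condTailR P t ω < K₄) ∧
        Tendsto (fun t : ℝ => t ^ κ * condTailR P t ω) atTop (𝓝 (K ω))

/-! ### The random walk in the environment and the branching process -/

/-- Quenched one-step transition probabilities of the walk. -/
def walkStep (ω : Env) (i j : ℤ) : ℝ≥0∞ :=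
  if j = i + 1 then ENNReal.ofReal (ω i : ℝ)
  else if j = i - 1 then ENNReal.ofReal (1 - (ω i : ℝ))
  else 0

/-- `P_ω(X_0 = x_0, …, X_n = x_n)` for the walk started at `0`. -/
def walkPathProb (ω : Env) (x : ℕ → ℤ) (n : ℕ) : ℝ≥0∞ :=
  (if x 0 = 0 then 1 else 0) * ∏ i ∈ Finset.range n, walkStep ω (x i) (x (i + 1))

/-- The geometric law on `{0, 1, 2, …}` giving mass `ω_{-n} (1 - ω_{-n})^k` to `k`. -/
def offspringLaw (ω : Env) (n : ℕ) : Measure ℕ :=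
  geometricMeasure ⟨(ω (-(n : ℤ)) : ℝ), (ω (-(n : ℤ))).2.1.le, (ω (-(n : ℤ))).2.2.le⟩

/-- Quenched law of `Z_{n+1}` given `Z_n = z`: the law of the sum of `z + 1` independent
variables `V_{n,0}, …, V_{n,z}` distributed according to `offspringLaw ω n`. -/
def branchingStep (ω : Env) (n z : ℕ) : Measure ℕ :=
  (Measure.pi fun _ : Fin (z + 1) => offspringLaw ω n).map fun v => ∑ j, v j

/-- `P_ω(Z_0 = z_0, …, Z_n = z_n)` for the branching process with `Z_0 = 0`. -/
def branchingPathProb (ω : Env) (z : ℕ → ℕ) (n : ℕ) : ℝ≥0∞ :=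
  (if z 0 = 0 then 1 else 0) * ∏ i ∈ Finset.range n, branchingStep ω i (z i) {z (i + 1)}

/-- On the probability space `(Ω', Pr)`, the environment `env` has law `P` and, given the
environment, `X` is the nearest neighbour walk with quenched law `P_ω`; that is, `(env, X)` has
the annealed law `P ⊗ P_ω`. -/
structure IsRWRE {Ω' : Type*} [MeasurableSpace Ω'] (Pr : Measure Ω') (P : Measure Env)
    (env : Ω' → Env) (X : ℕ → Ω' → ℤ) : Prop where
  measurable_env : Measurable env
  measurable_walk : ∀ n, Measurable (X n)
  law : ∀ (n : ℕ) (x : ℕ → ℤ) (F : Set Env), MeasurableSet F →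
    Pr {a | env a ∈ F ∧ ∀ i ≤ n, X i a = x i} = ∫⁻ ω in F, walkPathProb ω x n ∂P

/-- On the probability space `(Ω', Pr)`, the environment `env` has law `P` and, given the
environment, `Z` is the branching process with one immigrant at each unit of time. -/
structure IsBranching {Ω' : Type*} [MeasurableSpace Ω'] (Pr : Measure Ω') (P : Measure Env)
    (env : Ω' → Env) (Z : ℕ → Ω' → ℕ) : Prop where
  measurable_env : Measurable env
  measurable_branching : ∀ n, Measurable (Z n)
  law : ∀ (n : ℕ) (z : ℕ → ℕ) (F : Set Env), MeasurableSet F →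
    Pr {a | env a ∈ F ∧ ∀ i ≤ n, Z i a = z i} = ∫⁻ ω in F, branchingPathProb ω z n ∂P

/-- `𝒢` is an augmentation of the filtration `σ(ω_j : j > -n)` that generates the original quenched
law: given `𝒢 n`, the process `Z` up to time `n` has its quenched law. -/
structure IsAugmentation {Ω' : Type*} [m : MeasurableSpace Ω'] (Pr : Measure Ω')
    (env : Ω' → Env) (Z : ℕ → Ω' → ℕ) (𝒢 : Filtration ℕ m) : Prop where
  le : ∀ n, MeasurableSpace.comap env (envSigma n) ≤ 𝒢 n
  quenched : ∀ (n : ℕ) (z : ℕ → ℕ),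
    Pr[Set.indicator {a | ∀ i ≤ n, Z i a = z i} (fun _ => (1 : ℝ)) | 𝒢 n]
      =ᵐ[Pr] fun a => (branchingPathProb (env a) z n).toReal

/-- The filtration `σ(Z_0, …, Z_n) ∨ 𝒢_n`. -/
def augFiltration {Ω' : Type*} [m : MeasurableSpace Ω'] (Z : ℕ → Ω' → ℕ)
    (hZ : ∀ n, Measurable (Z n)) (𝒢 : Filtration ℕ m) : Filtration ℕ m :=
  Filtration.natural Z (fun n => (hZ n).stronglyMeasurable) ⊔ 𝒢

/-! ### Stable laws and the limit laws for the walk -/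

/-- `f_κ(t) = -tan(πκ/2)` if `κ ≠ 1`, and `f_1(t) = (2/π) log |t|`. -/
def stableF (κ t : ℝ) : ℝ :=
  if κ = 1 then 2 / Real.pi * Real.log |t| else -Real.tan (Real.pi / 2 * κ)

/-- `ν` is the stable law `ℒ_{κ,b}`: its characteristic function is
`t ↦ exp(-b |t|^κ (1 + i (t/|t|) f_κ(t)))`. -/
def IsStableLaw (κ b : ℝ) (ν : ProbabilityMeasure ℝ) : Prop :=
  ∀ t : ℝ, charFun (ν : Measure ℝ) t =
    Complex.exp (-(b * |t| ^ κ : ℝ) * (1 + Complex.I * ((t / |t| * stableF κ t : ℝ) : ℂ)))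

/-- The norming sequence `B_m`. -/
def normB (κ : ℝ) (m : ℕ) : ℝ :=
  if κ = 2 then ((m : ℝ) * Real.log m) ^ (1 / 2 : ℝ) else (m : ℝ) ^ (1 / κ)

/-- `A` is an admissible centering sequence: `A_m = 0` if `κ < 1`, `A_m ∼ c₁ m log m` if `κ = 1`,
`A_m = c₂ m` if `κ > 1`, with positive constants `c₁`, `c₂`. -/
def IsCentering (κ : ℝ) (A : ℕ → ℝ) : Prop :=
  (κ < 1 → ∀ m, A m = 0) ∧
  (κ = 1 → ∃ c₁ : ℝ, 0 < c₁ ∧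
    Asymptotics.IsEquivalent atTop A (fun m : ℕ => c₁ * (m : ℝ) * Real.log m)) ∧
  (1 < κ → ∃ c₂ : ℝ, 0 < c₂ ∧ ∀ m : ℕ, A m = c₂ * (m : ℝ))

/-- `v` is the speed of the walk: `X_n / n → v` almost surely. -/
def IsSpeed {Ω' : Type*} [MeasurableSpace Ω'] (Pr : Measure Ω') (X : ℕ → Ω' → ℤ) (v : ℝ) : Prop :=
  ∀ᵐ a ∂Pr, Tendsto (fun n : ℕ => (X n a : ℝ) / (n : ℝ)) atTop (𝓝 v)

/-- The stable limit laws for `X_n`, with the distribution function of `ℒ_{κ,b}` for some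
`b > 0`. -/
def StableLimitLaws {Ω' : Type*} [MeasurableSpace Ω'] (Pr : Measure Ω') (X : ℕ → Ω' → ℤ)
    (κ : ℝ) : Prop :=
  ∃ b : ℝ, 0 < b ∧ ∃ ν : ProbabilityMeasure ℝ, IsStableLaw κ b ν ∧
    (κ < 1 → ∀ z : ℝ, 0 < z →
      Tendsto (fun n : ℕ => Pr.real {a | (n : ℝ) ^ (-κ) * (X n a : ℝ) ≤ z}) atTop
        (𝓝 (1 - cdf (ν : Measure ℝ) (z ^ (-1 / κ))))) ∧
    (κ = 1 → ∃ A₁ : ℝ, 0 < A₁ ∧ ∃ δ : ℕ → ℝ,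
      Asymptotics.IsEquivalent atTop δ (fun n : ℕ => (A₁ * Real.log n)⁻¹ * (n : ℝ)) ∧
      ∀ z : ℝ,
        Tendsto (fun n : ℕ =>
            Pr.real {a | (n : ℝ)⁻¹ * Real.log n ^ 2 * ((X n a : ℝ) - δ n) ≤ z}) atTop
          (𝓝 (1 - cdf (ν : Measure ℝ) (-z)))) ∧
    (1 < κ → κ < 2 → ∃ v : ℝ, IsSpeed Pr X v ∧ ∀ z : ℝ,
      Tendsto (fun n : ℕ =>
          Pr.real {a | (n : ℝ) ^ (-1 / κ) * ((X n a : ℝ) - (n : ℝ) * v) ≤ z}) atTop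
        (𝓝 (1 - cdf (ν : Measure ℝ) (-z)))) ∧
    (κ = 2 → ∃ v : ℝ, IsSpeed Pr X v ∧ ∀ z : ℝ,
      Tendsto (fun n : ℕ =>
          Pr.real {a | ((n : ℝ) * Real.log n) ^ (-1 / 2 : ℝ) * ((X n a : ℝ) - (n : ℝ) * v) ≤ z})
        atTop (𝓝 (cdf (ν : Measure ℝ) z)))

end

end RWRE

/-!
The position of the walk is read off from its hitting times `T_n`, and the hitting times from the
total progeny of the branching process, for which a limit law is part of the hypotheses.

*Hitting times and progeny.* Since `Λ(β) < 0` for `β < κ`, products of the `ρ_i` have summable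
moments of order `β`. Counting the crossings of each edge then shows that the walk tends to `+∞`
(`IsWalkLaw.ae_tendsto_atTop`), and the strong Markov property at the first passage to `1`
(`IsWalkLaw.strong_markov`), with the stationarity of the environment, makes `T_n` a Birkhoff sum
for the map `afterOne`, which preserves the annealed law (`IsRWRE.annealed`). When the walk is
reflected at `-1`, the quenched generating function of `T_n` is a product along an orbit of Möbius
maps (`passageProd`). The same product, for a shifted environment, is the generating function of
`n + 2 (Z_0 + ⋯ + Z_n)`, so that both variables have the same annealed law
(`IsBranching.measure_progeny_eq`). A transient walk spends a finite time below `0`, so the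
reflection is irrelevant for limit laws (`GoodPath.exists_hitTime_le`).

*Limit law of the hitting times.* By the central limit theorem `η_m` differs from `m μ` by `O(√m)`
in probability, and the moments of order `β < κ` of the `Z_i` are bounded. For a suitable `β` the
sum of the `Z_i` over a window of length slightly larger than `√m` is therefore `o(B_m)` in
probability (`inProbZero_sum_sub_sum`), and `η_m` may be replaced by the deterministic index `n` with
`m = ⌊n / μ⌋` (`IsBranching.cdfTendsto_sum`). This gives the limit law of `T_n`
(`IsBranching.cdfTendsto_hitTime`). Stable laws have no atoms, so convergence in law means
convergence of the distribution functions at every point.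

*Inversion.* The events `{X_n < N}` and `{T_N > n}` differ only if the walk returns below `N` after
it has reached a level far above `N`, or if `T_N ≤ n < T_{N + ζ}`, and replacing `N` by `N + ζ` with
`ζ` fixed does not change the limit (`AnnealedWalk.tendsto_lt`). For `κ < 1` and `κ > 1` the limit
law of `X_n` follows from the regular variation of the norming sequence
(`AnnealedWalk.tendsto_le_of_lt_one`, `AnnealedWalk.tendsto_le_of_one_lt`). For `κ = 1` the
centering `g(n)` of `T_n` is only known up to asymptotic equivalence. However, the increments of
`T_n` are tight, whence those of `g` are at most `o(n)` (`AnnealedWalk.eventually_centering_sub_le`), and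
`g` has an asymptotic inverse `δ` (`exists_asymptotic_inverse`). For `N - δ(n)` of order
`n / (log n)²` the difference `T_N - T_{δ(n)}` satisfies a weak law of large numbers on the scale
`δ(n)` (`AnnealedWalk.tendsto_hitTime_le`). The change of scale of the stable law, which for
`κ = 1` entails a translation, is absorbed by `b` and `δ` (`IsStableLaw.affineImage_of_ne`,
`IsStableLaw.affineImage_one`).

*Speed.* For `κ > 1` the limit law of `T_n` implies that `T_n / n` converges in probability to a
constant. As `T_1` is integrable, the maximal ergodic theorem turns this into almost sure
convergence without any ergodicity of the annealed law (`ae_tendsto_birkhoffSum_div`).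
-/

namespace RWRE

/-! ### Path measures of time-inhomogeneous chains on a countable set -/

/-- The paths that agree with `x` up to time `n`. -/
def cyl {S : Type*} (n : ℕ) (x : ℕ → S) : Set (ℕ → S) := {y | ∀ i ≤ n, y i = x i}

/-- The event `D` depends on the path up to time `n` only. -/
def Determined {S : Type*} (n : ℕ) (D : Set (ℕ → S)) : Prop :=
  ∀ y y' : ℕ → S, (∀ i ≤ n, y i = y' i) → y ∈ D → y' ∈ D

/-- `Q` is the law of the chain with initial weights `w` and transition weights `p n s s'` at
time `n`, expressed through the probabilities of finite paths. -/
def IsChain {S : Type*} [MeasurableSpace S] (w : S → ℝ≥0∞) (p : ℕ → S → S → ℝ≥0∞)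
    (Q : Measure (ℕ → S)) : Prop :=
  ∀ (n : ℕ) (x : ℕ → S), Q (cyl n x) = w (x 0) * ∏ i ∈ Finset.range n, p i (x i) (x (i + 1))

lemma determined_eq_preimage {S : Type*} {n : ℕ} {D : Set (ℕ → S)} (hD : Determined n D) :
    D = (fun (y : ℕ → S) (i : Fin (n + 1)) => y i) ⁻¹'
      ((fun (y : ℕ → S) (i : Fin (n + 1)) => y i) '' D) := by
  ext y
  refine ⟨fun h => ⟨y, h, rfl⟩, ?_⟩
  rintro ⟨y', hy', h⟩
  exact hD y' y (fun i hi => congrFun h ⟨i, by omega⟩) hy'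

section Chain

variable {S : Type*} [MeasurableSpace S] [Countable S] [MeasurableSingletonClass S]

lemma measurableSet_coord_eq (n : ℕ) (s : S) : MeasurableSet {y : ℕ → S | y n = s} :=
  measurableSet_eq_fun (measurable_pi_apply n) measurable_const

lemma measurableSet_cyl (n : ℕ) (x : ℕ → S) : MeasurableSet (cyl n x) := by
  have : cyl n x = ⋂ i, ⋂ (_ : i ≤ n), {y : ℕ → S | y i = x i} := by
    ext y; simp [cyl]
  rw [this]
  exact MeasurableSet.iInter fun i => MeasurableSet.iInter fun _ =>
    measurableSet_coord_eq i (x i)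

lemma Determined.measurableSet {n : ℕ} {D : Set (ℕ → S)} (hD : Determined n D) :
    MeasurableSet D := by
  rw [determined_eq_preimage hD]
  exact (measurable_pi_lambda _ fun i => measurable_pi_apply _) (Set.to_countable _).measurableSet

/-- Measures that agree on the cylinders of length `n` agree on all events that depend on the
path up to time `n`. -/
lemma measure_eq_of_determined {m₁ m₂ : Measure (ℕ → S)} {n : ℕ}
    (h : ∀ x, m₁ (cyl n x) = m₂ (cyl n x)) {D : Set (ℕ → S)} (hD : Determined n D) :
    m₁ D = m₂ D := by
  have hr : Measurable (fun (y : ℕ → S) (i : Fin (n + 1)) => y i) :=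
    measurable_pi_lambda _ fun i => measurable_pi_apply _
  have key : m₁.map (fun (y : ℕ → S) (i : Fin (n + 1)) => y i)
      = m₂.map (fun (y : ℕ → S) (i : Fin (n + 1)) => y i) := by
    refine Measure.ext_of_singleton fun a => ?_
    rw [Measure.map_apply hr (measurableSet_singleton a),
      Measure.map_apply hr (measurableSet_singleton a)]
    have : (fun (y : ℕ → S) (i : Fin (n + 1)) => y i) ⁻¹' {a}
        = cyl n (fun i => if hi : i < n + 1 then a ⟨i, hi⟩ else a 0) := by
      ext y
      simp only [Set.mem_preimage, Set.mem_singleton_iff, cyl, Set.mem_ofPred_eq, funext_iff]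
      constructor
      · intro hy i hi
        rw [dif_pos (by omega)]; exact hy ⟨i, by omega⟩
      · intro hy i
        have := hy i (by omega)
        rwa [dif_pos i.2] at this
    rw [this, h]
  rw [determined_eq_preimage hD, ← Measure.map_apply hr (Set.to_countable _).measurableSet, key,
    Measure.map_apply hr (Set.to_countable _).measurableSet]

/-- A finite measure on path space is determined by its values on cylinders. -/
lemma ext_of_cyl {m₁ m₂ : Measure (ℕ → S)} [IsFiniteMeasure m₁]
    (h : ∀ n x, m₁ (cyl n x) = m₂ (cyl n x)) : m₁ = m₂ := by
  have hdet : ∀ n, Determined n (Set.univ : Set (ℕ → S)) := fun n y y' _ _ => trivial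
  refine ext_of_generate_finite {D : Set (ℕ → S) | ∃ n, Determined n D} ?_ ?_ ?_
    (measure_eq_of_determined (h 0) (hdet 0))
  · refine le_antisymm ?_ ?_
    · refine iSup_le fun i => ?_
      rintro D ⟨t, -, rfl⟩
      refine MeasurableSpace.measurableSet_generateFrom ⟨i, fun y y' hy hD => ?_⟩
      simpa [← hy i le_rfl] using hD
    · refine MeasurableSpace.generateFrom_le ?_
      rintro D ⟨n, hD⟩
      exact hD.measurableSet
  · rintro D ⟨n, hD⟩ D' ⟨n', hD'⟩ -
    refine ⟨max n n', fun y y' hy hmem => ⟨hD y y' (fun i hi => hy i (by omega)) hmem.1,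
      hD' y y' (fun i hi => hy i (by omega)) hmem.2⟩⟩
  · rintro D ⟨n, hD⟩
    exact measure_eq_of_determined (h n) hD

/-- The Markov property at a fixed time, for one step. -/
lemma IsChain.step {w : S → ℝ≥0∞} {p : ℕ → S → S → ℝ≥0∞} {Q : Measure (ℕ → S)}
    (hQ : IsChain w p Q) {n : ℕ} {D : Set (ℕ → S)} (hD : Determined n D) (s s' : S) :
    Q (D ∩ {y | y n = s ∧ y (n + 1) = s'}) = Q (D ∩ {y | y n = s}) * p n s s' := by
  have key := measure_eq_of_determined (m₁ := Q.restrict {y | y n = s ∧ y (n + 1) = s'})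
    (m₂ := p n s s' • Q.restrict {y | y n = s}) (n := n) ?_ hD
  · rw [Measure.restrict_apply hD.measurableSet, Measure.smul_apply,
      Measure.restrict_apply hD.measurableSet, smul_eq_mul, mul_comm] at key
    exact key
  · intro x
    rw [Measure.restrict_apply (measurableSet_cyl n x), Measure.smul_apply,
      Measure.restrict_apply (measurableSet_cyl n x), smul_eq_mul]
    classical
    by_cases hx : x n = s
    · have h1 : cyl n x ∩ {y | y n = s} = cyl n x := by
        ext y; simp only [cyl, Set.mem_inter_iff, Set.mem_ofPred_eq, and_iff_left_iff_imp]
        intro h; rw [h n le_rfl, hx]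
      have h2 : cyl n x ∩ {y | y n = s ∧ y (n + 1) = s'}
          = cyl (n + 1) (Function.update x (n + 1) s') := by
        ext y
        simp only [cyl, Set.mem_inter_iff, Set.mem_ofPred_eq]
        constructor
        · rintro ⟨h, h', h''⟩ i hi
          rcases Nat.lt_or_ge i (n + 1) with hlt | hge
          · rw [Function.update_of_ne (by omega)]; exact h i (by omega)
          · obtain rfl : i = n + 1 := by omega
            rw [Function.update_self]; exact h''
        · intro h
          refine ⟨fun i hi => ?_, ?_, ?_⟩
          · have := h i (by omega); rwa [Function.update_of_ne (by omega)] at this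
          · have := h n (by omega); rwa [Function.update_of_ne (by omega), hx] at this
          · have := h (n + 1) le_rfl; rwa [Function.update_self] at this
      rw [h1, h2, hQ, hQ, Finset.prod_range_succ, Function.update_self,
        Function.update_of_ne (by omega), Function.update_of_ne (by omega), hx]
      rw [Finset.prod_congr rfl (g := fun i => p i (x i) (x (i + 1)))]
      · ring
      · intro i hi
        have := Finset.mem_range.mp hi
        rw [Function.update_of_ne (by omega), Function.update_of_ne (by omega)]
    · have h1 : cyl n x ∩ {y | y n = s} = ∅ := by
        ext y; simp only [cyl, Set.mem_inter_iff, Set.mem_ofPred_eq, Set.mem_empty_iff_false,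
          iff_false, not_and]
        intro h h'; exact hx (by rw [← h n le_rfl, h'])
      have h2 : cyl n x ∩ {y | y n = s ∧ y (n + 1) = s'} = ∅ :=
        Set.eq_empty_of_subset_empty fun y hy => h1 ▸ ⟨hy.1, hy.2.1⟩
      rw [h1, h2]; simp

end Chain

/-! ### Shifts of the environment and moments of products of `ρ` -/

/-- The environment seen from site `i`. -/
def shiftBy (i : ℤ) (ω : Env) : Env := fun k => ω (k + i)

/-- `ρ_i` with values in `[0, ∞]`. -/
noncomputable def rhoE (ω : Env) (i : ℤ) : ℝ≥0∞ := ENNReal.ofReal (rho ω i)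

@[simp] lemma shiftBy_apply (i k : ℤ) (ω : Env) : shiftBy i ω k = ω (k + i) := rfl

lemma shiftBy_shiftBy (i j : ℤ) (ω : Env) : shiftBy i (shiftBy j ω) = shiftBy (i + j) ω := by
  funext k; simp [add_assoc]

@[simp] lemma shiftBy_zero (ω : Env) : shiftBy 0 ω = ω := by funext k; simp

@[simp] lemma rhoE_shiftBy (i k : ℤ) (ω : Env) : rhoE (shiftBy i ω) k = rhoE ω (k + i) := rfl

lemma measurable_shiftBy (i : ℤ) : Measurable (shiftBy i) :=
  measurable_pi_lambda _ fun k => measurable_pi_apply (k + i)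

lemma measurable_coe_env (i : ℤ) : Measurable (fun ω : Env => (ω i : ℝ)) :=
  measurable_subtype_coe.comp (measurable_pi_apply i)

lemma measurable_rho (i : ℤ) : Measurable (fun ω : Env => rho ω i) :=
  (measurable_const.sub (measurable_coe_env i)).div (measurable_coe_env i)

lemma measurable_rhoE (i : ℤ) : Measurable (fun ω : Env => rhoE ω i) :=
  (measurable_rho i).ennreal_ofReal

lemma measurable_prod_rhoE (g : ℕ → ℤ) (n : ℕ) :
    Measurable fun ω : Env => ∏ k ∈ Finset.range n, rhoE ω (g k) :=
  Finset.measurable_prod (f := fun k ω => rhoE ω (g k)) _ fun k _ => measurable_rhoE (g k)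

lemma rho_pos (ω : Env) (i : ℤ) : 0 < rho ω i :=
  div_pos (sub_pos.mpr (ω i).2.2) (ω i).2.1

lemma measurePreserving_shiftBy {P : Measure Env} (h : MeasurePreserving shift P P) (i : ℤ) :
    MeasurePreserving (shiftBy i) P P := by
  have h1 : shiftBy 1 = shift := by funext ω k; rfl
  have hnat : ∀ n : ℕ, MeasurePreserving (shiftBy n) P P := by
    intro n
    induction n with
    | zero =>
      have : shiftBy ((0 : ℕ) : ℤ) = id := by funext ω; simp
      rw [this]; exact MeasurePreserving.id P
    | succ n ih =>
      have : shiftBy ((n + 1 : ℕ) : ℤ) = shift ∘ shiftBy n := by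
        funext ω; rw [← h1, Function.comp, shiftBy_shiftBy]; push_cast; rw [add_comm]
      rw [this]; exact h.comp ih
  have hneg : ∀ n : ℕ, MeasurePreserving (shiftBy (-n)) P P := by
    intro n
    refine ⟨measurable_shiftBy _, ?_⟩
    conv_lhs => rw [← (hnat n).map_eq]
    rw [Measure.map_map (measurable_shiftBy _) (measurable_shiftBy _)]
    have : shiftBy (-(n : ℤ)) ∘ shiftBy n = id := by
      funext ω; simp [shiftBy_shiftBy]
    rw [this, Measure.map_id]
  obtain ⟨n, rfl | rfl⟩ := i.eq_nat_or_neg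
  · exact hnat n
  · exact hneg n

lemma ENNReal_tsum_rpow_le {ι : Type*} (a : ι → ℝ≥0∞) {β : ℝ} (h0 : 0 < β) (h1 : β ≤ 1) :
    (∑' i, a i) ^ β ≤ ∑' i, a i ^ β := by
  have hfin : ∀ s : Finset ι, (∑ i ∈ s, a i) ^ β ≤ ∑ i ∈ s, a i ^ β := by
    classical
    intro s
    induction s using Finset.induction_on with
    | empty => simp [h0]
    | insert i s hi ih =>
      rw [Finset.sum_insert hi, Finset.sum_insert hi]
      exact (ENNReal.rpow_add_le_add_rpow _ _ h0.le h1).trans (by gcongr)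
  have ht : Tendsto (fun s : Finset ι => (∑ i ∈ s, a i) ^ β) atTop (𝓝 ((∑' i, a i) ^ β)) :=
    (ENNReal.continuous_rpow_const.tendsto _).comp ENNReal.summable.hasSum
  exact le_of_tendsto ht (Eventually.of_forall fun s => (hfin s).trans (ENNReal.sum_le_tsum s))

section Moments

variable {P : Measure Env} {κ : ℝ}

lemma ConditionB.preserving (hB : ConditionB P κ) (i : ℤ) : MeasurePreserving (shiftBy i) P P :=
  measurePreserving_shiftBy hB.ergodic.toMeasurePreserving i

/-- Ellipticity and stationarity bound all `ρ_i` by one constant. -/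
lemma ConditionB.rho_bounded (hB : ConditionB P κ) :
    ∃ C : ℝ, 0 < C ∧ ∀ᵐ ω ∂P, ∀ i : ℤ, rho ω i ≤ C := by
  obtain ⟨ε, hε, h⟩ := hB.elliptic
  refine ⟨1 / ε, one_div_pos.mpr hε.1, ae_all_iff.mpr fun i => ?_⟩
  have := (hB.preserving i).quasiMeasurePreserving.ae h
  filter_upwards [this] with ω hω
  simp only [shiftBy_apply, zero_add] at hω
  have hpos : (0 : ℝ) < ω i := (ω i).2.1
  rw [rho, div_le_div_iff₀ hpos hε.1]
  nlinarith [hε.1, hω.1, hω.2]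

lemma prod_rhoE_reflect (ω : Env) (n : ℕ) (a : ℤ) :
    ∏ k ∈ Finset.range n, rhoE ω (a - k)
      = ∏ i ∈ Finset.range n, rhoE (shiftBy (a - (n - 1)) ω) i := by
  rw [← Finset.prod_range_reflect]
  refine Finset.prod_congr rfl fun k hk => ?_
  have := Finset.mem_range.mp hk
  rw [rhoE_shiftBy]
  congr 1
  omega

lemma ConditionB.lintegral_prod_reflect (hB : ConditionB P κ) (β : ℝ) (n : ℕ) (a : ℤ) :
    ∫⁻ ω, (∏ k ∈ Finset.range n, rhoE ω (a - k)) ^ β ∂P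
      = ∫⁻ ω, (∏ i ∈ Finset.range n, rhoE ω i) ^ β ∂P := by
  simp_rw [prod_rhoE_reflect]
  exact (hB.preserving (a - (n - 1))).lintegral_comp
    (f := fun ω => (∏ i ∈ Finset.range n, rhoE ω i) ^ β)
    ((measurable_prod_rhoE (fun k => (k : ℤ)) n).pow_const β)

lemma ConditionB.exists_exponent (hB : ConditionB P κ) : ∃ β : ℝ, 0 < β ∧ β ≤ 1 ∧ β < κ :=
  ⟨min 1 (κ / 2), lt_min one_pos (half_pos hB.kappa_pos), min_le_left _ _,
    (min_le_right _ _).trans_lt (half_lt_self hB.kappa_pos)⟩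

variable [IsProbabilityMeasure P]

/-- Below the exponent `κ` the moments of products of the `ρ_i` are summable, as `Λ(β) < 0`. -/
lemma ConditionB.tsum_moments_ne_top (hB : ConditionB P κ) {β : ℝ} (h0 : 0 < β) (hβ : β < κ) :
    ∑' n : ℕ, ∫⁻ ω, (∏ i ∈ Finset.range n, rhoE ω i) ^ β ∂P ≠ ⊤ := by
  obtain ⟨Λ, hΛ, -, -, huniq, hsign⟩ := hB.moments
  obtain ⟨C, hC0, hC⟩ := hB.rho_bounded
  have hneg : Λ β < 0 := by
    have h1 := hsign β h0
    have h2 : Λ β ≠ 0 := fun h => hβ.ne (huniq β h0 h)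
    rcases lt_or_gt_of_ne h2 with h | h
    · exact h
    · nlinarith
  set E : ℕ → ℝ := fun n => ∫ ω, ∏ i ∈ Finset.range n, (rho ω (i : ℤ)) ^ β ∂P with hE
  have hnn : ∀ n ω, 0 ≤ ∏ i ∈ Finset.range n, (rho ω (i : ℤ)) ^ β := fun n ω =>
    Finset.prod_nonneg fun i _ => Real.rpow_nonneg (rho_pos ω i).le _
  have hmeas : ∀ n, Measurable fun ω : Env => ∏ i ∈ Finset.range n, (rho ω (i : ℤ)) ^ β :=
    fun n => Finset.measurable_prod _ fun i _ => (measurable_rho i).pow_const β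
  have hint : ∀ n, Integrable (fun ω : Env => ∏ i ∈ Finset.range n, (rho ω (i : ℤ)) ^ β) P := by
    intro n
    refine Integrable.of_bound (hmeas n).aestronglyMeasurable ((C ^ β) ^ n) ?_
    filter_upwards [hC] with ω hω
    rw [Real.norm_of_nonneg (hnn n ω)]
    calc _ ≤ ∏ i ∈ Finset.range n, C ^ β := by
          refine Finset.prod_le_prod (fun i _ => Real.rpow_nonneg (rho_pos ω i).le _) fun i _ => ?_
          exact Real.rpow_le_rpow (rho_pos ω i).le (hω i) h0.le
      _ = _ := by simp
  have hlint : ∀ n, ∫⁻ ω, (∏ i ∈ Finset.range n, rhoE ω i) ^ β ∂P = ENNReal.ofReal (E n) := by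
    intro n
    rw [hE, ofReal_integral_eq_lintegral_ofReal (hint n) (Eventually.of_forall (hnn n))]
    refine lintegral_congr fun ω => ?_
    rw [ENNReal.ofReal_prod_of_nonneg (f := fun i : ℕ => rho ω i ^ β) (fun i _ => Real.rpow_nonneg (rho_pos ω i).le _),
      ← ENNReal.prod_rpow_of_nonneg h0.le]
    refine Finset.prod_congr rfl fun i _ => ?_
    rw [rhoE, ENNReal.ofReal_rpow_of_pos (rho_pos ω i)]
  have hE0 : ∀ n, 0 ≤ E n := fun n => integral_nonneg (hnn n)
  have hev : ∀ᶠ n : ℕ in atTop, E n ≤ Real.exp (Λ β / 2) ^ n := by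
    have := (hΛ β h0).eventually (gt_mem_nhds (show Λ β < Λ β / 2 by linarith))
    filter_upwards [this, eventually_gt_atTop 0] with n hn hn0
    rcases (hE0 n).eq_or_lt with h | h
    · rw [← h]; positivity
    · have hn0' : (0 : ℝ) < n := by exact_mod_cast hn0
      have : Real.log (E n) < n * (Λ β / 2) := by
        rw [one_div, inv_mul_lt_iff₀ hn0'] at hn; exact hn
      rw [← Real.exp_nat_mul]
      exact ((Real.log_lt_iff_lt_exp h).mp this).le
  have hsum : Summable E := by
    refine Summable.of_norm_bounded_eventually_nat (g := fun n => Real.exp (Λ β / 2) ^ n) ?_ ?_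
    · exact summable_geometric_of_lt_one (Real.exp_pos _).le (Real.exp_lt_one_iff.mpr (by linarith))
    · filter_upwards [hev] with n hn
      rwa [Real.norm_of_nonneg (hE0 n)]
  simp_rw [hlint]
  rw [← ENNReal.ofReal_tsum_of_nonneg hE0 hsum]
  exact ENNReal.ofReal_ne_top

/-- Almost surely, from every site, the sums of forward products of `ρ` are finite. -/
lemma ConditionB.ae_forward_finite (hB : ConditionB P κ) :
    ∀ᵐ ω ∂P, ∀ i : ℤ, ∑' n : ℕ, ∏ k ∈ Finset.range n, rhoE (shiftBy i ω) k ≠ ⊤ := by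
  obtain ⟨β, h0, h1, hβ⟩ := hB.exists_exponent
  refine ae_all_iff.mpr fun i => ?_
  have hm : ∀ n : ℕ, Measurable fun ω : Env => (∏ k ∈ Finset.range n, rhoE ω k) ^ β := fun n =>
    (measurable_prod_rhoE (fun k => (k : ℤ)) n).pow_const β
  have : ∀ᵐ ω ∂P, ∑' n : ℕ, (∏ k ∈ Finset.range n, rhoE ω k) ^ β < ⊤ := by
    refine ae_lt_top (Measurable.tsum hm) ?_
    rw [lintegral_tsum fun n => (hm n).aemeasurable]
    exact hB.tsum_moments_ne_top h0 hβ
  filter_upwards [(hB.preserving i).quasiMeasurePreserving.ae this] with ω hω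
  have := (ENNReal_tsum_rpow_le _ h0 h1).trans_lt hω
  intro h
  rw [h, ENNReal.top_rpow_of_pos h0] at this
  exact lt_irrefl _ this

/-- Almost surely, from every site, the sums of backward products of `ρ` are finite. -/
lemma ConditionB.ae_backward_finite (hB : ConditionB P κ) :
    ∀ᵐ ω ∂P, ∀ i : ℤ, ∑' n : ℕ, ∏ k ∈ Finset.range n, rhoE ω (i - k) ≠ ⊤ := by
  obtain ⟨β, h0, h1, hβ⟩ := hB.exists_exponent
  refine ae_all_iff.mpr fun i => ?_
  have hm : ∀ n : ℕ, Measurable fun ω : Env => (∏ k ∈ Finset.range n, rhoE ω (i - k)) ^ β :=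
    fun n => (measurable_prod_rhoE (fun k => i - (k : ℤ)) n).pow_const β
  have : ∀ᵐ ω ∂P, ∑' n : ℕ, (∏ k ∈ Finset.range n, rhoE ω (i - k)) ^ β < ⊤ := by
    refine ae_lt_top (Measurable.tsum hm) ?_
    rw [lintegral_tsum fun n => (hm n).aemeasurable]
    simp_rw [hB.lintegral_prod_reflect]
    exact hB.tsum_moments_ne_top h0 hβ
  filter_upwards [this] with ω hω
  have := (ENNReal_tsum_rpow_le _ h0 h1).trans_lt hω
  intro h
  rw [h, ENNReal.top_rpow_of_pos h0] at this
  exact lt_irrefl _ this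

end Moments

/-! ### Quenched laws as regular conditional distributions -/

/-- If the finite-dimensional laws of a process, jointly with the environment, are those of a chain
with transition weights `p ω`, then the regular conditional law of its whole path given the
environment is almost surely the law of this chain. -/
lemma exists_quenched_kernel {S : Type*} [MeasurableSpace S] [Countable S]
    [MeasurableSingletonClass S] [StandardBorelSpace S] [Inhabited S]
    {Ω' : Type*} [MeasurableSpace Ω'] {Pr : Measure Ω'} [IsProbabilityMeasure Pr]
    {P : Measure Env} [IsProbabilityMeasure P] {env : Ω' → Env} {Y : ℕ → Ω' → S}
    (henv : Measurable env) (hY : ∀ n, Measurable (Y n))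
    (w : S → ℝ≥0∞) (p : Env → ℕ → S → S → ℝ≥0∞) (hw : ∑' s, w s = 1)
    (hp : ∀ n s s', Measurable fun ω => p ω n s s')
    (law : ∀ (n : ℕ) (x : ℕ → S) (F : Set Env), MeasurableSet F →
      Pr {a | env a ∈ F ∧ ∀ i ≤ n, Y i a = x i}
        = ∫⁻ ω in F, w (x 0) * ∏ i ∈ Finset.range n, p ω i (x i) (x (i + 1)) ∂P) :
    ∃ Q : Kernel Env (ℕ → S), IsMarkovKernel Q ∧ (∀ᵐ ω ∂P, IsChain w (p ω) (Q ω)) ∧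
      Pr.map (fun a => (env a, fun n => Y n a)) = P ⊗ₘ Q := by
  have hYm : Measurable (fun a n => Y n a) := measurable_pi_lambda _ hY
  have hmap : Pr.map env = P := by
    ext F hF
    rw [Measure.map_apply henv hF]
    have h0 := fun s : S => law 0 (fun _ => s) F hF
    simp only [Finset.range_zero, Finset.prod_empty, mul_one, nonpos_iff_eq_zero, forall_eq,
      lintegral_const, Measure.restrict_apply MeasurableSet.univ, Set.univ_inter] at h0
    have h1 := tsum_measure_preimage_singleton (μ := Pr.restrict (env ⁻¹' F)) (f := Y 0)
      (Set.to_countable (Set.univ : Set S)) (fun y _ => hY 0 (measurableSet_singleton y))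
    rw [tsum_univ (fun y : S => (Pr.restrict (env ⁻¹' F)) (Y 0 ⁻¹' {y}))] at h1
    rw [Set.preimage_univ, Measure.restrict_apply_univ] at h1
    rw [← h1]
    have h2 : ∀ s : S, (Pr.restrict (env ⁻¹' F)) (Y 0 ⁻¹' {s}) = w s * P F := by
      intro s
      rw [Measure.restrict_apply (hY 0 (measurableSet_singleton s)), ← h0 s]
      congr 1
      ext a; simp [and_comm]
    simp_rw [h2, ENNReal.tsum_mul_right, hw, one_mul]
  refine ⟨condDistrib (fun a n => Y n a) env Pr, inferInstance, ?_, ?_⟩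
  · -- Lists enumerate the countably many cylinders, so that one null set serves for all of them.
    have hl : ∀ᵐ ω ∂P, ∀ (n : ℕ) (l : List S),
        condDistrib (fun a n => Y n a) env Pr ω (cyl n fun i => l.getD i default)
          = w (l.getD 0 default)
            * ∏ i ∈ Finset.range n, p ω i (l.getD i default) (l.getD (i + 1) default) := by
      refine ae_all_iff.mpr fun n => ae_all_iff.mpr fun l => ?_
      refine ae_eq_of_forall_setLIntegral_eq_of_sigmaFinite
        (Kernel.measurable_coe _ (measurableSet_cyl _ _))
        ((Finset.measurable_prod (f := fun i ω => p ω i (l.getD i default) (l.getD (i + 1) default))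
          _ fun i _ => hp _ _ _).const_mul _) fun F hF _ => ?_
      rw [← law n (fun i => l.getD i default) F hF]
      conv_lhs => rw [← hmap]
      rw [setLIntegral_map hF (Kernel.measurable_coe _ (measurableSet_cyl _ _)) henv,
        setLIntegral_preimage_condDistrib henv hYm.aemeasurable (measurableSet_cyl _ _) hF]
      congr 1
    filter_upwards [hl] with ω hω n x
    have hx : ∀ i ≤ n, ((List.range (n + 1)).map x).getD i default = x i := by
      intro i hi
      rw [List.getD_eq_getElem _ _ (by simp; omega)]
      simp
    have := hω n ((List.range (n + 1)).map x)
    rw [hx 0 (by omega)] at this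
    rw [Finset.prod_congr rfl (g := fun i => p ω i (x i) (x (i + 1)))] at this
    · rw [← this]
      congr 1
      ext y
      simp only [cyl, Set.mem_ofPred_eq]
      exact forall₂_congr fun i hi => by rw [hx i hi]
    · intro i hi
      have := Finset.mem_range.mp hi
      rw [hx i (by omega), hx (i + 1) (by omega)]
  · conv_rhs => rw [← hmap]
    rw [compProd_map_condDistrib hYm.aemeasurable]

/-! ### The walk on path space: Markov property at the first passage to `1` -/

/-- `Q` is the quenched law, on path space, of the walk in the environment `ω` started at `0`. -/
def IsWalkLaw (ω : Env) (Q : Measure (ℕ → ℤ)) : Prop :=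
  IsChain (fun i : ℤ => if i = 0 then 1 else 0) (fun _ => walkStep ω) Q

/-- The path from time `n` on, recentred by `m`. -/
def pathShift (n : ℕ) (m : ℤ) (y : ℕ → ℤ) : ℕ → ℤ := fun k => y (n + k) - m

/-- The first hitting time of `1`, with value `0` if `1` is never hit. -/
noncomputable def hitOne (y : ℕ → ℤ) : ℕ := sInf {n | y n = 1}

/-- The path from the first passage to `1` on, seen from `1`. -/
noncomputable def afterOne (y : ℕ → ℤ) : ℕ → ℤ := pathShift (hitOne y) 1 y

/-- `1` is hit for the first time at time `n`. -/
def firstAt (n : ℕ) : Set (ℕ → ℤ) := {y | y n = 1 ∧ ∀ k < n, y k ≠ 1}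

lemma measurable_pathShift (n : ℕ) (m : ℤ) : Measurable (pathShift n m) :=
  measurable_pi_lambda _ fun k => (measurable_pi_apply (n + k)).sub measurable_const

lemma determined_firstAt (n : ℕ) : Determined n (firstAt n) := by
  rintro y y' h ⟨h1, h2⟩
  exact ⟨by rw [← h n le_rfl, h1], fun k hk => by rw [← h k hk.le]; exact h2 k hk⟩

lemma hitOne_of_mem {n : ℕ} {y : ℕ → ℤ} (h : y ∈ firstAt n) : hitOne y = n := by
  refine le_antisymm (Nat.sInf_le h.1) ?_
  have hmem : hitOne y ∈ {k | y k = 1} := Nat.sInf_mem ⟨n, h.1⟩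
  by_contra hlt
  exact h.2 _ (not_le.mp hlt) hmem

lemma mem_firstAt_hitOne {y : ℕ → ℤ} (h : ∃ n, y n = 1) : y ∈ firstAt (hitOne y) :=
  ⟨Nat.sInf_mem h, fun _ hk he => hk.not_ge (Nat.sInf_le he)⟩

lemma hitOne_eq_zero {y : ℕ → ℤ} (h : ¬∃ n, y n = 1) : hitOne y = 0 := by
  have : {n | y n = 1} = ∅ := by
    ext n; simpa using fun hn => h ⟨n, hn⟩
  rw [hitOne, this, Nat.sInf_empty]

lemma measurable_hitOne : Measurable hitOne := by
  refine measurable_to_countable' fun n => ?_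
  have hne : MeasurableSet {y : ℕ → ℤ | ¬∃ n, y n = 1} := by
    have : {y : ℕ → ℤ | ¬∃ n, y n = 1} = (⋃ n, {y | y n = 1})ᶜ := by ext; simp
    rw [this]
    exact (MeasurableSet.iUnion fun n => measurableSet_coord_eq n 1).compl
  have : hitOne ⁻¹' {n} = firstAt n ∪ ({y | ¬∃ n, y n = 1} ∩ {_y | n = 0}) := by
    ext y
    simp only [Set.mem_preimage, Set.mem_singleton_iff, Set.mem_union, Set.mem_inter_iff,
      Set.mem_ofPred_eq]
    constructor
    · rintro rfl
      by_cases h : ∃ n, y n = 1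
      · exact Or.inl (mem_firstAt_hitOne h)
      · exact Or.inr ⟨h, hitOne_eq_zero h⟩
    · rintro (h | ⟨h, rfl⟩)
      · exact hitOne_of_mem h
      · exact hitOne_eq_zero h
  rw [this]
  exact (determined_firstAt n).measurableSet.union (hne.inter (MeasurableSet.const _))

lemma measurable_afterOne : Measurable afterOne := by
  refine measurable_pi_lambda _ fun k => ?_
  have : Measurable fun p : ℕ × (ℕ → ℤ) => p.2 (p.1 + k) - 1 :=
    measurable_from_prod_countable_right fun n =>
      (measurable_pi_apply (n + k)).sub measurable_const
  exact this.comp (measurable_hitOne.prodMk measurable_id)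

lemma walkStep_shiftBy (ω : Env) (m i j : ℤ) :
    walkStep (shiftBy m ω) i j = walkStep ω (i + m) (j + m) := by
  have h1 : j + m = i + m + 1 ↔ j = i + 1 := by omega
  have h2 : j + m = i + m - 1 ↔ j = i - 1 := by omega
  simp only [walkStep, shiftBy_apply, h1, h2]

section Markov

variable {ω : Env} {Q Q' : Measure (ℕ → ℤ)}

lemma IsWalkLaw.cyl_eq (h : IsWalkLaw ω Q) (n : ℕ) (x : ℕ → ℤ) :
    Q (cyl n x) = (if x 0 = 0 then 1 else 0)
      * ∏ i ∈ Finset.range n, walkStep ω (x i) (x (i + 1)) := h n x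

/-- The Markov property at a fixed time: the path after time `n` is a walk in the environment
seen from the position at time `n`, independent of the past. -/
lemma IsWalkLaw.markov [IsProbabilityMeasure Q] [IsProbabilityMeasure Q'] {m : ℤ}
    (h : IsWalkLaw ω Q) (h' : IsWalkLaw (shiftBy m ω) Q') {n : ℕ} {D : Set (ℕ → ℤ)}
    (hD : Determined n D) (hDm : ∀ y ∈ D, y n = m) {B : Set (ℕ → ℤ)} (hB : MeasurableSet B) :
    Q (D ∩ pathShift n m ⁻¹' B) = Q D * Q' B := by
  have hcyl : ∀ x : ℕ → ℤ, x n = m →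
      (Q.restrict (cyl n x)).map (pathShift n m) = Q (cyl n x) • Q' := by
    intro x hx
    refine ext_of_cyl fun l z => ?_
    rw [Measure.map_apply (measurable_pathShift n m) (measurableSet_cyl l z),
      Measure.restrict_apply (measurable_pathShift n m (measurableSet_cyl l z)),
      Measure.smul_apply, smul_eq_mul]
    by_cases hz : z 0 = 0
    · -- `u` is the path `x` up to time `n`, followed by the path `z` started at `m`.
      set u : ℕ → ℤ := fun i => if i ≤ n then x i else z (i - n) + m with hu
      have hu1 : ∀ i ≤ n, u i = x i := fun i hi => if_pos hi
      have hu2 : ∀ k, u (n + k) = z k + m := by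
        intro k
        rcases k.eq_zero_or_pos with rfl | hk
        · rw [add_zero, hu1 n le_rfl, hx, hz, zero_add]
        · simp only [hu]; rw [if_neg (by omega)]; congr 2; omega
      have hset : pathShift n m ⁻¹' cyl l z ∩ cyl n x = cyl (n + l) u := by
        ext y
        simp only [cyl, pathShift, Set.mem_inter_iff, Set.mem_preimage, Set.mem_ofPred_eq]
        constructor
        · rintro ⟨ha, hb⟩ i hi
          rcases le_or_gt i n with hin | hin
          · rw [hu1 i hin, hb i hin]
          · obtain ⟨k, rfl⟩ := Nat.exists_eq_add_of_lt hin
            have := ha (k + 1) (by omega)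
            have h3 := hu2 (k + 1)
            rw [add_assoc]; omega
        · intro hy
          refine ⟨fun i hi => ?_, fun i hi => ?_⟩
          · rw [hy (n + i) (by omega), hu2 i]; omega
          · rw [hy i (by omega), hu1 i hi]
      rw [hset, h.cyl_eq, h.cyl_eq, h'.cyl_eq, Finset.prod_range_add, hu1 0 (by omega), hz,
        if_pos rfl, one_mul, mul_assoc]
      congr 2
      · refine Finset.prod_congr rfl fun i hi => ?_
        have := Finset.mem_range.mp hi
        rw [hu1 i (by omega), hu1 (i + 1) (by omega)]
      · refine Finset.prod_congr rfl fun i hi => ?_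
        rw [hu2, add_assoc, hu2, walkStep_shiftBy]
    · have hset : pathShift n m ⁻¹' cyl l z ∩ cyl n x = ∅ := by
        ext y
        simp only [cyl, pathShift, Set.mem_inter_iff, Set.mem_preimage, Set.mem_ofPred_eq,
          Set.mem_empty_iff_false, iff_false, not_and]
        intro ha hb
        have h1 := ha 0 (by omega)
        have h2 := hb n le_rfl
        rw [add_zero, h2, hx] at h1
        exact hz (by omega)
      rw [hset, measure_empty, h'.cyl_eq, if_neg hz, zero_mul, mul_zero]
  have hm := measurable_pathShift n m hB
  have key := measure_eq_of_determined
    (m₁ := (Q.restrict {y | y n = m}).restrict (pathShift n m ⁻¹' B))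
    (m₂ := Q' B • Q.restrict {y | y n = m}) (n := n) (fun x => ?_) hD
  · have hDD : D ∩ {y | y n = m} = D := Set.inter_eq_left.mpr hDm
    rw [Measure.restrict_apply hD.measurableSet,
      Measure.restrict_apply (hD.measurableSet.inter hm), Measure.smul_apply,
      Measure.restrict_apply hD.measurableSet, hDD, smul_eq_mul, mul_comm, Set.inter_right_comm,
      hDD] at key
    exact key
  · have hc := measurableSet_cyl n x
    rw [Measure.restrict_apply hc, Measure.restrict_apply (hc.inter hm), Measure.smul_apply,
      Measure.restrict_apply hc, smul_eq_mul, Set.inter_right_comm]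
    by_cases hx : x n = m
    · have hcc : cyl n x ∩ {y | y n = m} = cyl n x :=
        Set.inter_eq_left.mpr fun y hy => by
          change y n = m
          rw [hy n le_rfl, hx]
      have := congrArg (fun μ => μ B) (hcyl x hx)
      rw [Measure.map_apply (measurable_pathShift n m) hB, Measure.restrict_apply hm,
        Measure.smul_apply, smul_eq_mul] at this
      rw [hcc, Set.inter_comm, this, mul_comm]
    · have hcc : cyl n x ∩ {y | y n = m} = ∅ := by
        ext y
        simp only [Set.mem_inter_iff, Set.mem_ofPred_eq, Set.mem_empty_iff_false, iff_false, not_and]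
        intro ha hb
        exact hx (by rw [← ha n le_rfl, hb])
      rw [hcc]; simp

/-- The strong Markov property at the first passage to `1`. -/
lemma IsWalkLaw.strong_markov [IsProbabilityMeasure Q] [IsProbabilityMeasure Q']
    (h : IsWalkLaw ω Q) (h' : IsWalkLaw (shiftBy 1 ω) Q') (hhit : ∀ᵐ y ∂Q, ∃ n, y n = 1)
    {D : Set (ℕ → ℤ)} (hD : ∀ n, Determined n (D ∩ firstAt n))
    {B : Set (ℕ → ℤ)} (hB : MeasurableSet B) :
    Q (D ∩ afterOne ⁻¹' B) = Q D * Q' B := by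
  have hdisj : Pairwise (Function.onFun Disjoint firstAt) := by
    intro i j hij
    refine Set.disjoint_left.mpr fun y hi hj => hij ?_
    rw [← hitOne_of_mem hi, hitOne_of_mem hj]
  -- Split according to the first passage time, and use the Markov property at that time.
  have hsplit : ∀ A : Set (ℕ → ℤ), Q A = ∑' n, Q (A ∩ firstAt n) := by
    intro A
    rw [← Measure.restrict_apply_univ, ← measure_congr (s := ⋃ n, firstAt n)]
    · rw [measure_iUnion hdisj fun n => (determined_firstAt n).measurableSet]
      refine tsum_congr fun n => ?_
      rw [Measure.restrict_apply (determined_firstAt n).measurableSet, Set.inter_comm]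
    · refine eventuallyEq_univ.mpr ?_
      filter_upwards [ae_restrict_of_ae hhit] with y hy
      exact Set.mem_iUnion.mpr ⟨_, mem_firstAt_hitOne hy⟩
  rw [hsplit, hsplit D, ← ENNReal.tsum_mul_right]
  refine tsum_congr fun n => ?_
  rw [← h.markov h' (hD n) (fun y hy => hy.2.1) hB]
  congr 1
  ext y
  simp only [Set.mem_inter_iff, Set.mem_preimage]
  constructor
  · rintro ⟨⟨h1, h2⟩, h3⟩
    exact ⟨⟨h1, h3⟩, by rwa [afterOne, hitOne_of_mem h3] at h2⟩
  · rintro ⟨⟨h1, h3⟩, h2⟩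
    exact ⟨⟨h1, by rwa [afterOne, hitOne_of_mem h3]⟩, h3⟩

end Markov

/-! ### Expected numbers of crossings and transience -/

/-- The path starts at `0` and makes steps `±1`. -/
def NearestNeighbour (y : ℕ → ℤ) : Prop :=
  y 0 = 0 ∧ ∀ k, y (k + 1) = y k + 1 ∨ y (k + 1) = y k - 1

/-- The expected number of steps from `i` to `j` made before time `N` and while the events
`D k` hold. -/
noncomputable def flow (Q : Measure (ℕ → ℤ)) (D : ℕ → Set (ℕ → ℤ)) (N : ℕ) (i j : ℤ) : ℝ≥0∞ :=
  ∑ k ∈ Finset.range N, Q (D k ∩ {y | y k = i ∧ y (k + 1) = j})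

/-- The number of steps from `i` to `j` before time `N`. -/
def stepCount (y : ℕ → ℤ) (N : ℕ) (i j : ℤ) : ℕ :=
  ∑ k ∈ Finset.range N, if y k = i ∧ y (k + 1) = j then 1 else 0

/-- Up-crossings and down-crossings of the edge `{i, i + 1}` alternate. -/
lemma stepCount_balance {y : ℕ → ℤ} (hy : NearestNeighbour y) (N : ℕ) (i : ℤ) :
    stepCount y N i (i + 1) + (if i < 0 then 1 else 0)
      = stepCount y N (i + 1) i + (if i < y N then 1 else 0) := by
  induction N with
  | zero => simp [stepCount, hy.1]
  | succ N ih =>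
    have h1 : ∀ i j, stepCount y (N + 1) i j
        = stepCount y N i j + if y N = i ∧ y (N + 1) = j then 1 else 0 :=
      fun i j => Finset.sum_range_succ _ _
    rw [h1, h1]
    have := hy.2 N
    split_ifs at * <;> omega

/-- Decreasing events `D k`, read as being alive at time `k`, amount to a time of death. -/
lemma exists_alive {D : ℕ → Set (ℕ → ℤ)} (hD : Antitone D) (y : ℕ → ℤ) (N : ℕ) :
    ∃ N' ≤ N, ∀ k < N, (y ∈ D k ↔ k < N') := by
  induction N with
  | zero => exact ⟨0, le_rfl, by simp⟩
  | succ N ih =>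
    by_cases h : y ∈ D N
    · refine ⟨N + 1, le_rfl, fun k hk => ⟨fun _ => hk, fun _ => hD (by omega) h⟩⟩
    · obtain ⟨N', hN', h'⟩ := ih
      refine ⟨N', by omega, fun k hk => ?_⟩
      rcases Nat.lt_or_ge k N with hlt | hge
      · exact h' k hlt
      · obtain rfl : k = N := by omega
        exact ⟨fun hk => absurd hk h, fun hk => by omega⟩

lemma walkStep_up (ω : Env) (i : ℤ) : walkStep ω i (i + 1) = ENNReal.ofReal (ω i : ℝ) := by
  simp [walkStep]

lemma walkStep_down (ω : Env) (i : ℤ) : walkStep ω i (i - 1) = ENNReal.ofReal (1 - (ω i : ℝ)) := by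
  rw [walkStep, if_neg (by omega), if_pos rfl]

lemma walkStep_down_eq (ω : Env) (i : ℤ) :
    walkStep ω i (i - 1) = rhoE ω i * walkStep ω i (i + 1) := by
  have := (ω i).2.1
  rw [walkStep_up, walkStep_down, rhoE, ← ENNReal.ofReal_mul (rho_pos ω i).le, rho,
    div_mul_cancel₀ _ this.ne']

lemma walkStep_add (ω : Env) (i : ℤ) : walkStep ω i (i + 1) + walkStep ω i (i - 1) = 1 := by
  have := (ω i).2
  rw [walkStep_up, walkStep_down, ← ENNReal.ofReal_add this.1.le (by linarith [this.2])]
  simp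

section Flow

variable {ω : Env} {Q : Measure (ℕ → ℤ)}

lemma IsWalkLaw.ae_nearestNeighbour (h : IsWalkLaw ω Q) : ∀ᵐ y ∂Q, NearestNeighbour y := by
  have huniv : ∀ n, Determined n (Set.univ : Set (ℕ → ℤ)) := fun n y y' _ _ => trivial
  have h0 : ∀ᵐ y ∂Q, y 0 = 0 := by
    have : ∀ᵐ y ∂Q, ∀ i : ℤ, i ≠ 0 → y 0 ≠ i := by
      refine ae_all_iff.mpr fun i => ?_
      by_cases hi : i = 0
      · exact Eventually.of_forall fun _ h => absurd hi h
      · have : Q (cyl 0 fun _ => i) = 0 := by rw [h.cyl_eq, if_neg hi, zero_mul]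
        filter_upwards [measure_eq_zero_iff_ae_notMem.mp this] with y hy _ he
        exact hy fun k hk => by rw [Nat.le_zero.mp hk, he]
    filter_upwards [this] with y hy
    by_contra hne
    exact hy _ hne rfl
  have h1 : ∀ᵐ y ∂Q, ∀ (k : ℕ) (i j : ℤ), ¬(j = i + 1 ∨ j = i - 1) →
      ¬(y k = i ∧ y (k + 1) = j) := by
    refine ae_all_iff.mpr fun k => ae_all_iff.mpr fun i => ae_all_iff.mpr fun j => ?_
    by_cases hj : j = i + 1 ∨ j = i - 1
    · exact Eventually.of_forall fun _ h => absurd hj h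
    · push Not at hj
      have := IsChain.step h (huniv k) i j
      rw [Set.univ_inter, walkStep, if_neg hj.1, if_neg hj.2, mul_zero] at this
      filter_upwards [measure_eq_zero_iff_ae_notMem.mp this] with y hy _
      exact hy
  filter_upwards [h0, h1] with y hy0 hy1
  refine ⟨hy0, fun k => ?_⟩
  by_contra hne
  exact hy1 k (y k) (y (k + 1)) hne ⟨rfl, rfl⟩

variable {D : ℕ → Set (ℕ → ℤ)}

lemma IsWalkLaw.flow_eq (h : IsWalkLaw ω Q) (hD : ∀ k, Determined k (D k)) (N : ℕ) (i j : ℤ) :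
    flow Q D N i j
      = (∑ k ∈ Finset.range N, Q (D k ∩ {y | y k = i})) * walkStep ω i j := by
  rw [flow, Finset.sum_mul]
  exact Finset.sum_congr rfl fun k _ => IsChain.step h (hD k) i j

lemma IsWalkLaw.flow_down (h : IsWalkLaw ω Q) (hD : ∀ k, Determined k (D k)) (N : ℕ) (i : ℤ) :
    flow Q D N i (i - 1) = rhoE ω i * flow Q D N i (i + 1) := by
  rw [h.flow_eq hD, h.flow_eq hD, walkStep_down_eq]
  ring

lemma IsWalkLaw.visits_eq (h : IsWalkLaw ω Q) (hD : ∀ k, Determined k (D k)) (N : ℕ) (i : ℤ) :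
    ∑ k ∈ Finset.range N, Q (D k ∩ {y | y k = i})
      = flow Q D N i (i + 1) + flow Q D N i (i - 1) := by
  rw [h.flow_eq hD, h.flow_eq hD, ← mul_add, walkStep_add, mul_one]

variable [IsProbabilityMeasure Q]

/-- Pathwise, the steps from `i` to `i + 1` exceed those from `i + 1` to `i` by at most one, and do
not exceed them if `i < 0`. -/
lemma IsWalkLaw.flow_up_le (h : IsWalkLaw ω Q) (hD : ∀ k, Determined k (D k)) (hA : Antitone D)
    (N : ℕ) (i : ℤ) :
    flow Q D N i (i + 1) ≤ flow Q D N (i + 1) i + if 0 ≤ i then 1 else 0 := by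
  classical
  have hm : ∀ (k : ℕ) (i j : ℤ), MeasurableSet (D k ∩ {y | y k = i ∧ y (k + 1) = j}) :=
    fun k i j => (hD k).measurableSet.inter
      ((measurableSet_coord_eq k i).inter (measurableSet_coord_eq (k + 1) j))
  have hflow : ∀ i j, flow Q D N i j = ∫⁻ y, ∑ k ∈ Finset.range N,
      (D k ∩ {y | y k = i ∧ y (k + 1) = j}).indicator (fun _ => (1 : ℝ≥0∞)) y ∂Q := by
    intro i j
    rw [lintegral_finsetSum _ fun k _ => measurable_const.indicator (hm k i j)]
    refine Finset.sum_congr rfl fun k _ => ?_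
    rw [lintegral_indicator_const (hm k i j), one_mul]
  have hcount : ∀ y : ℕ → ℤ, ∃ N' : ℕ, ∀ i j, ∑ k ∈ Finset.range N,
      (D k ∩ {y | y k = i ∧ y (k + 1) = j}).indicator (fun _ => (1 : ℝ≥0∞)) y
        = (stepCount y N' i j : ℝ≥0∞) := by
    intro y
    obtain ⟨N', hN', hal⟩ := exists_alive hA y N
    refine ⟨N', fun i j => ?_⟩
    rw [stepCount, Nat.cast_sum]
    symm
    refine Finset.sum_subset_zero_on_sdiff (Finset.range_mono hN') ?_ ?_
    · intro k hk
      simp only [Finset.mem_sdiff, Finset.mem_range] at hk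
      refine Set.indicator_of_notMem (fun hmem => ?_) _
      exact hk.2 ((hal k hk.1).mp hmem.1)
    · intro k hk
      have hk' := Finset.mem_range.mp hk
      have hmem : y ∈ D k := (hal k (by omega)).mpr hk'
      simp [Set.indicator_apply, hmem]
  rw [hflow, hflow]
  have hconst : (if 0 ≤ i then (1 : ℝ≥0∞) else 0) = ∫⁻ _y, (if 0 ≤ i then (1 : ℝ≥0∞) else 0) ∂Q := by
    simp
  rw [hconst, ← lintegral_add_right _ measurable_const]
  refine lintegral_mono_ae ?_
  filter_upwards [h.ae_nearestNeighbour] with y hy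
  obtain ⟨N', hN'⟩ := hcount y
  rw [hN', hN']
  have := stepCount_balance hy N' i
  have hle : stepCount y N' i (i + 1) ≤ stepCount y N' (i + 1) i + if 0 ≤ i then 1 else 0 := by
    split_ifs at * <;> omega
  calc (stepCount y N' i (i + 1) : ℝ≥0∞)
      ≤ ((stepCount y N' (i + 1) i + if 0 ≤ i then 1 else 0 : ℕ) : ℝ≥0∞) := by exact_mod_cast hle
    _ = _ := by push_cast; rfl

/-- The recursion for the expected numbers of steps to the left. -/
lemma IsWalkLaw.flow_down_le (h : IsWalkLaw ω Q) (hD : ∀ k, Determined k (D k)) (hA : Antitone D)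
    (N : ℕ) (i : ℤ) :
    flow Q D N i (i - 1)
      ≤ rhoE ω i * (flow Q D N (i + 1) (i + 1 - 1) + if 0 ≤ i then 1 else 0) := by
  rw [h.flow_down hD, add_sub_cancel_right]
  gcongr
  exact h.flow_up_le hD hA N i

/-- The recursion iterated along the negative sites. -/
lemma IsWalkLaw.flow_down_neg_le (h : IsWalkLaw ω Q) (hD : ∀ k, Determined k (D k))
    (hA : Antitone D) (N k : ℕ) :
    flow Q D N (-(k : ℤ)) (-(k : ℤ) - 1)
      ≤ (∏ l ∈ Finset.range k, rhoE ω (-1 - (l : ℤ))) * flow Q D N 0 (-1) := by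
  induction k with
  | zero => simp
  | succ k ih =>
    have h1 := h.flow_down_le hD hA N (-((k + 1 : ℕ) : ℤ))
    have e1 : -((k + 1 : ℕ) : ℤ) + 1 = -k := by push_cast; ring
    rw [if_neg (by omega), add_zero, e1] at h1
    refine h1.trans ?_
    rw [Finset.prod_range_succ]
    have e2 : -((k + 1 : ℕ) : ℤ) = -1 - k := by push_cast; ring
    rw [e2]
    calc _ ≤ rhoE ω (-1 - k) * ((∏ l ∈ Finset.range k, rhoE ω (-1 - (l : ℤ)))
          * flow Q D N 0 (-1)) := by gcongr
      _ = _ := by ring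

lemma IsWalkLaw.visits_le (h : IsWalkLaw ω Q) (hD : ∀ k, Determined k (D k)) (hA : Antitone D)
    (N : ℕ) (i : ℤ) :
    ∑ k ∈ Finset.range N, Q (D k ∩ {y | y k = i})
      ≤ flow Q D N (i + 1) i + (if 0 ≤ i then 1 else 0) + flow Q D N i (i - 1) := by
  rw [h.visits_eq hD]
  gcongr
  exact h.flow_up_le hD hA N i

/-- Without killing, the expected number of left steps from `i ≥ 0` is bounded by the sum of
the forward products of `ρ`. -/
lemma IsWalkLaw.flow_down_le_forward (h : IsWalkLaw ω Q) (N : ℕ) {i : ℤ} (hi : 0 ≤ i) :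
    flow Q (fun _ => Set.univ) N i (i - 1)
      ≤ ∑' n : ℕ, ∏ k ∈ Finset.range n, rhoE (shiftBy i ω) k := by
  have huniv : ∀ n : ℕ, Determined n ((fun _ => Set.univ : ℕ → Set (ℕ → ℤ)) n) :=
    fun n y y' _ _ => trivial
  set d : ℤ → ℝ≥0∞ := fun i => flow Q (fun _ => Set.univ) N i (i - 1) with hd
  have key : ∀ M : ℕ, d i ≤ ∑ j ∈ Finset.range M, ∏ l ∈ Finset.range (j + 1), rhoE ω (l + i)
      + (∏ l ∈ Finset.range M, rhoE ω (l + i)) * d (i + M) := by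
    intro M
    induction M with
    | zero => simp
    | succ M ih =>
      refine ih.trans ?_
      have h1 := h.flow_down_le huniv antitone_const N (i + M)
      rw [if_pos (by omega)] at h1
      rw [Finset.sum_range_succ, Finset.prod_range_succ]
      have e1 : i + ((M + 1 : ℕ) : ℤ) = i + M + 1 := by push_cast; ring
      rw [e1]
      calc _ ≤ ∑ j ∈ Finset.range M, ∏ l ∈ Finset.range (j + 1), rhoE ω (l + i)
            + (∏ l ∈ Finset.range M, rhoE ω (l + i))
              * (rhoE ω (i + M) * (d (i + M + 1) + 1)) := by gcongr
        _ = _ := by rw [add_comm i (M : ℤ)]; ring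
  -- The walk does not get to `i + N` in fewer than `N` steps.
  have hzero : d (i + N) = 0 := by
    refine Finset.sum_eq_zero fun k hk => ?_
    have hk := Finset.mem_range.mp hk
    rw [Set.univ_inter, measure_eq_zero_iff_ae_notMem]
    filter_upwards [h.ae_nearestNeighbour] with y hy
    have hle : ∀ k : ℕ, y k ≤ k := by
      intro k
      induction k with
      | zero => simp [hy.1]
      | succ k ih => have := hy.2 k; push_cast; omega
    intro hmem
    have h1 := hle k
    have h2 : y k = i + N := hmem.1
    omega
  refine (key N).trans ?_
  rw [hzero, mul_zero, add_zero]
  have hsub := ENNReal.tsum_comp_le_tsum_of_injective (add_left_injective 1)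
    (fun n : ℕ => ∏ k ∈ Finset.range n, rhoE (shiftBy i ω) k)
  exact (ENNReal.sum_le_tsum (f := fun j : ℕ => ∏ k ∈ Finset.range (j + 1), rhoE (shiftBy i ω) k)
    (Finset.range N)).trans hsub

/-- If the sums of forward and backward products of `ρ` are finite, then the walk tends
to `+∞`. -/
lemma IsWalkLaw.ae_tendsto_atTop (h : IsWalkLaw ω Q)
    (hf : ∀ i : ℤ, ∑' n : ℕ, ∏ k ∈ Finset.range n, rhoE (shiftBy i ω) k ≠ ⊤)
    (hb : ∑' n : ℕ, ∏ k ∈ Finset.range n, rhoE ω (-1 - k) ≠ ⊤) :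
    ∀ᵐ y ∂Q, Tendsto y atTop atTop := by
  have huniv : ∀ n : ℕ, Determined n ((fun _ => Set.univ : ℕ → Set (ℕ → ℤ)) n) :=
    fun n y y' _ _ => trivial
  set F : ℤ → ℝ≥0∞ := fun i => ∑' n : ℕ, ∏ k ∈ Finset.range n, rhoE (shiftBy i ω) k with hF
  -- By the Borel–Cantelli lemma it suffices that the expected numbers of visits to each `i ≥ 0` and
  -- to the negative half-line are finite.
  have hpos : ∀ i : ℤ, 0 ≤ i → ∑' k, Q {y | y k = i} ≠ ⊤ := by
    intro i hi
    refine ne_top_of_le_ne_top (b := F (i + 1) + 1 + F i)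
      (ENNReal.add_ne_top.mpr ⟨ENNReal.add_ne_top.mpr ⟨hf _, ENNReal.one_ne_top⟩, hf _⟩) ?_
    refine ENNReal.tsum_le_of_sum_range_le fun N => ?_
    have h1 := h.visits_le huniv antitone_const N i
    simp only [Set.univ_inter, if_pos hi] at h1
    refine h1.trans ?_
    have h2 := h.flow_down_le_forward N (show 0 ≤ i + 1 by omega)
    rw [add_sub_cancel_right] at h2
    gcongr
    exact h.flow_down_le_forward N hi
  have hneg : ∑' k, Q {y | y k < 0} ≠ ⊤ := by
    set b : ℕ → ℝ≥0∞ := fun n => ∏ k ∈ Finset.range n, rhoE ω (-1 - k) with hbdef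
    have hd : ∀ N k : ℕ, flow Q (fun _ => Set.univ) N (-(k : ℤ)) (-(k : ℤ) - 1) ≤ b k * F 0 := by
      intro N k
      refine (h.flow_down_neg_le huniv antitone_const N k).trans ?_
      gcongr
      have h0 := h.flow_down_le_forward N (le_refl 0)
      rwa [zero_sub] at h0
    have hv : ∀ j : ℕ, ∑' k, Q {y | y k = -((j + 1 : ℕ) : ℤ)} ≤ b j * F 0 + b (j + 1) * F 0 := by
      intro j
      refine ENNReal.tsum_le_of_sum_range_le fun N => ?_
      have h1 := h.visits_le huniv antitone_const N (-((j + 1 : ℕ) : ℤ))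
      have e1 : -((j + 1 : ℕ) : ℤ) + 1 = -j := by push_cast; ring
      have e2 : -((j + 1 : ℕ) : ℤ) = -j - 1 := by push_cast; ring
      simp only [Set.univ_inter] at h1
      rw [if_neg (by omega), add_zero, e1] at h1
      refine h1.trans (add_le_add ?_ (hd N (j + 1)))
      rw [e2]
      exact hd N j
    have hle : ∑' k, Q {y | y k < 0} ≤ ∑' j : ℕ, (b j * F 0 + b (j + 1) * F 0) := by
      calc ∑' k, Q {y | y k < 0}
          ≤ ∑' k, ∑' j : ℕ, Q {y | y k = -((j + 1 : ℕ) : ℤ)} := by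
            refine ENNReal.tsum_le_tsum fun k => ?_
            refine (measure_mono ?_).trans (measure_iUnion_le _)
            intro y hy
            have hy : y k < 0 := hy
            refine Set.mem_iUnion.mpr ⟨(-y k - 1).toNat, ?_⟩
            change y k = _
            omega
        _ = ∑' j : ℕ, ∑' k, Q {y | y k = -((j + 1 : ℕ) : ℤ)} := ENNReal.tsum_comm
        _ ≤ _ := ENNReal.tsum_le_tsum hv
    refine ne_top_of_le_ne_top ?_ hle
    rw [ENNReal.tsum_add, ENNReal.tsum_mul_right, ENNReal.tsum_mul_right]
    have h2 : ∑' j : ℕ, b (j + 1) ≠ ⊤ := ne_top_of_le_ne_top hb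
      (ENNReal.tsum_comp_le_tsum_of_injective (add_left_injective 1) b)
    exact ENNReal.add_ne_top.mpr ⟨ENNReal.mul_ne_top hb (hf 0), ENNReal.mul_ne_top h2 (hf 0)⟩
  have h1 : ∀ᵐ y ∂Q, ∀ i : ℕ, ∀ᶠ k in atTop, y k ≠ (i : ℤ) := by
    refine ae_all_iff.mpr fun i => ?_
    filter_upwards [ae_eventually_notMem (hpos i (by omega))] with y hy
    exact hy
  filter_upwards [h1, ae_eventually_notMem hneg] with y hy hy0
  refine tendsto_atTop.mpr fun b => ?_
  have h3 : ∀ᶠ k in atTop, ∀ i ∈ Finset.range b.toNat, y k ≠ (i : ℤ) :=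
    (Finset.eventually_all _).mpr fun i _ => hy i
  filter_upwards [hy0, h3] with k hk hk3
  have hk : ¬ y k < 0 := hk
  by_contra hlt
  refine hk3 (y k).toNat (Finset.mem_range.mpr (by omega)) (by omega)

/-- The quenched expectation of the first passage time to `1` is bounded through the sum of
backward products of `ρ`. -/
lemma IsWalkLaw.lintegral_hitOne_le (h : IsWalkLaw ω Q) :
    ∫⁻ y, (hitOne y : ℝ≥0∞) ∂Q
      ≤ 1 + 2 * ∑' n : ℕ, ∏ k ∈ Finset.range (n + 1), rhoE ω (0 - k) := by
  -- The walk is killed at `1`, so that it never steps down from `1`.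
  set D : ℕ → Set (ℕ → ℤ) := fun k => {y | ∀ j ≤ k, y j ≠ 1} with hDdef
  have hD : ∀ k, Determined k (D k) := fun k y y' hy hmem j hj => by
    rw [← hy j hj]; exact hmem j hj
  have hA : Antitone D := fun k l hkl y hy j hj => hy j (hj.trans hkl)
  set b : ℕ → ℝ≥0∞ := fun n => ∏ k ∈ Finset.range (n + 1), rhoE ω (0 - k) with hb
  have hone : ∀ N, flow Q D N 1 0 = 0 := by
    intro N
    refine Finset.sum_eq_zero fun k _ => ?_
    have : D k ∩ {y | y k = 1 ∧ y (k + 1) = 0} = ∅ := by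
      ext y
      simp only [Set.mem_inter_iff, Set.mem_ofPred_eq, Set.mem_empty_iff_false, iff_false, not_and]
      intro h1 h2
      exact absurd h2 (h1 k le_rfl)
    rw [this, measure_empty]
  have hzero : ∀ N, flow Q D N 0 (-1) ≤ rhoE ω 0 := by
    intro N
    have := h.flow_down_le hD hA N 0
    simpa [hone] using this
  have hd : ∀ N k : ℕ, flow Q D N (-(k : ℤ)) (-(k : ℤ) - 1) ≤ b k := by
    intro N k
    refine (h.flow_down_neg_le hD hA N k).trans ?_
    rw [hb]
    simp only
    rw [Finset.prod_range_succ']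
    have e : ∀ l : ℕ, (0 : ℤ) - ((l + 1 : ℕ) : ℤ) = -1 - l := fun l => by push_cast; ring
    simp only [e]
    gcongr
    simpa using hzero N
  have hv : ∀ j : ℕ, ∑' k, Q (D k ∩ {y | y k = -(j : ℤ)})
      ≤ (if j = 0 then 1 else b (j - 1)) + b j := by
    intro j
    refine ENNReal.tsum_le_of_sum_range_le fun N => ?_
    refine (h.visits_le hD hA N (-(j : ℤ))).trans (add_le_add ?_ (hd N j))
    rcases j with _ | j
    · simp [hone]
    · have e1 : -((j + 1 : ℕ) : ℤ) + 1 = -j := by push_cast; ring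
      have e2 : -((j + 1 : ℕ) : ℤ) = -j - 1 := by push_cast; ring
      rw [if_neg (by omega), add_zero, e1, e2]
      simpa using hd N j
  have hT : ∀ n : ℕ, (n : ℝ≥0∞) = ∑' k : ℕ, if k < n then 1 else 0 := by
    intro n
    rw [tsum_eq_sum (s := Finset.range n) fun k hk => if_neg (by simpa using hk)]
    rw [Finset.sum_congr rfl fun k hk => if_pos (Finset.mem_range.mp hk)]
    simp
  have hm : ∀ k : ℕ, MeasurableSet {y : ℕ → ℤ | k < hitOne y} := fun k =>
    measurableSet_lt measurable_const measurable_hitOne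
  calc ∫⁻ y, (hitOne y : ℝ≥0∞) ∂Q
      = ∑' k : ℕ, Q {y | k < hitOne y} := by
        simp_rw [hT]
        rw [lintegral_tsum fun k => (Measurable.ite (hm k) measurable_const
          measurable_const).aemeasurable]
        refine tsum_congr fun k => ?_
        rw [← lintegral_indicator_one (hm k)]
        refine lintegral_congr fun y => ?_
        simp [Set.indicator_apply]
    _ ≤ ∑' k : ℕ, ∑' j : ℕ, Q (D k ∩ {y | y k = -(j : ℤ)}) := by
        refine ENNReal.tsum_le_tsum fun k => ?_
        refine (measure_mono_ae ?_).trans (measure_iUnion_le _)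
        filter_upwards [h.ae_nearestNeighbour] with y hy hk
        have hk : k < hitOne y := hk
        have hDk : y ∈ D k := fun j hj he => by
          have : hitOne y ≤ j := Nat.sInf_le he
          omega
        have hle : ∀ l ≤ k, y l ≤ 0 := by
          intro l
          induction l with
          | zero => simp [hy.1]
          | succ l ih =>
            intro hl
            have h1 := ih (by omega)
            have h2 := hDk (l + 1) hl
            have h3 := hy.2 l
            omega
        refine Set.mem_iUnion.mpr ⟨(-y k).toNat, hDk, ?_⟩
        have := hle k le_rfl
        change y k = _
        omega
    _ = ∑' j : ℕ, ∑' k : ℕ, Q (D k ∩ {y | y k = -(j : ℤ)}) := ENNReal.tsum_comm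
    _ ≤ ∑' j : ℕ, ((if j = 0 then 1 else b (j - 1)) + b j) := ENNReal.tsum_le_tsum hv
    _ = 1 + 2 * ∑' n, b n := by
        rw [ENNReal.tsum_add, tsum_eq_zero_add' ENNReal.summable]
        simp only [if_true, Nat.add_eq_zero_iff, one_ne_zero, and_false, if_false,
          Nat.add_sub_cancel]
        rw [add_assoc, two_mul]

end Flow

/-! ### Hitting times along a transient nearest neighbour path -/

/-- Nearest neighbour paths from `0` that tend to `+∞`. -/
def GoodPath (y : ℕ → ℤ) : Prop := NearestNeighbour y ∧ Tendsto y atTop atTop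

/-- The hitting time of `n`, as a Birkhoff sum of the first passage time to `1`. -/
noncomputable def hitTime (n : ℕ) (y : ℕ → ℤ) : ℕ := birkhoffSum afterOne hitOne n y

/-- The number of steps before the first passage to `1` that remain when the walk is reflected
at `-j`: each excursion from `-j` to `-j + 1` counts for one step. -/
noncomputable def cutTime (j : ℕ) (y : ℕ → ℤ) : ℕ :=
  ∑ k ∈ Finset.range (hitOne y), if -(j : ℤ) < y k ∨ (y k = -j ∧ y (k + 1) = -j + 1) then 1 else 0

/-- The hitting time of `n` for the walk reflected at `-j`. The reflection level moves with the
origin of the recentred paths. -/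
noncomputable def cutSum (j n : ℕ) (y : ℕ → ℤ) : ℕ :=
  ∑ i ∈ Finset.range n, cutTime (j + i) (afterOne^[i] y)

lemma NearestNeighbour.exists_eq_one {y : ℕ → ℤ} (h : NearestNeighbour y)
    (h1 : ∃ n, 1 ≤ y n) : ∃ n, y n = 1 := by
  obtain ⟨n, hn⟩ := h1
  induction n with
  | zero => rw [h.1] at hn; omega
  | succ n ih =>
    by_cases h2 : 1 ≤ y n
    · exact ih h2
    · exact ⟨n + 1, by have := h.2 n; omega⟩

lemma GoodPath.hits {y : ℕ → ℤ} (h : GoodPath y) : ∃ n, y n = 1 :=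
  h.1.exists_eq_one (h.2.eventually_ge_atTop 1).exists

lemma NearestNeighbour.le_zero_of_lt_hitOne {y : ℕ → ℤ} (h : NearestNeighbour y) {k : ℕ}
    (hk : k < hitOne y) : y k ≤ 0 := by
  induction k with
  | zero => simp [h.1]
  | succ k ih =>
    have h1 := ih (by omega)
    have h2 : y (k + 1) ≠ 1 := fun he => by
      have : hitOne y ≤ k + 1 := Nat.sInf_le he
      omega
    have h3 := h.2 k
    omega

lemma GoodPath.pathShift {y : ℕ → ℤ} (h : GoodPath y) (n : ℕ) {m : ℤ} (hm : y n = m) :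
    GoodPath (pathShift n m y) := by
  refine ⟨⟨by simp [RWRE.pathShift, hm], fun k => ?_⟩, ?_⟩
  · have := h.1.2 (n + k)
    simp only [RWRE.pathShift, ← add_assoc]
    omega
  · have : Tendsto (fun k => n + k) atTop atTop :=
      tendsto_atTop_mono (fun k => Nat.le_add_left k n) tendsto_id
    exact tendsto_atTop_add_const_right _ (-m) (h.2.comp this)

lemma GoodPath.afterOne {y : ℕ → ℤ} (h : GoodPath y) : GoodPath (afterOne y) :=
  h.pathShift _ (mem_firstAt_hitOne h.hits).1

lemma GoodPath.iterate_afterOne {y : ℕ → ℤ} (h : GoodPath y) (n : ℕ) :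
    GoodPath (RWRE.afterOne^[n] y) := by
  induction n with
  | zero => exact h
  | succ n ih => rw [Function.iterate_succ_apply']; exact ih.afterOne

lemma hitTime_zero (y : ℕ → ℤ) : hitTime 0 y = 0 := birkhoffSum_zero _ _ _

lemma hitTime_succ (n : ℕ) (y : ℕ → ℤ) :
    hitTime (n + 1) y = hitTime n y + hitOne (afterOne^[n] y) := birkhoffSum_succ _ _ _ _

lemma hitTime_add (m n : ℕ) (y : ℕ → ℤ) :
    hitTime (m + n) y = hitTime m y + hitTime n (afterOne^[m] y) := birkhoffSum_add _ _ _ _ _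

lemma hitTime_mono (y : ℕ → ℤ) : Monotone fun n => hitTime n y :=
  monotone_nat_of_le_succ fun n => by rw [hitTime_succ]; omega

lemma iterate_afterOne_apply (n k : ℕ) (y : ℕ → ℤ) :
    (afterOne^[n] y) k = y (hitTime n y + k) - n := by
  induction n generalizing k with
  | zero => simp [hitTime_zero]
  | succ n ih =>
    rw [Function.iterate_succ_apply', hitTime_succ, afterOne, pathShift, ih]
    push_cast
    rw [add_assoc]
    ring

lemma GoodPath.apply_hitTime {y : ℕ → ℤ} (h : GoodPath y) (n : ℕ) : y (hitTime n y) = n := by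
  have h1 := iterate_afterOne_apply n 0 y
  rw [(h.iterate_afterOne n).1.1, add_zero] at h1
  omega

lemma GoodPath.lt_of_lt_hitTime {y : ℕ → ℤ} (h : GoodPath y) {n k : ℕ} (hk : k < hitTime n y) :
    y k < n := by
  induction n with
  | zero => simp [hitTime_zero] at hk
  | succ n ih =>
    rcases Nat.lt_or_ge k (hitTime n y) with hlt | hge
    · have := ih hlt; push_cast; omega
    · obtain ⟨l, rfl⟩ := Nat.exists_eq_add_of_le hge
      rw [hitTime_succ] at hk
      have h1 := (h.iterate_afterOne n).1.le_zero_of_lt_hitOne (k := l) (by omega)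
      rw [iterate_afterOne_apply] at h1
      push_cast; omega

lemma hitOne_pos {y : ℕ → ℤ} (h : GoodPath y) : 0 < hitOne y := by
  rcases Nat.eq_zero_or_pos (hitOne y) with h0 | h0
  · have := (mem_firstAt_hitOne h.hits).1
    rw [h0, h.1.1] at this
    omega
  · exact h0

/-! ### The walk reflected at a negative level -/

lemma cutTime_zero {y : ℕ → ℤ} (h : GoodPath y) : cutTime 0 y = 1 := by
  have hpos := hitOne_pos h
  have hmem := mem_firstAt_hitOne h.hits
  rw [cutTime, Finset.sum_eq_single_of_mem (hitOne y - 1) (by simp; omega)]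
  · have h1 := h.1.le_zero_of_lt_hitOne (k := hitOne y - 1) (by omega)
    have h2 := h.1.2 (hitOne y - 1)
    have h3 : y (hitOne y - 1 + 1) = 1 := by rw [Nat.sub_add_cancel hpos]; exact hmem.1
    rw [if_pos]
    right; push_cast; omega
  · intro k hk hne
    have hk := Finset.mem_range.mp hk
    have h1 := h.1.le_zero_of_lt_hitOne hk
    have h2 := h.1.le_zero_of_lt_hitOne (k := k + 1) (by omega)
    rw [if_neg]
    push_cast; omega

lemma cutTime_up {y : ℕ → ℤ} (h : GoodPath y) (hy : y 1 = 1) (j : ℕ) : cutTime (j + 1) y = 1 := by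
  have : hitOne y = 1 := hitOne_of_mem ⟨hy, fun k hk => by
    obtain rfl : k = 0 := by omega
    rw [h.1.1]; omega⟩
  rw [cutTime, this, Finset.sum_range_one, if_pos]
  left; rw [h.1.1]; push_cast; omega

/-- Decomposition of the passage from `0` to `1` after a first step to the left, into the
passages from `-1` to `0` and from `0` to `1`. -/
lemma cutTime_down {y : ℕ → ℤ} (h : GoodPath y) (hy : y 1 = -1) (j : ℕ) :
    cutTime (j + 1) y = 1 + cutTime j (pathShift 1 (-1) y)
      + cutTime (j + 1) (afterOne (pathShift 1 (-1) y)) := by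
  set y' := pathShift 1 (-1) y with hy'
  have h' : GoodPath y' := h.pathShift 1 hy
  have e' : ∀ k, y' k = y (1 + k) + 1 := fun k => by rw [hy', pathShift]; ring
  have e'' : ∀ k, afterOne y' k = y (1 + hitOne y' + k) := fun k => by
    rw [afterOne, pathShift, e', add_assoc]; ring
  have hT : hitOne y = 1 + hitOne y' + hitOne (afterOne y') := by
    refine hitOne_of_mem ⟨?_, fun k hk => ?_⟩
    · rw [← e'']; exact (mem_firstAt_hitOne h'.afterOne.hits).1
    · rcases Nat.eq_zero_or_pos k with rfl | hk0
      · rw [h.1.1]; omega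
      · obtain ⟨l, rfl⟩ := Nat.exists_eq_add_of_le (show 1 ≤ k by omega)
        rcases Nat.lt_or_ge l (hitOne y') with hlt | hge
        · have := h'.1.le_zero_of_lt_hitOne hlt
          rw [e'] at this; omega
        · obtain ⟨l', rfl⟩ := Nat.exists_eq_add_of_le hge
          have := h'.afterOne.1.le_zero_of_lt_hitOne (k := l') (by omega)
          rw [e'', add_assoc] at this; omega
  rw [cutTime, hT, Finset.sum_range_add, Finset.sum_range_add, Finset.sum_range_one]
  congr 1
  · congr 1
    · rw [if_pos]
      left; rw [h.1.1]; push_cast; omega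
    · refine Finset.sum_congr rfl fun k _ => ?_
      rw [e', e', ← add_assoc]
      push_cast
      refine if_congr ?_ rfl rfl
      omega
  · refine Finset.sum_congr rfl fun k _ => ?_
    rw [e'', e'', ← add_assoc]

lemma cutTime_le (j : ℕ) (y : ℕ → ℤ) : cutTime j y ≤ hitOne y := by
  calc cutTime j y ≤ ∑ k ∈ Finset.range (hitOne y), 1 :=
        Finset.sum_le_sum fun k _ => by split_ifs <;> omega
    _ = hitOne y := by simp

lemma cutSum_le (j n : ℕ) (y : ℕ → ℤ) : cutSum j n y ≤ hitTime n y :=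
  Finset.sum_le_sum fun _ _ => cutTime_le _ _

lemma cutSum_succ' (j n : ℕ) (y : ℕ → ℤ) :
    cutSum j (n + 1) y = cutTime j y + cutSum (j + 1) n (afterOne y) := by
  rw [cutSum, Finset.sum_range_succ', add_comm]
  congr 1
  refine Finset.sum_congr rfl fun i _ => ?_
  rw [Function.iterate_succ_apply]
  congr 1
  omega

/-- Reflection at `-1` only removes time spent below `0`. -/
lemma hitTime_le_cutSum_add (n : ℕ) (y : ℕ → ℤ) :
    hitTime n y ≤ cutSum 1 n y + ∑ k ∈ Finset.range (hitTime n y), if y k < 0 then 1 else 0 := by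
  induction n with
  | zero => simp [hitTime_zero]
  | succ n ih =>
    have h1 : hitOne (afterOne^[n] y) ≤ cutTime (1 + n) (afterOne^[n] y)
        + ∑ k ∈ Finset.range (hitOne (afterOne^[n] y)),
          if y (hitTime n y + k) < 0 then 1 else 0 := by
      rw [cutTime, ← Finset.sum_add_distrib]
      calc hitOne (afterOne^[n] y) = ∑ k ∈ Finset.range (hitOne (afterOne^[n] y)), 1 := by simp
        _ ≤ _ := Finset.sum_le_sum fun k _ => by
          rw [iterate_afterOne_apply]
          push_cast
          split_ifs <;> omega
    have h2 : cutSum 1 (n + 1) y = cutSum 1 n y + cutTime (1 + n) (afterOne^[n] y) :=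
      Finset.sum_range_succ _ _
    rw [hitTime_succ, Finset.sum_range_add, h2]
    omega

/-- A transient walk spends a finite time below `0`, so reflection changes all its hitting times by
a bounded amount only. -/
lemma GoodPath.exists_hitTime_le {y : ℕ → ℤ} (h : GoodPath y) :
    ∃ L : ℕ, ∀ n, hitTime n y ≤ cutSum 1 n y + L := by
  obtain ⟨L, hL⟩ := (h.2.eventually_ge_atTop 0).exists_forall_of_atTop
  refine ⟨L, fun n => (hitTime_le_cutSum_add n y).trans ?_⟩
  gcongr
  calc ∑ k ∈ Finset.range (hitTime n y), (if y k < 0 then 1 else 0)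
      ≤ ∑ k ∈ Finset.range (hitTime n y), (if k < L then 1 else 0) := by
        refine Finset.sum_le_sum fun k _ => ?_
        by_cases hk : k < L
        · rw [if_pos hk]; split_ifs <;> omega
        · have := hL k (by omega)
          rw [if_neg (by omega)]; omega
    _ ≤ L := by
        rw [Finset.sum_ite, Finset.sum_const_zero, add_zero, Finset.sum_const, smul_eq_mul, mul_one]
        calc _ ≤ (Finset.range L).card := Finset.card_le_card fun k hk => by
              simp only [Finset.mem_filter, Finset.mem_range] at hk ⊢; omega
          _ = L := Finset.card_range L

/-- The distance of the walk to its running maximum is bounded by a passage time. -/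
lemma GoodPath.sub_le {y : ℕ → ℤ} (h : GoodPath y) {m n : ℕ} (h1 : hitTime m y ≤ n)
    (h2 : n < hitTime (m + 1) y) :
    (m : ℤ) - y n ≤ hitTime (m + 1) y - hitTime m y := by
  have key : ∀ l, (m : ℤ) - l ≤ y (hitTime m y + l) := by
    intro l
    induction l with
    | zero => simp [h.apply_hitTime]
    | succ l ih =>
      have := h.1.2 (hitTime m y + l)
      rw [← add_assoc]; push_cast; omega
  obtain ⟨l, rfl⟩ := Nat.exists_eq_add_of_le h1
  have := key l
  omega

lemma measurable_iterate_afterOne (n : ℕ) : Measurable (afterOne^[n]) :=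
  measurable_afterOne.iterate n

lemma measurable_hitTime (n : ℕ) : Measurable (hitTime n) :=
  Finset.measurable_sum (f := fun i y => hitOne (afterOne^[i] y)) (Finset.range n) fun i _ =>
    measurable_hitOne.comp (measurable_iterate_afterOne i)

lemma measurable_cutTime (j : ℕ) : Measurable (cutTime j) := by
  have : Measurable fun p : ℕ × (ℕ → ℤ) => ∑ k ∈ Finset.range p.1,
      if -(j : ℤ) < p.2 k ∨ (p.2 k = -j ∧ p.2 (k + 1) = -j + 1) then 1 else 0 := by
    refine measurable_from_prod_countable_right fun n => ?_
    refine Finset.measurable_sum (f := fun k (y : ℕ → ℤ) =>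
      if -(j : ℤ) < y k ∨ (y k = -j ∧ y (k + 1) = -j + 1) then 1 else 0)
      (Finset.range n) fun k _ => ?_
    refine Measurable.ite ?_ measurable_const measurable_const
    exact (measurableSet_lt measurable_const (measurable_pi_apply k)).union
      ((measurableSet_coord_eq k _).inter (measurableSet_coord_eq (k + 1) _))
  exact this.comp (measurable_hitOne.prodMk measurable_id)

lemma measurable_cutSum (j n : ℕ) : Measurable (cutSum j n) :=
  Finset.measurable_sum (f := fun i y => cutTime (j + i) (afterOne^[i] y)) (Finset.range n) fun i _ =>
    (measurable_cutTime (j + i)).comp (measurable_iterate_afterOne i)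

lemma determined_cutTime (j : ℕ) (A : Set ℕ) (n : ℕ) :
    Determined n (cutTime j ⁻¹' A ∩ firstAt n) := by
  rintro y y' h ⟨h1, h2⟩
  have h2' := determined_firstAt n y y' h h2
  refine ⟨?_, h2'⟩
  have : cutTime j y' = cutTime j y := by
    rw [cutTime, cutTime, hitOne_of_mem h2, hitOne_of_mem h2']
    refine Finset.sum_congr rfl fun k hk => ?_
    have := Finset.mem_range.mp hk
    rw [h k (by omega), h (k + 1) (by omega)]
  rw [Set.mem_preimage, this]
  exact h1

/-! ### Quenched generating functions of the reflected hitting times -/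

/-- The first passage map: if `w` is the generating function of the passage time from `i - 1` to
`i`, and the walk steps to the right from `i` with probability `p`, then `firstPassage s p w` is
the generating function of the passage time from `i` to `i + 1`. -/
noncomputable def firstPassage (s : ℂ) (p : ℝ) (w : ℂ) : ℂ := s * p / (1 - s * (1 - p) * w)

/-- The product of the first `n` values of the orbit of `w` under the first passage maps with
parameters `p 0, p 1, …`. -/
noncomputable def passageProd (s : ℂ) : ℕ → (ℕ → ℝ) → ℂ → ℂ
  | 0, _, _ => 1
  | n + 1, p, w =>
      firstPassage s (p 0) w * passageProd s n (fun k => p (k + 1)) (firstPassage s (p 0) w)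

/-- The quenched generating function of `cutTime j`. -/
noncomputable def cutGF (s : ℂ) : ℕ → Env → ℂ
  | 0, _ => s
  | j + 1, ω => firstPassage s (ω 0) (cutGF s j (shiftBy (-1) ω))

/-- The measures `Q (θ^i ω)` are, for all `i`, quenched laws that are carried by good paths. -/
def GoodEnv (Q : Env → Measure (ℕ → ℤ)) (ω : Env) : Prop :=
  ∀ i : ℤ, IsWalkLaw (shiftBy i ω) (Q (shiftBy i ω)) ∧ ∀ᵐ y ∂Q (shiftBy i ω), GoodPath y

section Quenched

variable {Q : Env → Measure (ℕ → ℤ)} {ω : Env}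

lemma GoodEnv.shifted (h : GoodEnv Q ω) (i : ℤ) : GoodEnv Q (shiftBy i ω) := fun k => by
  rw [shiftBy_shiftBy]; exact h (k + i)

lemma GoodEnv.walk (h : GoodEnv Q ω) : IsWalkLaw ω (Q ω) := by simpa using (h 0).1

lemma GoodEnv.good (h : GoodEnv Q ω) : ∀ᵐ y ∂Q ω, GoodPath y := by simpa using (h 0).2

variable [∀ ω, IsProbabilityMeasure (Q ω)]

/-- The path after the first passage to `1` is a walk in the shifted environment. -/
lemma GoodEnv.measure_afterOne (h : GoodEnv Q ω) {B : Set (ℕ → ℤ)} (hB : MeasurableSet B) :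
    Q ω (afterOne ⁻¹' B) = Q (shiftBy 1 ω) B := by
  have := h.walk.strong_markov (h.shifted 1).walk (h.good.mono fun y hy => hy.hits)
    (D := Set.univ) (fun n => by rw [Set.univ_inter]; exact determined_firstAt n) hB
  rwa [Set.univ_inter, measure_univ, one_mul] at this

lemma GoodEnv.map_afterOne (h : GoodEnv Q ω) :
    (Q ω).map afterOne = Q (shiftBy 1 ω) := by
  ext B hB
  rw [Measure.map_apply measurable_afterOne hB, h.measure_afterOne hB]

lemma GoodEnv.indepFun (h : GoodEnv Q ω) (j : ℕ) : IndepFun (cutTime j) afterOne (Q ω) := by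
  rw [indepFun_iff_measure_inter_preimage_eq_mul]
  intro A B _ hB
  rw [h.measure_afterOne hB]
  exact h.walk.strong_markov (h.shifted 1).walk (h.good.mono fun y hy => hy.hits)
    (determined_cutTime j A) hB

lemma GoodEnv.integral_cutTime_mul (h : GoodEnv Q ω) (j : ℕ) (s : ℂ) {g : (ℕ → ℤ) → ℂ}
    (hg : Measurable g) :
    ∫ y, s ^ cutTime j y * g (afterOne y) ∂Q ω
      = (∫ y, s ^ cutTime j y ∂Q ω) * ∫ y, g y ∂Q (shiftBy 1 ω) := by
  have h1 := (h.indepFun j).integral_fun_comp_mul_comp (f := fun k : ℕ => s ^ k) (g := g)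
    (measurable_cutTime j).aemeasurable measurable_afterOne.aemeasurable
    (measurable_from_top).aestronglyMeasurable hg.aestronglyMeasurable
  rw [h1, ← h.map_afterOne, integral_map measurable_afterOne.aemeasurable hg.aestronglyMeasurable]

lemma measurable_pow_comp {α : Type*} [MeasurableSpace α] (s : ℂ) {f : α → ℕ} (hf : Measurable f) :
    Measurable fun a => s ^ f a :=
  (measurable_from_top (f := fun k : ℕ => s ^ k)).comp hf

lemma norm_integral_pow_le_one {α : Type*} [MeasurableSpace α] (μ : Measure α)
    [IsProbabilityMeasure μ] {s : ℂ} (hs : ‖s‖ ≤ 1) (f : α → ℕ) : ‖∫ a, s ^ f a ∂μ‖ ≤ 1 := by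
  refine (norm_integral_le_of_norm_le_const (C := 1) (Eventually.of_forall fun a => ?_)).trans ?_
  · rw [norm_pow]; exact pow_le_one₀ (norm_nonneg _) hs
  · simp

lemma integrable_pow {α : Type*} [MeasurableSpace α] (μ : Measure α)
    [IsFiniteMeasure μ] {s : ℂ} (hs : ‖s‖ ≤ 1) {f : α → ℕ} (hf : Measurable f) :
    Integrable (fun a => s ^ f a) μ :=
  Integrable.of_bound (measurable_pow_comp s hf).aestronglyMeasurable 1
    (Eventually.of_forall fun a => by rw [norm_pow]; exact pow_le_one₀ (norm_nonneg _) hs)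

lemma one_sub_mul_ne_zero {s w : ℂ} (hs : ‖s‖ ≤ 1) (hw : ‖w‖ ≤ 1) (p : Set.Ioo (0 : ℝ) 1) :
    1 - s * (1 - (p : ℝ)) * w ≠ 0 := by
  intro h
  have h1 : s * (1 - (p : ℝ)) * w = 1 := (sub_eq_zero.mp h).symm
  have h2 : ‖s * (1 - (p : ℝ)) * w‖ = 1 := by rw [h1, norm_one]
  have h3 : ‖(1 - (p : ℝ) : ℂ)‖ = 1 - p := by
    rw [← Complex.ofReal_one, ← Complex.ofReal_sub, Complex.norm_real, Real.norm_of_nonneg]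
    linarith [p.2.2]
  rw [norm_mul, norm_mul, h3] at h2
  have hp := p.2
  have : ‖s‖ * (1 - p) * ‖w‖ ≤ 1 * (1 - p) * 1 := by
    have : (0 : ℝ) ≤ 1 - p := by linarith [hp.2]
    gcongr
  linarith [hp.1]

/-- The first-passage decomposition, in terms of generating functions. -/
lemma GoodEnv.integral_pow_cutTime {s : ℂ} (hs : ‖s‖ ≤ 1) (j : ℕ) (h : GoodEnv Q ω) :
    ∫ y, s ^ cutTime j y ∂Q ω = cutGF s j ω := by
  induction j generalizing ω with
  | zero =>
    have : ∫ y, s ^ cutTime 0 y ∂Q ω = ∫ _y, s ∂Q ω :=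
      integral_congr_ae (h.good.mono fun y hy => by simp only [cutTime_zero hy, pow_one])
    rw [this]; simp [cutGF]
  | succ j ih =>
    have hleft : shiftBy 1 (shiftBy (-1) ω) = ω := by simp [shiftBy_shiftBy]
    set I := ∫ y, s ^ cutTime (j + 1) y ∂Q ω with hI
    set Φ := cutGF s j (shiftBy (-1) ω) with hΦ
    have hΦint := ih (h.shifted (-1))
    have hΦ1 : ‖Φ‖ ≤ 1 := by rw [hΦ, ← hΦint]; exact norm_integral_pow_le_one _ hs _
    set U : ℤ → Set (ℕ → ℤ) := fun i => {y | y 0 = 0 ∧ y 1 = i} with hU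
    have hUm : ∀ i, MeasurableSet (U i) := fun i =>
      (measurableSet_coord_eq 0 0).inter (measurableSet_coord_eq 1 i)
    have hUdet : ∀ i, Determined 1 (U i) := fun i y y' hy hm =>
      ⟨by rw [← hy 0 (by omega)]; exact hm.1, by rw [← hy 1 le_rfl]; exact hm.2⟩
    have hUmeas : ∀ i, Q ω (U i) = walkStep ω 0 i := by
      intro i
      have huniv : Determined 0 (Set.univ : Set (ℕ → ℤ)) := fun y y' _ _ => trivial
      have h1 := IsChain.step h.walk huniv 0 i
      rw [Set.univ_inter, Set.univ_inter] at h1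
      have h2 : Q ω {y | y 0 = 0} = 1 := by
        rw [← measure_univ (μ := Q ω)]
        refine measure_congr (eventuallyEq_univ.mpr ?_)
        filter_upwards [h.good] with y hy using hy.1.1
      rw [h2, one_mul] at h1
      exact h1
    have hsplit : I = (∫ y in U 1, s ^ cutTime (j + 1) y ∂Q ω)
        + ∫ y in U (-1), s ^ cutTime (j + 1) y ∂Q ω := by
      rw [← setIntegral_union _ (hUm (-1)) (integrable_pow _ hs (measurable_cutTime _)).integrableOn
        (integrable_pow _ hs (measurable_cutTime _)).integrableOn, hI, ← setIntegral_univ]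
      · refine setIntegral_congr_set ?_
        symm
        refine eventuallyEq_univ.mpr ?_
        filter_upwards [h.good] with y hy
        have h1 := hy.1.2 0
        rw [hy.1.1] at h1
        rcases h1 with h1 | h1
        · exact Or.inl ⟨hy.1.1, by simpa using h1⟩
        · exact Or.inr ⟨hy.1.1, by simpa using h1⟩
      · refine Set.disjoint_left.mpr fun y h1 h2 => ?_
        have := h1.2.symm.trans h2.2
        omega
    have hup : ∫ y in U 1, s ^ cutTime (j + 1) y ∂Q ω = (ω 0 : ℝ) * s := by
      have : ∫ y in U 1, s ^ cutTime (j + 1) y ∂Q ω = ∫ _y in U 1, s ∂Q ω := by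
        refine setIntegral_congr_ae (hUm 1) (h.good.mono fun y hy hm => ?_)
        rw [cutTime_up hy hm.2, pow_one]
      rw [this, setIntegral_const, measureReal_def, hUmeas]
      have h1 := walkStep_up ω 0
      rw [zero_add] at h1
      rw [h1, ENNReal.toReal_ofReal (ω 0).2.1.le, Complex.real_smul]
    have hdown : ∫ y in U (-1), s ^ cutTime (j + 1) y ∂Q ω = (1 - (ω 0 : ℝ)) * (s * (Φ * I)) := by
      have hmap : ((Q ω).restrict (U (-1))).map (pathShift 1 (-1))
          = Q ω (U (-1)) • Q (shiftBy (-1) ω) := by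
        ext B hB
        rw [Measure.map_apply (measurable_pathShift _ _) hB,
          Measure.restrict_apply (measurable_pathShift _ _ hB), Measure.smul_apply, smul_eq_mul,
          Set.inter_comm]
        exact h.walk.markov (h.shifted (-1)).walk (hUdet (-1)) (fun y hy => hy.2) hB
      have hmeas : Measurable fun y => s ^ cutTime (j + 1) y :=
        measurable_pow_comp s (measurable_cutTime _)
      set G : (ℕ → ℤ) → ℂ :=
        fun z => s * (s ^ cutTime j z * s ^ cutTime (j + 1) (afterOne z)) with hG
      have hGm : Measurable G := ((measurable_pow_comp s (measurable_cutTime _)).mul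
        (hmeas.comp measurable_afterOne)).const_mul s
      have h1 : ∫ y in U (-1), s ^ cutTime (j + 1) y ∂Q ω
          = ∫ y in U (-1), G (pathShift 1 (-1) y) ∂Q ω := by
        refine setIntegral_congr_ae (hUm (-1)) (h.good.mono fun y hy hm => ?_)
        rw [cutTime_down hy hm.2, pow_add, pow_add, pow_one, hG]
        ring
      have h3 := integral_map (μ := (Q ω).restrict (U (-1)))
        (measurable_pathShift 1 (-1)).aemeasurable (f := G) hGm.aestronglyMeasurable
      rw [h1, ← h3, hmap, integral_smul_measure,
        hUmeas, integral_const_mul, (h.shifted (-1)).integral_cutTime_mul j s hmeas, hΦint, hleft]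
      have h2 := walkStep_down ω 0
      rw [zero_sub] at h2
      rw [h2, ENNReal.toReal_ofReal (by linarith [(ω 0).2.2]), Complex.real_smul]
      push_cast
      rfl
    rw [hup, hdown] at hsplit
    have hne := one_sub_mul_ne_zero hs hΦ1 (ω 0)
    rw [cutGF, firstPassage, eq_div_iff hne]
    linear_combination hsplit

/-- The quenched generating function of the reflected hitting times: the successive passage times
are independent under the quenched law, and their generating functions form an orbit of the first
passage maps. -/
lemma GoodEnv.integral_pow_cutSum {s : ℂ} (hs : ‖s‖ ≤ 1) (j n : ℕ) (h : GoodEnv Q ω) :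
    ∫ y, s ^ cutSum (j + 1) n y ∂Q ω
      = passageProd s n (fun k => (ω k : ℝ)) (cutGF s j (shiftBy (-1) ω)) := by
  induction n generalizing j ω with
  | zero => simp [cutSum, passageProd]
  | succ n ih =>
    have hright : shiftBy (-1) (shiftBy 1 ω) = ω := by simp [shiftBy_shiftBy]
    simp_rw [cutSum_succ', pow_add]
    rw [h.integral_cutTime_mul (j + 1) s (g := fun y => s ^ cutSum (j + 1 + 1) n y)
      (measurable_pow_comp s (measurable_cutSum _ _)), h.integral_pow_cutTime hs,
      ih (j + 1) (h.shifted 1), hright]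
    rw [passageProd, cutGF]
    simp only [shiftBy_apply]
    push_cast
    rfl

end Quenched

/-! ### The annealed law of the walk -/

lemma measurableSet_goodPath : MeasurableSet {y : ℕ → ℤ | GoodPath y} := by
  have h1 : MeasurableSet {y : ℕ → ℤ | NearestNeighbour y} := by
    have : {y : ℕ → ℤ | NearestNeighbour y} = {y | y 0 = 0} ∩
        ⋂ k : ℕ, ({y | y (k + 1) = y k + 1} ∪ {y | y (k + 1) = y k - 1}) := by
      ext y; simp [NearestNeighbour]
    rw [this]
    refine (measurableSet_coord_eq 0 0).inter (MeasurableSet.iInter fun k => ?_)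
    have hk : ∀ k : ℕ, Measurable fun y : ℕ → ℤ => y k := fun k => measurable_pi_apply k
    exact (measurableSet_eq_fun (hk (k + 1)) ((hk k).add_const 1)).union
      (measurableSet_eq_fun (hk (k + 1)) ((hk k).sub_const 1))
  have h2 : MeasurableSet {y : ℕ → ℤ | Tendsto (fun n => y n) atTop atTop} :=
    measurableSet_tendsto atTop fun n => measurable_pi_apply n
  exact h1.inter h2

lemma measurable_walkStep (i j : ℤ) : Measurable fun ω : Env => walkStep ω i j := by
  unfold walkStep
  split_ifs
  · exact (measurable_coe_env i).ennreal_ofReal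
  · exact (measurable_const.sub (measurable_coe_env i)).ennreal_ofReal
  · exact measurable_const

lemma measurable_passageProd {α : Type*} [MeasurableSpace α] (s : ℂ) (n : ℕ) {p : α → ℕ → ℝ}
    {w : α → ℂ} (hp : ∀ k, Measurable fun a => p a k) (hw : Measurable w) :
    Measurable fun a => passageProd s n (p a) (w a) := by
  induction n generalizing p w with
  | zero => exact measurable_const
  | succ n ih =>
    have hpc : Measurable fun a => ((p a 0 : ℝ) : ℂ) := Complex.measurable_ofReal.comp (hp 0)
    have h1 : Measurable fun a => firstPassage s (p a 0) (w a) := by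
      unfold firstPassage
      exact (hpc.const_mul s).div
        (measurable_const.sub (((measurable_const.sub hpc).const_mul s).mul hw))
    exact h1.mul (ih (fun k => hp (k + 1)) h1)

/-- An integral with respect to a mixture of the probability measures `Q ω`. -/
lemma integral_comp_kernel {β : Type*} [MeasurableSpace β] {P : Measure Env}
    [IsProbabilityMeasure P] {Q : Kernel Env β} [IsMarkovKernel Q] {f : β → ℂ}
    (hf : Integrable f (Q ∘ₘ P)) : ∫ y, f y ∂(Q ∘ₘ P) = ∫ ω, ∫ y, f y ∂Q ω ∂P := by
  rw [← Measure.snd_compProd] at hf ⊢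
  rw [Measure.snd, integral_map measurable_snd.aemeasurable hf.1, Measure.integral_compProd]
  exact hf.comp_measurable measurable_snd

/-- The annealed law `W` of the walk: it is carried by good paths, preserved by the passage to the
path after the first visit to `1`, and the reflected hitting times have explicit generating
functions. -/
structure AnnealedWalk (P : Measure Env) (W : Measure (ℕ → ℤ)) : Prop where
  good : ∀ᵐ y ∂W, GoodPath y
  preserving : MeasurePreserving afterOne W W
  gf : ∀ (s : ℂ), ‖s‖ ≤ 1 → ∀ n,
    ∫ y, s ^ cutSum 1 n y ∂W = ∫ ω, passageProd s n (fun k => (ω k : ℝ)) s ∂P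

section Annealed

variable {P : Measure Env} {κ : ℝ} {Ω' : Type*} [MeasurableSpace Ω'] {Pr : Measure Ω'}
  {env : Ω' → Env} {X : ℕ → Ω' → ℤ}

lemma IsRWRE.measurable_path (hX : IsRWRE Pr P env X) : Measurable fun a n => X n a :=
  measurable_pi_lambda _ hX.measurable_walk

variable [IsProbabilityMeasure P] [IsProbabilityMeasure Pr]

/-- The law of the walk is a mixture of quenched laws; for almost every environment all its shifts
have transient quenched laws. -/
lemma IsRWRE.exists_kernel (hB : ConditionB P κ) (hX : IsRWRE Pr P env X) :
    ∃ Q : Kernel Env (ℕ → ℤ), IsMarkovKernel Q ∧ (∀ᵐ ω ∂P, GoodEnv (fun ω => Q ω) ω) ∧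
      Pr.map (fun a n => X n a) = Q ∘ₘ P := by
  obtain ⟨Q, hQ, hchain, hmap⟩ := exists_quenched_kernel (P := P) hX.measurable_env
    hX.measurable_walk (fun i : ℤ => if i = 0 then 1 else 0) (fun ω _ => walkStep ω)
    (by simp) (fun _ i j => measurable_walkStep i j) hX.law
  refine ⟨Q, hQ, ?_, ?_⟩
  · have h1 : ∀ᵐ ω ∂P, IsWalkLaw ω (Q ω) ∧ ∀ᵐ y ∂Q ω, GoodPath y := by
      filter_upwards [hchain, hB.ae_forward_finite, hB.ae_backward_finite] with ω hω hf hb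
      have hw : IsWalkLaw ω (Q ω) := hω
      refine ⟨hw, ?_⟩
      filter_upwards [hw.ae_nearestNeighbour, hw.ae_tendsto_atTop hf (hb (-1))] with y h1 h2
      exact ⟨h1, h2⟩
    exact ae_all_iff.mpr fun i => (hB.preserving i).quasiMeasurePreserving.ae h1
  · rw [← Measure.snd_compProd, ← hmap, Measure.snd,
      Measure.map_map measurable_snd (hX.measurable_env.prodMk hX.measurable_path)]
    rfl

/-- The annealed law inherits the renewal structure of the quenched laws: passing to the path after
the first visit to `1` shifts the environment, and the shift preserves `P`. -/
lemma IsRWRE.annealed (hB : ConditionB P κ) (hX : IsRWRE Pr P env X) :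
    AnnealedWalk P (Pr.map fun a n => X n a) := by
  obtain ⟨Q, hQ, hgood, hmap⟩ := hX.exists_kernel hB
  rw [hmap]
  refine ⟨?_, ⟨measurable_afterOne, ?_⟩, ?_⟩
  · exact Measure.ae_comp_of_ae_ae measurableSet_goodPath (hgood.mono fun ω hω => hω.good)
  · ext B hB'
    rw [Measure.map_apply measurable_afterOne hB',
      Measure.bind_apply (measurable_afterOne hB') Q.measurable.aemeasurable,
      Measure.bind_apply hB' Q.measurable.aemeasurable]
    rw [lintegral_congr_ae (hgood.mono fun ω hω => hω.measure_afterOne hB')]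
    exact (hB.preserving 1).lintegral_comp (f := fun ω => Q ω B) (Kernel.measurable_coe Q hB')
  · intro s hs n
    rw [integral_comp_kernel (integrable_pow _ hs (measurable_cutSum 1 n))]
    refine integral_congr_ae (hgood.mono fun ω hω => ?_)
    exact hω.integral_pow_cutSum hs 0 n

/-- If `κ > 1`, then the first passage time to `1` has finite annealed expectation. -/
lemma IsRWRE.lintegral_hitOne_lt_top (hB : ConditionB P κ) (hκ : 1 < κ)
    (hX : IsRWRE Pr P env X) :
    ∫⁻ y, (hitOne y : ℝ≥0∞) ∂(Pr.map fun a n => X n a) < ⊤ := by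
  obtain ⟨Q, hQ, hgood, hmap⟩ := hX.exists_kernel hB
  have hm : Measurable fun y : ℕ → ℤ => (hitOne y : ℝ≥0∞) :=
    measurable_from_top.comp measurable_hitOne
  have hmp : ∀ n : ℕ, Measurable fun ω : Env =>
      ∏ k ∈ Finset.range (n + 1), rhoE ω (0 - k) := fun n =>
    measurable_prod_rhoE (fun k => 0 - (k : ℤ)) (n + 1)
  have hmoment := hB.tsum_moments_ne_top one_pos hκ
  rw [hmap, Measure.lintegral_bind Q.measurable.aemeasurable hm.aemeasurable]
  refine (lintegral_mono_ae (hgood.mono fun ω hω => hω.walk.lintegral_hitOne_le)).trans_lt ?_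
  rw [lintegral_add_left measurable_const, lintegral_const_mul _ (Measurable.tsum hmp),
    lintegral_tsum fun n => (hmp n).aemeasurable]
  have h1 : ∀ n : ℕ, ∫⁻ ω, ∏ k ∈ Finset.range (n + 1), rhoE ω (0 - k) ∂P
      = ∫⁻ ω, (∏ k ∈ Finset.range (n + 1), rhoE ω k) ^ (1 : ℝ) ∂P := by
    intro n
    rw [← hB.lintegral_prod_reflect 1 (n + 1) 0]
    simp only [ENNReal.rpow_one]
  simp_rw [h1]
  have h2 := ENNReal.tsum_comp_le_tsum_of_injective (add_left_injective 1)
    (fun n : ℕ => ∫⁻ ω, (∏ k ∈ Finset.range n, rhoE ω k) ^ (1 : ℝ) ∂P)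
  refine ENNReal.add_lt_top.mpr ⟨by simp, ENNReal.mul_lt_top (by simp) ?_⟩
  exact h2.trans_lt hmoment.lt_top

end Annealed

/-! ### The branching process -/

/-- The total progeny up to generation `n`. -/
def progeny (n : ℕ) (z : ℕ → ℕ) : ℕ := ∑ i ∈ Finset.range (n + 1), z i

lemma progeny_succ (n : ℕ) (z : ℕ → ℕ) : progeny (n + 1) z = progeny n z + z (n + 1) :=
  Finset.sum_range_succ _ _

lemma measurable_progeny (n : ℕ) : Measurable (progeny n) :=
  Finset.measurable_sum (f := fun i (z : ℕ → ℕ) => z i) (Finset.range (n + 1)) fun i _ =>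
    measurable_pi_apply i

instance (ω : Env) (n : ℕ) : IsProbabilityMeasure (offspringLaw ω n) := by
  unfold offspringLaw; infer_instance

instance (ω : Env) (n z : ℕ) : IsProbabilityMeasure (branchingStep ω n z) := by
  unfold branchingStep
  exact Measure.isProbabilityMeasure_map (Measurable.of_discrete.aemeasurable)

lemma offspring_param_ne_zero (ω : Env) (n : ℕ) :
    (⟨(ω (-(n : ℤ)) : ℝ), (ω (-(n : ℤ))).2.1.le, (ω (-(n : ℤ))).2.2.le⟩ : unitInterval) ≠ 0 := by
  intro h
  have := congrArg Subtype.val h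
  exact (ω (-(n : ℤ))).2.1.ne' this

lemma integral_pow_offspringLaw (ω : Env) (n : ℕ) {u : ℂ} (hu : ‖u‖ ≤ 1) :
    ∫ k, u ^ k ∂offspringLaw ω n
      = (ω (-(n : ℤ)) : ℝ) / (1 - (1 - (ω (-(n : ℤ)) : ℝ)) * u) := by
  rw [offspringLaw, integral_geometricMeasure (offspring_param_ne_zero ω n)]
  set p : ℝ := (ω (-(n : ℤ)) : ℝ) with hp
  have hp0 : 0 < p := (ω (-(n : ℤ))).2.1
  have hp1 : p < 1 := (ω (-(n : ℤ))).2.2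
  have hterm : ∀ k : ℕ, ((1 - p) ^ k * p) • u ^ k = (p : ℂ) * ((1 - p) * u) ^ k := by
    intro k
    rw [Complex.real_smul, mul_pow]
    push_cast
    ring
  have hnorm : ‖(1 - (p : ℂ)) * u‖ < 1 := by
    rw [norm_mul, ← Complex.ofReal_one, ← Complex.ofReal_sub, Complex.norm_real,
      Real.norm_of_nonneg (by linarith)]
    calc (1 - p) * ‖u‖ ≤ (1 - p) * 1 := by
          have : 0 ≤ 1 - p := by linarith
          gcongr
      _ < 1 := by linarith
  simp only [hterm]
  rw [tsum_mul_left, tsum_geometric_of_norm_lt_one hnorm, div_eq_mul_inv]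

lemma lintegral_offspringLaw (ω : Env) (n : ℕ) :
    ∫⁻ k, (k : ℝ≥0∞) ∂offspringLaw ω n = rhoE ω (-(n : ℤ)) := by
  rw [offspringLaw, geometricMeasure_eq (offspring_param_ne_zero ω n)]
  set p : ℝ := (ω (-(n : ℤ)) : ℝ) with hp
  have hp0 : 0 < p := (ω (-(n : ℤ))).2.1
  have hp1 : p < 1 := (ω (-(n : ℤ))).2.2
  rw [lintegral_sum_measure]
  simp only [lintegral_smul_measure, lintegral_dirac, smul_eq_mul]
  have hq : ‖(1 - p : ℝ)‖ < 1 := by rw [Real.norm_of_nonneg] <;> linarith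
  have hsum := (hasSum_coe_mul_geometric_of_norm_lt_one hq).mul_right p
  have hterm : ∀ k : ℕ, ENNReal.ofReal ((1 - p) ^ k * p) * (k : ℝ≥0∞)
      = ENNReal.ofReal (k * (1 - p) ^ k * p) := by
    intro k
    have : (0 : ℝ) ≤ (1 - p) ^ k * p := mul_nonneg (pow_nonneg (by linarith) k) hp0.le
    rw [← ENNReal.ofReal_natCast k, ← ENNReal.ofReal_mul this]
    congr 1; ring
  simp only [hterm]
  rw [← ENNReal.ofReal_tsum_of_nonneg _ hsum.summable, hsum.tsum_eq, rhoE, rho, ← hp]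
  · congr 1
    have h1 : 1 - (1 - p) = p := by ring
    rw [h1]
    field_simp
  · intro k
    have : (0 : ℝ) ≤ 1 - p := by linarith
    positivity

lemma integral_pow_branchingStep (ω : Env) (n z : ℕ) {u : ℂ} (hu : ‖u‖ ≤ 1) :
    ∫ k, u ^ k ∂branchingStep ω n z
      = ((ω (-(n : ℤ)) : ℝ) / (1 - (1 - (ω (-(n : ℤ)) : ℝ)) * u)) ^ (z + 1) := by
  rw [branchingStep, integral_map Measurable.of_discrete.aemeasurable
    Measurable.of_discrete.aestronglyMeasurable]
  simp only [← Finset.prod_pow_eq_pow_sum]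
  rw [integral_fintype_prod_eq_pow (fun k : ℕ => u ^ k), integral_pow_offspringLaw ω n hu,
    Fintype.card_fin]

lemma lintegral_branchingStep (ω : Env) (n z : ℕ) :
    ∫⁻ k, (k : ℝ≥0∞) ∂branchingStep ω n z = (z + 1) * rhoE ω (-(n : ℤ)) := by
  rw [branchingStep, lintegral_map Measurable.of_discrete Measurable.of_discrete]
  simp only [Nat.cast_sum]
  rw [lintegral_finsetSum _ fun j _ => Measurable.of_discrete]
  have : ∀ j : Fin (z + 1), ∫⁻ v : Fin (z + 1) → ℕ, (v j : ℝ≥0∞)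
      ∂Measure.pi (fun _ => offspringLaw ω n) = rhoE ω (-(n : ℤ)) := by
    intro j
    rw [← lintegral_offspringLaw]
    exact (measurePreserving_eval (fun _ : Fin (z + 1) => offspringLaw ω n) j).lintegral_comp
      (f := fun k : ℕ => (k : ℝ≥0∞)) Measurable.of_discrete
  simp only [this]
  simp

lemma measurable_branchingStep (n z z' : ℕ) :
    Measurable fun ω : Env => branchingStep ω n z {z'} := by
  have h : ∀ ω : Env, branchingStep ω n z {z'}
      = ∑' v : Fin (z + 1) → ℕ, if ∑ j, v j = z'
          then ∏ j, ENNReal.ofReal ((1 - (ω (-(n : ℤ)) : ℝ)) ^ v j * (ω (-(n : ℤ)) : ℝ)) else 0 := by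
    intro ω
    rw [branchingStep, Measure.map_apply Measurable.of_discrete (measurableSet_singleton _),
      ← Measure.tsum_indicator_apply_singleton _ _ (Set.to_countable _).measurableSet]
    refine tsum_congr fun v => ?_
    classical
    rw [Set.indicator_apply]
    refine if_congr (by simp) ?_ rfl
    rw [Measure.pi_singleton]
    refine Finset.prod_congr rfl fun j _ => ?_
    rw [offspringLaw, geometricMeasure_singleton (offspring_param_ne_zero ω n)]
  simp only [h]
  refine Measurable.tsum fun v => ?_
  split_ifs
  · refine Finset.measurable_prod (f := fun (j : Fin (z + 1)) (ω : Env) =>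
      ENNReal.ofReal ((1 - (ω (-(n : ℤ)) : ℝ)) ^ v j * (ω (-(n : ℤ)) : ℝ))) _ fun j _ => ?_
    exact (((measurable_const.sub (measurable_coe_env _)).pow_const _).mul
      (measurable_coe_env _)).ennreal_ofReal
  · exact measurable_const

/-- `Q` is the quenched law, on path space, of the branching process in the environment `ω`. -/
def IsBranchingLaw (ω : Env) (Q : Measure (ℕ → ℕ)) : Prop :=
  IsChain (fun z : ℕ => if z = 0 then 1 else 0) (fun n z z' => branchingStep ω n z {z'}) Q

/-- The transition kernel of the chain `(progeny n z, z n)`. -/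
noncomputable def stepKernel (ω : Env) (n : ℕ) : Kernel (ℕ × ℕ) ℕ :=
  ⟨fun a => branchingStep ω n a.2, Measurable.of_discrete⟩

instance (ω : Env) (n : ℕ) : IsMarkovKernel (stepKernel ω n) :=
  ⟨fun a => inferInstanceAs (IsProbabilityMeasure (branchingStep ω n a.2))⟩

section Branching

variable {ω : Env} {Q : Measure (ℕ → ℕ)}

lemma IsBranchingLaw.ae_zero (h : IsBranchingLaw ω Q) : ∀ᵐ z ∂Q, z 0 = 0 := by
  have : ∀ᵐ z ∂Q, ∀ i : ℕ, i ≠ 0 → z 0 ≠ i := by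
    refine ae_all_iff.mpr fun i => ?_
    by_cases hi : i = 0
    · exact Eventually.of_forall fun _ h => absurd hi h
    · have : Q (cyl 0 fun _ => i) = 0 := by rw [h 0]; simp [hi]
      filter_upwards [measure_eq_zero_iff_ae_notMem.mp this] with y hy _ he
      exact hy fun k hk => by rw [Nat.le_zero.mp hk, he]
  filter_upwards [this] with y hy
  by_contra hne
  exact hy _ hne rfl

variable [IsProbabilityMeasure Q]

/-- The last generation depends on the past through the size of the one before it only. -/
lemma IsBranchingLaw.map_eq_compProd (h : IsBranchingLaw ω Q) (n : ℕ) :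
    Q.map (fun z => ((progeny n z, z n), z (n + 1)))
      = (Q.map fun z => (progeny n z, z n)) ⊗ₘ stepKernel ω n := by
  have hm1 : Measurable fun z : ℕ → ℕ => (progeny n z, z n) :=
    (measurable_progeny n).prodMk (measurable_pi_apply n)
  have hm2 : Measurable fun z : ℕ → ℕ => ((progeny n z, z n), z (n + 1)) :=
    hm1.prodMk (measurable_pi_apply (n + 1))
  refine Measure.ext_of_singleton fun ⟨⟨a, b⟩, c⟩ => ?_
  rw [Measure.map_apply hm2 (measurableSet_singleton _), ← Set.singleton_prod_singleton,
    Measure.compProd_apply_prod (measurableSet_singleton _) (measurableSet_singleton _),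
    lintegral_singleton, Measure.map_apply hm1 (measurableSet_singleton _), mul_comm]
  have hdet : Determined n {z | progeny n z = a} := by
    intro z z' hz hmem
    have : progeny n z' = progeny n z :=
      Finset.sum_congr rfl fun i hi => (hz i (by have := Finset.mem_range.mp hi; omega)).symm
    exact this.trans hmem
  have h1 := IsChain.step h hdet b c
  have e1 : (fun z : ℕ → ℕ => ((progeny n z, z n), z (n + 1))) ⁻¹' {(a, b)} ×ˢ {c}
      = {z | progeny n z = a} ∩ {z | z n = b ∧ z (n + 1) = c} := by
    ext z; simp [and_assoc]
  have e2 : (fun z : ℕ → ℕ => (progeny n z, z n)) ⁻¹' {(a, b)}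
      = {z | progeny n z = a} ∩ {z | z n = b} := by
    ext z; simp
  rw [e1, e2, h1]
  rfl

/-- The joint generating function of the total progeny and the last generation. -/
lemma IsBranchingLaw.integral_progeny {s : ℂ} (hs : ‖s‖ ≤ 1) (n : ℕ) {v : ℂ} (hv : ‖v‖ ≤ 1)
    (h : IsBranchingLaw ω Q) :
    s ^ n * ∫ z, s ^ (2 * progeny n z) * v ^ z n ∂Q
      = passageProd s n (fun k => (ω ((k : ℤ) + 1 - n) : ℝ)) (s * v) := by
  induction n generalizing v with
  | zero =>
    have : ∫ z, s ^ (2 * progeny 0 z) * v ^ z 0 ∂Q = ∫ _z, (1 : ℂ) ∂Q := by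
      refine integral_congr_ae (h.ae_zero.mono fun z hz => ?_)
      simp [progeny, hz]
    rw [this]
    simp [passageProd]
  | succ n ih =>
    set p : ℝ := (ω (-(n : ℤ)) : ℝ) with hp
    set u : ℂ := s ^ 2 * v with hu
    have hs2 : ‖s ^ 2‖ ≤ 1 := by rw [norm_pow]; exact pow_le_one₀ (norm_nonneg _) hs
    have hu1 : ‖u‖ ≤ 1 := by
      rw [hu, norm_mul]
      exact mul_le_one₀ hs2 (norm_nonneg _) hv
    set r : ℂ := p / (1 - (1 - p) * u) with hr
    have hr1 : ‖r‖ ≤ 1 := by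
      rw [hr, ← integral_pow_offspringLaw ω n hu1]
      exact norm_integral_pow_le_one _ hu1 _
    set f : (ℕ × ℕ) × ℕ → ℂ := fun a => s ^ (2 * a.1.1) * u ^ a.2 with hf
    have hm1 : Measurable fun z : ℕ → ℕ => (progeny n z, z n) :=
      (measurable_progeny n).prodMk (measurable_pi_apply n)
    have hm2 : Measurable fun z : ℕ → ℕ => ((progeny n z, z n), z (n + 1)) :=
      hm1.prodMk (measurable_pi_apply (n + 1))
    have hfm : Measurable f := Measurable.of_discrete
    have hfint : ∀ μ : Measure ((ℕ × ℕ) × ℕ), IsFiniteMeasure μ → Integrable f μ := by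
      intro μ hμ
      refine Integrable.of_bound hfm.aestronglyMeasurable 1 (Eventually.of_forall fun a => ?_)
      rw [hf, norm_mul, norm_pow, norm_pow]
      exact mul_le_one₀ (pow_le_one₀ (norm_nonneg _) hs) (by positivity)
        (pow_le_one₀ (norm_nonneg _) hu1)
    have h1 : ∫ z, s ^ (2 * progeny (n + 1) z) * v ^ z (n + 1) ∂Q
        = ∫ a, f a ∂(Q.map fun z => ((progeny n z, z n), z (n + 1))) := by
      rw [integral_map hm2.aemeasurable hfm.aestronglyMeasurable]
      refine integral_congr_ae (Eventually.of_forall fun z => ?_)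
      simp only [hf, hu]
      rw [progeny_succ, mul_pow, mul_add, pow_add, pow_mul s 2 (z (n + 1))]
      ring
    have := Measure.isProbabilityMeasure_map (μ := Q) hm1.aemeasurable
    have h2 : ∫ z, s ^ (2 * progeny (n + 1) z) * v ^ z (n + 1) ∂Q
        = r * ∫ z, s ^ (2 * progeny n z) * r ^ z n ∂Q := by
      rw [h1, h.map_eq_compProd, Measure.integral_compProd (hfint _ inferInstance)]
      have h3 : ∀ a : ℕ × ℕ, ∫ b, f (a, b) ∂stepKernel ω n a
          = r * (s ^ (2 * a.1) * r ^ a.2) := by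
        intro a
        simp only [hf]
        rw [integral_const_mul]
        have := integral_pow_branchingStep ω n a.2 hu1
        rw [show stepKernel ω n a = branchingStep ω n a.2 from rfl, this, ← hp, ← hr, pow_succ]
        ring
      simp only [h3]
      rw [integral_const_mul, integral_map hm1.aemeasurable
        (Measurable.of_discrete (f := fun a : ℕ × ℕ => s ^ (2 * a.1) * r ^ a.2)).aestronglyMeasurable]
    have hstep : firstPassage s p (s * v) = s * r := by
      rw [firstPassage, hr, hu, mul_div_assoc]
      congr 2
      ring
    have ep : (ω (((0 : ℕ) : ℤ) + 1 - ((n + 1 : ℕ) : ℤ)) : ℝ) = p := by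
      rw [hp, show ((0 : ℕ) : ℤ) + 1 - ((n + 1 : ℕ) : ℤ) = -(n : ℤ) by push_cast; ring]
    rw [passageProd, ep, hstep, h2]
    have e2 : (fun k : ℕ => (ω (((k + 1 : ℕ) : ℤ) + 1 - ((n + 1 : ℕ) : ℤ)) : ℝ))
        = fun k : ℕ => (ω ((k : ℤ) + 1 - n) : ℝ) := by
      funext k
      rw [show ((k + 1 : ℕ) : ℤ) + 1 - ((n + 1 : ℕ) : ℤ) = (k : ℤ) + 1 - n by push_cast; ring]
    rw [e2, ← ih hr1]
    ring

/-- A bound on the quenched mean of `Z n`, from the recursion `E Z_{n+1} = (E Z_n + 1) ρ_{-n}`. -/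
lemma IsBranchingLaw.lintegral_le (h : IsBranchingLaw ω Q) (n : ℕ) :
    ∫⁻ z, (z n : ℝ≥0∞) ∂Q
      ≤ ∑ j ∈ Finset.range n, ∏ k ∈ Finset.range (j + 1), rhoE ω (((k : ℤ) + 1) - n) := by
  induction n with
  | zero =>
    rw [lintegral_congr_ae (g := fun _ => 0) (h.ae_zero.mono fun z hz => by simp [hz])]
    simp
  | succ n ih =>
    have hm1 : Measurable fun z : ℕ → ℕ => (progeny n z, z n) :=
      (measurable_progeny n).prodMk (measurable_pi_apply n)
    have hm2 : Measurable fun z : ℕ → ℕ => ((progeny n z, z n), z (n + 1)) :=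
      hm1.prodMk (measurable_pi_apply (n + 1))
    have hmean : ∫⁻ z, (z (n + 1) : ℝ≥0∞) ∂Q
        = (∫⁻ z, (z n : ℝ≥0∞) ∂Q + 1) * rhoE ω (-(n : ℤ)) := by
      have h1 : ∫⁻ z, (z (n + 1) : ℝ≥0∞) ∂Q
          = ∫⁻ a, (a.2 : ℝ≥0∞) ∂(Q.map fun z => ((progeny n z, z n), z (n + 1))) := by
        rw [lintegral_map Measurable.of_discrete hm2]
      have := Measure.isProbabilityMeasure_map (μ := Q) hm1.aemeasurable
      rw [h1, h.map_eq_compProd, Measure.lintegral_compProd Measurable.of_discrete]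
      have h3 : ∀ a : ℕ × ℕ, ∫⁻ b, (b : ℝ≥0∞) ∂stepKernel ω n a
          = (a.2 + 1) * rhoE ω (-(n : ℤ)) := fun a => lintegral_branchingStep ω n a.2
      simp only [h3]
      rw [lintegral_map Measurable.of_discrete hm1, lintegral_mul_const' _ _ (by simp [rhoE]),
        lintegral_add_right _ measurable_const]
      simp
    rw [hmean, Finset.sum_range_succ']
    have e1 : ((0 : ℕ) : ℤ) + 1 - ((n + 1 : ℕ) : ℤ) = -n := by push_cast; ring
    have e2 : ∀ k : ℕ, ((k + 1 : ℕ) : ℤ) + 1 - ((n + 1 : ℕ) : ℤ) = k + 1 - n := fun k => by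
      push_cast; ring
    have e3 : ∀ j : ℕ, ∏ k ∈ Finset.range (j + 1 + 1), rhoE ω (((k : ℕ) : ℤ) + 1 - ((n + 1 : ℕ) : ℤ))
        = (∏ k ∈ Finset.range (j + 1), rhoE ω (((k : ℤ) + 1) - n)) * rhoE ω (-(n : ℤ)) := by
      intro j
      rw [Finset.prod_range_succ', e1]
      simp only [e2]
    simp only [e3, Finset.range_one, zero_add, Finset.prod_singleton, e1]
    rw [← Finset.sum_mul, add_mul, one_mul]
    gcongr

end Branching

/-! ### Hitting times and total progeny have the same annealed law up to reflection -/

/-- The law of a random variable with values in `ℕ` is determined by its generating function on the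
unit circle. -/
lemma measure_preimage_eq_of_gf {α β : Type*} [MeasurableSpace α] [MeasurableSpace β]
    {μ : Measure α} {ν : Measure β} [IsProbabilityMeasure μ] [IsProbabilityMeasure ν]
    {f : α → ℕ} {g : β → ℕ} (hf : Measurable f) (hg : Measurable g)
    (h : ∀ s : ℂ, ‖s‖ = 1 → ∫ a, s ^ f a ∂μ = ∫ b, s ^ g b ∂ν) (A : Set ℕ) :
    μ (f ⁻¹' A) = ν (g ⁻¹' A) := by
  have hc : Measurable fun n : ℕ => (n : ℝ) := Measurable.of_discrete
  have hf' : Measurable fun a => (f a : ℝ) := hc.comp hf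
  have hg' : Measurable fun b => (g b : ℝ) := hc.comp hg
  have := Measure.isProbabilityMeasure_map (μ := μ) hf'.aemeasurable
  have := Measure.isProbabilityMeasure_map (μ := ν) hg'.aemeasurable
  have hlaw : μ.map (fun a => (f a : ℝ)) = ν.map fun b => (g b : ℝ) := by
    refine Measure.ext_of_charFun (funext fun t => ?_)
    have hexp : Measurable fun x : ℝ => Complex.exp (t * x * Complex.I) := by fun_prop
    rw [charFun_apply_real, charFun_apply_real,
      integral_map hf'.aemeasurable hexp.aestronglyMeasurable,
      integral_map hg'.aemeasurable hexp.aestronglyMeasurable]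
    have key : ∀ n : ℕ, Complex.exp (t * (n : ℝ) * Complex.I)
        = Complex.exp (t * Complex.I) ^ n := fun n => by
      rw [← Complex.exp_nat_mul]; congr 1; push_cast; ring
    simp only [key]
    exact h _ (Complex.norm_exp_ofReal_mul_I t)
  have hA : MeasurableSet ((fun n : ℕ => (n : ℝ)) '' A) :=
    ((Set.to_countable A).image _).measurableSet
  have h1 := congrArg (fun m => m ((fun n : ℕ => (n : ℝ)) '' A)) hlaw
  simp only [Measure.map_apply hf' hA, Measure.map_apply hg' hA] at h1
  have e : (fun a => (f a : ℝ)) ⁻¹' ((fun n : ℕ => (n : ℝ)) '' A) = f ⁻¹' A := by ext c; simp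
  have e' : (fun b => (g b : ℝ)) ⁻¹' ((fun n : ℕ => (n : ℝ)) '' A) = g ⁻¹' A := by ext c; simp
  rwa [e, e'] at h1

/-- Jensen's inequality for the concave function `x ↦ x ^ β`. -/
lemma lintegral_rpow_le {α : Type*} [MeasurableSpace α] {μ : Measure α} [IsProbabilityMeasure μ]
    {f : α → ℝ≥0∞} (hf : AEMeasurable f μ) {β : ℝ} (h0 : 0 < β) (h1 : β ≤ 1) :
    ∫⁻ a, f a ^ β ∂μ ≤ (∫⁻ a, f a ∂μ) ^ β := by
  have := eLpNorm'_le_eLpNorm'_of_exponent_le (μ := μ) (f := f) h0 h1 hf.aestronglyMeasurable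
  simp only [eLpNorm', enorm_eq_self, ENNReal.rpow_one, one_div, inv_one] at this
  have h2 := ENNReal.rpow_le_rpow this h0.le
  rwa [← ENNReal.rpow_mul, inv_mul_cancel₀ h0.ne', ENNReal.rpow_one] at h2

section Annealed

variable {P : Measure Env} [IsProbabilityMeasure P] {κ : ℝ} {Ω' : Type*} [MeasurableSpace Ω']
  {Pr : Measure Ω'} [IsProbabilityMeasure Pr] {env : Ω' → Env} {Z : ℕ → Ω' → ℕ}

lemma IsBranching.exists_kernel (hZ : IsBranching Pr P env Z) :
    ∃ Q : Kernel Env (ℕ → ℕ), IsMarkovKernel Q ∧ (∀ᵐ ω ∂P, IsBranchingLaw ω (Q ω)) ∧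
      Pr.map (fun a n => Z n a) = Q ∘ₘ P := by
  obtain ⟨Q, hQ, hchain, hmap⟩ := exists_quenched_kernel (P := P) hZ.measurable_env
    hZ.measurable_branching (fun z : ℕ => if z = 0 then 1 else 0)
    (fun ω n z z' => branchingStep ω n z {z'})
    (by simp) (fun n z z' => measurable_branchingStep n z z') hZ.law
  refine ⟨Q, hQ, hchain, ?_⟩
  rw [← Measure.snd_compProd, ← hmap, Measure.snd, Measure.map_map measurable_snd
    (hZ.measurable_env.prodMk (measurable_pi_lambda _ hZ.measurable_branching))]
  rfl

/-- The hitting time of `n` by the walk reflected at `-1` is distributed as `n` plus twice the total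
progeny of the branching process up to generation `n`. -/
lemma IsBranching.measure_progeny_eq (hB : ConditionB P κ) (hZ : IsBranching Pr P env Z)
    {W : Measure (ℕ → ℤ)} [IsProbabilityMeasure W] (hW : AnnealedWalk P W) (n : ℕ) (A : Set ℕ) :
    W (cutSum 1 n ⁻¹' A) = Pr {a | n + 2 * progeny n (fun i => Z i a) ∈ A} := by
  have hZm : Measurable fun a n => Z n a := measurable_pi_lambda _ hZ.measurable_branching
  have hpm : Measurable fun a => n + 2 * progeny n (fun i => Z i a) :=
    (((measurable_progeny n).comp hZm).const_mul 2).const_add n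
  refine measure_preimage_eq_of_gf (measurable_cutSum 1 n) hpm (fun s hs => ?_) A
  obtain ⟨Q, hQ, hlaw, hmap⟩ := hZ.exists_kernel
  have hm : Measurable fun z : ℕ → ℕ => n + 2 * progeny n z :=
    ((measurable_progeny n).const_mul 2).const_add n
  have h1 : ∫ a, s ^ (n + 2 * progeny n (fun i => Z i a)) ∂Pr
      = ∫ z, s ^ (n + 2 * progeny n z) ∂(Q ∘ₘ P) := by
    rw [← hmap, integral_map hZm.aemeasurable (measurable_pow_comp s hm).aestronglyMeasurable]
  rw [h1, integral_comp_kernel (integrable_pow _ hs.le hm), hW.gf s hs.le n]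
  -- The branching process reads the environment at the sites `1 - n, …, 0`, the hitting time at
  -- `0, …, n - 1`.
  have h2 : ∀ᵐ ω ∂P, ∫ z, s ^ (n + 2 * progeny n z) ∂Q ω
      = passageProd s n (fun k => (shiftBy (1 - n) ω k : ℝ)) s := by
    filter_upwards [hlaw] with ω hω
    have h3 := hω.integral_progeny hs.le n (v := 1) (by simp)
    simp only [one_pow, mul_one] at h3
    simp only [pow_add]
    rw [integral_const_mul, h3]
    congr 1
    funext k
    rw [shiftBy_apply, add_sub_assoc]
  rw [integral_congr_ae h2]
  have hmeas : Measurable fun ω : Env => passageProd s n (fun k => (ω k : ℝ)) s :=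
    measurable_passageProd s n (p := fun (ω : Env) (k : ℕ) => (ω k : ℝ))
      (fun k => measurable_coe_env k) measurable_const
  have h4 := integral_map (μ := P) (measurable_shiftBy (1 - (n : ℤ))).aemeasurable
    (f := fun ω : Env => passageProd s n (fun k => (ω k : ℝ)) s) hmeas.aestronglyMeasurable
  rw [(hB.preserving _).map_eq] at h4
  exact h4

/-- Below the exponent `κ` the moments of the generation sizes are bounded. -/
lemma IsBranching.exists_moment_bound (hB : ConditionB P κ) (hZ : IsBranching Pr P env Z) {β : ℝ}
    (h0 : 0 < β) (h1 : β ≤ 1) (hβ : β < κ) :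
    ∃ C : ℝ≥0∞, C ≠ ⊤ ∧ ∀ n, ∫⁻ a, (Z n a : ℝ≥0∞) ^ β ∂Pr ≤ C := by
  refine ⟨_, hB.tsum_moments_ne_top h0 hβ, fun n => ?_⟩
  obtain ⟨Q, hQ, hlaw, hmap⟩ := hZ.exists_kernel
  have hZm : Measurable fun a n => Z n a := measurable_pi_lambda _ hZ.measurable_branching
  have hcoord : Measurable fun z : ℕ → ℕ => (z n : ℝ≥0∞) :=
    Measurable.of_discrete.comp (measurable_pi_apply n)
  have hmp : ∀ j : ℕ, Measurable fun ω : Env =>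
      (∏ k ∈ Finset.range (j + 1), rhoE ω (((k : ℤ) + 1) - n)) ^ β := fun j =>
    (measurable_prod_rhoE (fun k => (k : ℤ) + 1 - n) (j + 1)).pow_const β
  have hmf : Measurable fun z : ℕ → ℕ => (z n : ℝ≥0∞) ^ β := hcoord.pow_const β
  calc ∫⁻ a, (Z n a : ℝ≥0∞) ^ β ∂Pr = ∫⁻ z, (z n : ℝ≥0∞) ^ β ∂(Q ∘ₘ P) := by
        rw [← hmap, lintegral_map hmf hZm]
    _ = ∫⁻ ω, ∫⁻ z, (z n : ℝ≥0∞) ^ β ∂Q ω ∂P :=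
        Measure.lintegral_bind Q.measurable.aemeasurable hmf.aemeasurable
    _ ≤ ∫⁻ ω, ∑' j : ℕ, (∏ k ∈ Finset.range (j + 1), rhoE ω (((k : ℤ) + 1) - n)) ^ β ∂P := by
        refine lintegral_mono_ae (hlaw.mono fun ω hω => ?_)
        refine (lintegral_rpow_le hcoord.aemeasurable h0 h1).trans ?_
        refine (ENNReal.rpow_le_rpow ((hω.lintegral_le n).trans (ENNReal.sum_le_tsum _))
          h0.le).trans ?_
        exact ENNReal_tsum_rpow_le _ h0 h1
    _ = ∑' j : ℕ, ∫⁻ ω, (∏ k ∈ Finset.range (j + 1), rhoE ω k) ^ β ∂P := by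
        rw [lintegral_tsum fun j => (hmp j).aemeasurable]
        refine tsum_congr fun j => ?_
        rw [← (hB.preserving (1 - (n : ℤ))).lintegral_comp
          ((measurable_prod_rhoE (fun k => (k : ℤ)) (j + 1)).pow_const β)]
        simp only [rhoE_shiftBy, add_sub_assoc]
    _ ≤ _ := ENNReal.tsum_comp_le_tsum_of_injective (add_left_injective 1)
        (fun n : ℕ => ∫⁻ ω, (∏ k ∈ Finset.range n, rhoE ω k) ^ β ∂P)

end Annealed

/-! ### Convergence of distribution functions -/

/-- The distribution functions of `Y n` converge to `F` at every point. -/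
def CdfTendsto {α : Type*} [MeasurableSpace α] (μ : Measure α) (Y : ℕ → α → ℝ) (F : ℝ → ℝ) : Prop :=
  ∀ x, Tendsto (fun n => μ.real {a | Y n a ≤ x}) atTop (𝓝 (F x))

/-- The random variables `D n` converge to `0` in probability. -/
def InProbZero {α : Type*} [MeasurableSpace α] (μ : Measure α) (D : ℕ → α → ℝ) : Prop :=
  ∀ ε : ℝ, 0 < ε → Tendsto (fun n => μ.real {a | ε < |D n a|}) atTop (𝓝 0)

section Cdf

variable {α : Type*} [MeasurableSpace α] {μ : Measure α}
  {Y Y' : ℕ → α → ℝ} {D D' : ℕ → α → ℝ} {F : ℝ → ℝ}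

lemma tendsto_zero_of_forall_eventually_le {u : ℕ → ℝ} (h0 : ∀ n, 0 ≤ u n)
    (h : ∀ δ : ℝ, 0 < δ → ∀ᶠ n in atTop, u n ≤ δ) : Tendsto u atTop (𝓝 0) := by
  refine Metric.tendsto_atTop'.mpr fun ε hε => ?_
  obtain ⟨N, hN⟩ := (h (ε / 2) (by linarith)).exists_forall_of_atTop
  refine ⟨N, fun n hn => ?_⟩
  rw [Real.dist_0_eq_abs, abs_of_nonneg (h0 n)]
  linarith [hN n hn.le]

lemma InProbZero.comp (h : InProbZero μ D) {N : ℕ → ℕ} (hN : Tendsto N atTop atTop) :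
    InProbZero μ fun n => D (N n) := fun ε hε => (h ε hε).comp hN

lemma InProbZero.const {r : ℕ → ℝ} (hr : Tendsto r atTop (𝓝 0)) :
    InProbZero μ fun n _ => r n := by
  intro ε hε
  refine tendsto_const_nhds.congr' ?_
  have := hr.abs
  rw [abs_zero] at this
  filter_upwards [this.eventually (gt_mem_nhds hε)] with n hn
  have : {a : α | ε < |r n|} = ∅ := by
    ext a; simpa using hn.le
  rw [this, measureReal_empty]

lemma CdfTendsto.comp (h : CdfTendsto μ Y F) {N : ℕ → ℕ} (hN : Tendsto N atTop atTop) :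
    CdfTendsto μ (fun n => Y (N n)) F := fun x => (h x).comp hN

variable [IsProbabilityMeasure μ]

lemma InProbZero.add (h : InProbZero μ D) (h' : InProbZero μ D') :
    InProbZero μ fun n a => D n a + D' n a := by
  intro ε hε
  have := (h (ε / 2) (by linarith)).add (h' (ε / 2) (by linarith))
  rw [add_zero] at this
  refine squeeze_zero (fun n => measureReal_nonneg) (fun n => ?_) this
  refine (measureReal_mono ?_).trans (measureReal_union_le _ _)
  intro a ha
  by_contra hne
  have ha : ε < |D n a + D' n a| := ha
  have h1 : ¬ ε / 2 < |D n a| := fun h => hne (Or.inl h)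
  have h2 : ¬ ε / 2 < |D' n a| := fun h => hne (Or.inr h)
  linarith [abs_add_le (D n a) (D' n a)]

lemma InProbZero.of_abs_le (h : InProbZero μ D) (hle : ∀ᶠ n in atTop, ∀ᵐ a ∂μ, |D' n a| ≤ |D n a|) :
    InProbZero μ D' := by
  intro ε hε
  refine squeeze_zero' (Eventually.of_forall fun n => measureReal_nonneg) ?_ (h ε hε)
  filter_upwards [hle] with n hn
  refine ENNReal.toReal_mono (measure_ne_top _ _) (measure_mono_ae ?_)
  filter_upwards [hn] with a ha h1
  exact lt_of_lt_of_le h1 ha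

lemma InProbZero.of_ae_tendsto (hD : ∀ n, Measurable (D n))
    (h : ∀ᵐ a ∂μ, Tendsto (fun n => D n a) atTop (𝓝 0)) : InProbZero μ D := by
  intro ε hε
  have h1 := tendstoInMeasure_of_tendsto_ae (fun n => (hD n).aestronglyMeasurable) h
  rw [tendstoInMeasure_iff_measureReal_norm] at h1
  refine squeeze_zero (fun n => measureReal_nonneg) (fun n => measureReal_mono ?_) (h1 ε hε)
  intro a ha
  have ha : ε < |D n a| := ha
  change ε ≤ ‖D n a - 0‖
  rw [sub_zero, Real.norm_eq_abs]
  exact ha.le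

/-- Slutsky's lemma for distribution functions with a continuous limit. -/
lemma CdfTendsto.perturb (h : CdfTendsto μ Y F) (hF : Continuous F)
    (hD : InProbZero μ fun n a => Y' n a - Y n a) : CdfTendsto μ Y' F := by
  intro x
  rw [Metric.tendsto_nhds]
  intro δ hδ
  obtain ⟨ε, hε, hFε⟩ := Metric.continuous_iff.mp hF x (δ / 3) (by linarith)
  have hε2 : 0 < ε / 2 := by linarith
  have h1 := (h (x + ε / 2)).eventually_lt_const
    (show F (x + ε / 2) < F (x + ε / 2) + δ / 3 by linarith)
  have h2 := (h (x - ε / 2)).eventually_const_lt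
    (show F (x - ε / 2) - δ / 3 < F (x - ε / 2) by linarith)
  have h3 := (hD (ε / 2) hε2).eventually_lt_const (show 0 < δ / 3 by linarith)
  have h4 := hFε (x + ε / 2) (by rw [Real.dist_eq, add_sub_cancel_left, abs_of_pos hε2]; linarith)
  have h5 := hFε (x - ε / 2) (by
    rw [Real.dist_eq, sub_sub_cancel_left, abs_neg, abs_of_pos hε2]; linarith)
  rw [Real.dist_eq, abs_lt] at h4 h5
  filter_upwards [h1, h2, h3] with n h1 h2 h3
  have i1 : μ.real {a | Y' n a ≤ x}
      ≤ μ.real {a | Y n a ≤ x + ε / 2} + μ.real {a | ε / 2 < |Y' n a - Y n a|} := by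
    refine (measureReal_mono ?_).trans (measureReal_union_le _ _)
    intro a ha
    by_cases hc : ε / 2 < |Y' n a - Y n a|
    · exact Or.inr hc
    · have ha : Y' n a ≤ x := ha
      have := (abs_le.mp (not_lt.mp hc)).1
      exact Or.inl (show Y n a ≤ x + ε / 2 by linarith)
  have i2 : μ.real {a | Y n a ≤ x - ε / 2}
      ≤ μ.real {a | Y' n a ≤ x} + μ.real {a | ε / 2 < |Y' n a - Y n a|} := by
    refine (measureReal_mono ?_).trans (measureReal_union_le _ _)
    intro a ha
    by_cases hc : ε / 2 < |Y' n a - Y n a|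
    · exact Or.inr hc
    · have ha : Y n a ≤ x - ε / 2 := ha
      have := (abs_le.mp (not_lt.mp hc)).2
      exact Or.inl (show Y' n a ≤ x by linarith)
  rw [Real.dist_eq, abs_lt]
  constructor <;> linarith [h4.1, h4.2, h5.1, h5.2]

lemma CdfTendsto.threshold (h : CdfTendsto μ Y F) (hF : Continuous F) {x : ℕ → ℝ} {x₀ : ℝ}
    (hx : Tendsto x atTop (𝓝 x₀)) :
    Tendsto (fun n => μ.real {a | Y n a ≤ x n}) atTop (𝓝 (F x₀)) := by
  have h1 : CdfTendsto μ (fun n a => Y n a + (x₀ - x n)) F := by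
    refine h.perturb hF ?_
    simp only [add_sub_cancel_left]
    refine InProbZero.const ?_
    simpa using hx.const_sub x₀
  refine (h1 x₀).congr fun n => ?_
  congr 1
  ext a
  change Y n a + (x₀ - x n) ≤ x₀ ↔ Y n a ≤ x n
  constructor <;> intro <;> linarith

/-- Convergence in law implies tightness. -/
lemma CdfTendsto.mul_tendsto_zero (h : CdfTendsto μ Y F) (hY : ∀ n, Measurable (Y n))
    (h0 : Tendsto F atBot (𝓝 0)) (h1 : Tendsto F atTop (𝓝 1)) {r : ℕ → ℝ}
    (hr : Tendsto r atTop (𝓝 0)) : InProbZero μ fun n a => r n * Y n a := by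
  intro ε hε
  refine tendsto_zero_of_forall_eventually_le (fun n => measureReal_nonneg) fun δ hδ => ?_
  obtain ⟨K, hK1, hK2, hK0⟩ : ∃ K : ℝ, 1 - F K < δ / 4 ∧ F (-K) < δ / 4 ∧ 0 < K := by
    have e1 : ∀ᶠ K in atTop, 1 - F K < δ / 4 := by
      filter_upwards [h1.eventually (lt_mem_nhds (a := 1 - δ / 4) (by linarith))] with K hK
      linarith
    have e2 : ∀ᶠ K in atTop, F (-K) < δ / 4 :=
      (h0.comp tendsto_neg_atTop_atBot).eventually (gt_mem_nhds (by linarith))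
    exact (e1.and (e2.and (eventually_gt_atTop 0))).exists
  have e3 : ∀ᶠ n in atTop, |r n| < ε / K := by
    have := hr.abs
    rw [abs_zero] at this
    exact this.eventually (gt_mem_nhds (by positivity))
  filter_upwards [e3, (h K).eventually_const_lt (show F K - δ / 4 < F K by linarith),
    (h (-K)).eventually_lt_const (show F (-K) < F (-K) + δ / 4 by linarith)] with n h3 h4 h5
  have hm : MeasurableSet {a | Y n a ≤ K} := measurableSet_le (hY n) measurable_const
  have hcompl : μ.real {a | Y n a ≤ K}ᶜ = 1 - μ.real {a | Y n a ≤ K} := by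
    rw [measureReal_compl hm, probReal_univ]
  have hle : μ.real {a | ε < |r n * Y n a|}
      ≤ μ.real {a | Y n a ≤ K}ᶜ + μ.real {a | Y n a ≤ -K} := by
    refine (measureReal_mono ?_).trans (measureReal_union_le _ _)
    intro a ha
    have ha : ε < |r n * Y n a| := ha
    by_contra hne
    have c1 : Y n a ≤ K := by
      by_contra hc; exact hne (Or.inl hc)
    have c2 : -K < Y n a := by
      by_contra hc; exact hne (Or.inr (not_lt.mp hc))
    have c3 : |Y n a| ≤ K := abs_le.mpr ⟨c2.le, c1⟩
    rw [abs_mul] at ha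
    have : |r n| * |Y n a| ≤ ε / K * K := by gcongr
    rw [div_mul_cancel₀ _ hK0.ne'] at this
    linarith
  linarith

end Cdf

/-! ### Stable laws have continuous distribution functions -/

/-- A law whose characteristic function is bounded by that of a symmetric stable law has no atoms:
`ν {a} ≤ ∫ exp (-(n (x - a))² / 2) dν(x)`, and by Fubini's theorem the right side is the Gaussian
average of `t ↦ exp(-i a n t) φ(n t)`, which tends to `0`. -/
lemma measure_singleton_eq_zero {ν : Measure ℝ} [IsProbabilityMeasure ν] {b κ : ℝ} (hb : 0 < b)
    (hκ : 0 < κ) (h : ∀ t, ‖charFun ν t‖ ≤ Real.exp (-b * |t| ^ κ)) (a : ℝ) : ν {a} = 0 := by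
  set G : Measure ℝ := gaussianReal 0 1 with hG
  have hcont : ∀ n : ℕ, Continuous fun t : ℝ => Real.exp (-b * |n * t| ^ κ) := fun n =>
    Real.continuous_exp.comp (continuous_const.mul
      ((continuous_abs.comp (continuous_const.mul continuous_id)).rpow_const
        fun _ => Or.inr hκ.le))
  have hbound : ∀ n : ℕ, ν.real {a} ≤ ∫ t, Real.exp (-b * |n * t| ^ κ) ∂G := by
    intro n
    set f : ℝ → ℝ → ℂ := fun x t => Complex.exp (((n : ℝ) * (x - a) * t : ℝ) * Complex.I) with hf
    have hfm : Measurable (Function.uncurry f) := by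
      simp only [hf, Function.uncurry_def]
      fun_prop
    have hfn : ∀ x t, ‖f x t‖ = 1 := fun x t => Complex.norm_exp_ofReal_mul_I _
    have hfi : Integrable (Function.uncurry f) (ν.prod G) :=
      Integrable.of_bound hfm.aestronglyMeasurable 1
        (Eventually.of_forall fun p => (hfn p.1 p.2).le)
    have hswap := integral_integral_swap hfi
    have hinner : ∀ x, ∫ t, f x t ∂G = ((Real.exp (-((n : ℝ) * (x - a)) ^ 2 / 2) : ℝ) : ℂ) := by
      intro x
      have := charFun_gaussianReal (μ := 0) (v := 1) ((n : ℝ) * (x - a))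
      rw [charFun_apply_real] at this
      simp only [hf]
      push_cast at this ⊢
      rw [this]
      simp
      ring_nf
    have houter : ∀ t, ‖∫ x, f x t ∂ν‖ ≤ Real.exp (-b * |n * t| ^ κ) := by
      intro t
      have e : ∀ x, f x t = Complex.exp (((-(n * a * t) : ℝ) : ℂ) * Complex.I)
          * Complex.exp (((n * t : ℝ) : ℂ) * x * Complex.I) := by
        intro x
        rw [hf, ← Complex.exp_add]
        push_cast
        ring_nf
      simp only [e]
      rw [integral_const_mul, norm_mul, Complex.norm_exp_ofReal_mul_I, one_mul,
        ← charFun_apply_real]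
      exact h _
    have hreal : Integrable (fun x => Real.exp (-((n : ℝ) * (x - a)) ^ 2 / 2)) ν := by
      refine Integrable.of_bound (by fun_prop) 1 (Eventually.of_forall fun x => ?_)
      rw [Real.norm_of_nonneg (Real.exp_pos _).le]
      refine Real.exp_le_one_iff.mpr ?_
      have := sq_nonneg ((n : ℝ) * (x - a))
      linarith
    calc ν.real {a} = ∫ x, Set.indicator {a} (fun _ => (1 : ℝ)) x ∂ν := by
          rw [integral_indicator_const _ (measurableSet_singleton a)]; simp
      _ ≤ ∫ x, Real.exp (-((n : ℝ) * (x - a)) ^ 2 / 2) ∂ν := by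
          refine integral_mono ((integrable_const _).indicator (measurableSet_singleton a)) hreal
            fun x => ?_
          by_cases hx : x = a
          · simp [hx]
          · rw [Set.indicator_of_notMem (by simpa using hx)]
            exact (Real.exp_pos _).le
      _ ≤ ‖∫ x, ∫ t, f x t ∂G ∂ν‖ := by
          simp only [hinner]
          rw [integral_complex_ofReal, Complex.norm_real]
          exact le_abs_self _
      _ ≤ ∫ t, Real.exp (-b * |n * t| ^ κ) ∂G := by
          rw [hswap]
          refine norm_integral_le_of_norm_le ?_ (Eventually.of_forall houter)
          refine Integrable.of_bound (hcont n).aestronglyMeasurable 1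
            (Eventually.of_forall fun x => ?_)
          rw [Real.norm_of_nonneg (Real.exp_pos _).le]
          refine Real.exp_le_one_iff.mpr ?_
          have : 0 ≤ |n * x| ^ κ := Real.rpow_nonneg (abs_nonneg _) _
          nlinarith
  have hlim : Tendsto (fun n : ℕ => ∫ t, Real.exp (-b * |n * t| ^ κ) ∂G) atTop (𝓝 (∫ _t, 0 ∂G)) := by
    refine tendsto_integral_of_dominated_convergence (fun _ => 1)
      (fun n => (hcont n).aestronglyMeasurable)
      (integrable_const _) (fun n => Eventually.of_forall fun x => ?_) ?_
    · rw [Real.norm_of_nonneg (Real.exp_pos _).le]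
      refine Real.exp_le_one_iff.mpr ?_
      have : 0 ≤ |n * x| ^ κ := Real.rpow_nonneg (abs_nonneg _) _
      nlinarith
    · have hne : ∀ᵐ t ∂G, t ≠ 0 := by
        have := nullSingletonClass_gaussianReal (μ := 0) (v := 1) one_ne_zero
        exact Measure.ae_ne G 0
      filter_upwards [hne] with t ht
      refine Real.tendsto_exp_atBot.comp ?_
      refine Tendsto.const_mul_atTop_of_neg (by linarith) ?_
      refine (tendsto_rpow_atTop hκ).comp ?_
      simp only [abs_mul, Nat.abs_cast]
      exact tendsto_natCast_atTop_atTop.atTop_mul_const (abs_pos.mpr ht)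
  rw [integral_zero] at hlim
  have h0 : ν.real {a} ≤ 0 := ge_of_tendsto' hlim hbound
  have h1 : ν.real {a} = 0 := le_antisymm h0 measureReal_nonneg
  exact (measureReal_eq_zero_iff).mp h1

lemma IsStableLaw.measure_singleton {κ b : ℝ} {ν : ProbabilityMeasure ℝ} (h : IsStableLaw κ b ν)
    (hb : 0 < b) (hκ : 0 < κ) (a : ℝ) : (ν : Measure ℝ) {a} = 0 := by
  refine measure_singleton_eq_zero hb hκ (fun t => ?_) a
  rw [h t, Complex.norm_exp]
  simp

lemma continuous_cdf_of_singleton {ν : Measure ℝ} [IsProbabilityMeasure ν]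
    (h : ∀ a, ν {a} = 0) : Continuous (cdf ν) := by
  refine continuous_iff_continuousAt.mpr fun a => ?_
  have h1 : (cdf ν).measure {a} = 0 := by rw [measure_cdf]; exact h a
  rw [StieltjesFunction.measure_singleton] at h1
  have h2 := ENNReal.ofReal_eq_zero.mp h1
  have h3 := (cdf ν).mono.leftLim_le (le_refl a)
  rw [(cdf ν).mono.continuousAt_iff_leftLim_eq_rightLim, (cdf ν).rightLim_eq]
  linarith

/-- Convergence in distribution to an atomless limit, in terms of distribution functions. -/
lemma cdfTendsto_of_tendstoInDistribution {α : Type*} [MeasurableSpace α] {μ : Measure α}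
    [IsProbabilityMeasure μ] {Y : ℕ → α → ℝ} {ν : Measure ℝ} [IsProbabilityMeasure ν]
    (hν : ∀ a, ν {a} = 0) (h : TendstoInDistribution Y atTop id (fun _ => μ) ν) :
    CdfTendsto μ Y (cdf ν) := by
  intro x
  have h1 := ProbabilityMeasure.tendsto_measure_of_null_frontier_of_tendsto' h.tendsto
    (E := Set.Iic x) (by
      change (ν.map id) (frontier (Set.Iic x)) = 0
      rw [Measure.map_id, frontier_Iic]
      exact hν x)
  have : IsProbabilityMeasure (ν.map id) := by rw [Measure.map_id]; infer_instance
  have h2 := (ENNReal.tendsto_toReal (measure_ne_top (ν.map id) (Set.Iic x))).comp h1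
  change Tendsto _ _ (𝓝 ((ν.map id) (Set.Iic x)).toReal) at h2
  rw [Measure.map_id, ← measureReal_def, ← cdf_eq_real] at h2
  refine h2.congr fun n => ?_
  change ((μ.map (Y n)) (Set.Iic x)).toReal = _
  rw [Measure.map_apply_of_aemeasurable (h.forall_aemeasurable n) measurableSet_Iic]
  rfl

/-! ### The limit law of the hitting times -/

/-- A sequence that converges in law is negligible after multiplication by a null sequence. -/
lemma inProbZero_mul_of_tendstoInDistribution {α : Type*} [MeasurableSpace α] {μ : Measure α}
    [IsProbabilityMeasure μ] {Y : ℕ → α → ℝ} {ν : Measure ℝ} [IsProbabilityMeasure ν]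
    (h : TendstoInDistribution Y atTop id (fun _ => μ) ν) {r : ℕ → ℝ}
    (hr : Tendsto r atTop (𝓝 0)) : InProbZero μ fun n a => r n * Y n a := by
  intro ε hε
  have hm : TendstoInMeasure μ (fun n (_ : α) => r n) atTop fun _ => (0 : ℝ) :=
    tendstoInMeasure_of_tendsto_ae (fun n => aestronglyMeasurable_const)
      (Eventually.of_forall fun _ => hr)
  have h1 : TendstoInDistribution (fun n a => r n * Y n a) atTop (fun _ => (0 : ℝ))
      (fun _ => μ) ν := by
    have := h.continuous_comp_prodMk_of_tendstoInMeasure_const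
      (g := fun p : ℝ × ℝ => p.2 * p.1) (by fun_prop) hm (fun _ => aemeasurable_const)
    simpa using this
  have hopen : IsOpen {x : ℝ | ε < |x|} := isOpen_lt continuous_const continuous_abs
  have hfr : frontier {x : ℝ | ε < |x|} ⊆ {0}ᶜ := by
    intro x hx h0
    have h2 : ε ≤ |x| := closure_lt_subset_le continuous_const continuous_abs hx.1
    rw [Set.mem_singleton_iff.mp h0, abs_zero] at h2
    linarith
  have hz : (ν.map fun _ => (0 : ℝ)) {0}ᶜ = 0 := by
    rw [Measure.map_apply measurable_const (measurableSet_singleton _).compl]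
    simp
  have h2 := ProbabilityMeasure.tendsto_measure_of_null_frontier_of_tendsto' h1.tendsto
    (measure_mono_null hfr hz)
  change Tendsto (fun n => (μ.map fun a => r n * Y n a) {x | ε < |x|}) atTop
    (𝓝 ((ν.map fun _ => (0 : ℝ)) {x | ε < |x|})) at h2
  have hsub : {x : ℝ | ε < |x|} ⊆ {0}ᶜ := by
    intro x hx h0
    have hx : ε < |x| := hx
    rw [Set.mem_singleton_iff.mp h0, abs_zero] at hx
    linarith
  rw [measure_mono_null hsub hz] at h2
  refine ((ENNReal.tendsto_toReal ENNReal.zero_ne_top).comp h2).congr fun n => ?_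
  change ((μ.map fun a => r n * Y n a) {x | ε < |x|}).toReal = _
  rw [Measure.map_apply_of_aemeasurable (h1.forall_aemeasurable n) hopen.measurableSet]
  rfl

section Window

variable {α : Type*} [MeasurableSpace α] {μ : Measure α} {Z : ℕ → α → ℕ} {β : ℝ} {C : ℝ≥0∞}

/-- Markov's inequality for a sum over a window, from a bound on a fractional moment. -/
lemma measureReal_sum_gt_le [IsFiniteMeasure μ] (hZ : ∀ n, Measurable (Z n)) (h0 : 0 < β)
    (h1 : β ≤ 1)
    (hC : C ≠ ⊤) (hM : ∀ n, ∫⁻ a, (Z n a : ℝ≥0∞) ^ β ∂μ ≤ C) (s : Finset ℕ) {t : ℝ} (ht : 0 < t) :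
    μ.real {a | t < ∑ i ∈ s, (Z i a : ℝ)} ≤ s.card * C.toReal / t ^ β := by
  have hm : ∀ i, Measurable fun a => (Z i a : ℝ≥0∞) ^ β := fun i =>
    ((measurable_from_top (f := fun k : ℕ => (k : ℝ≥0∞))).comp (hZ i)).pow_const β
  have hint : ∫⁻ a, ∑ i ∈ s, (Z i a : ℝ≥0∞) ^ β ∂μ ≤ s.card * C := by
    rw [lintegral_finsetSum s fun i _ => hm i]
    calc _ ≤ ∑ _i ∈ s, C := Finset.sum_le_sum fun i _ => hM i
      _ = s.card * C := by rw [Finset.sum_const, nsmul_eq_mul]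
  have hsub : {a | t < ∑ i ∈ s, (Z i a : ℝ)}
      ⊆ {a | ENNReal.ofReal (t ^ β) ≤ ∑ i ∈ s, (Z i a : ℝ≥0∞) ^ β} := by
    intro a ha
    have ha : t < ∑ i ∈ s, (Z i a : ℝ) := ha
    change ENNReal.ofReal (t ^ β) ≤ ∑ i ∈ s, (Z i a : ℝ≥0∞) ^ β
    rw [← ENNReal.ofReal_rpow_of_pos ht]
    have e1 : ENNReal.ofReal t ≤ ∑ i ∈ s, (Z i a : ℝ≥0∞) := by
      refine ENNReal.ofReal_le_of_le_toReal ?_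
      rw [ENNReal.toReal_sum fun i _ => ENNReal.natCast_ne_top _]
      simpa using ha.le
    refine (ENNReal.rpow_le_rpow e1 h0.le).trans ?_
    have := ENNReal_tsum_rpow_le (fun i : s => (Z i a : ℝ≥0∞)) h0 h1
    rwa [tsum_fintype, tsum_fintype, Finset.sum_coe_sort s fun i => (Z i a : ℝ≥0∞),
      Finset.sum_coe_sort s fun i => (Z i a : ℝ≥0∞) ^ β] at this
  have hpos : 0 < t ^ β := Real.rpow_pos_of_pos ht β
  have hmk : μ {a | t < ∑ i ∈ s, (Z i a : ℝ)} ≤ s.card * C / ENNReal.ofReal (t ^ β) := by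
    refine (measure_mono hsub).trans ?_
    refine (meas_ge_le_lintegral_div
      (Finset.measurable_sum (f := fun i a => (Z i a : ℝ≥0∞) ^ β) s fun i _ => hm i).aemeasurable
      (by simpa using hpos) ENNReal.ofReal_ne_top).trans ?_
    gcongr
  have hne : s.card * C / ENNReal.ofReal (t ^ β) ≠ ⊤ :=
    ENNReal.div_ne_top (ENNReal.mul_ne_top (ENNReal.natCast_ne_top _) hC) (by simpa using hpos)
  refine (ENNReal.toReal_mono hne hmk).trans_eq ?_
  rw [ENNReal.toReal_div, ENNReal.toReal_mul, ENNReal.toReal_natCast,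
    ENNReal.toReal_ofReal hpos.le]

/-- Random and deterministic partial sums of a sequence with bounded fractional moments are close
as soon as the two indices are. -/
lemma inProbZero_sum_sub_sum [IsProbabilityMeasure μ] (hZ : ∀ n, Measurable (Z n)) (h0 : 0 < β)
    (h1 : β ≤ 1) (hC : C ≠ ⊤) (hM : ∀ n, ∫⁻ a, (Z n a : ℝ≥0∞) ^ β ∂μ ≤ C)
    {τ : ℕ → α → ℕ} {w B : ℕ → ℝ} (hB : ∀ᶠ n in atTop, 0 < B n) (hw0 : ∀ᶠ n in atTop, 1 ≤ w n)
    (hw : Tendsto (fun n => μ.real {a | w n < |(τ n a : ℝ) - n|}) atTop (𝓝 0))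
    (hwB : Tendsto (fun n => w n / B n ^ β) atTop (𝓝 0)) :
    InProbZero μ fun n a =>
      (∑ i ∈ Finset.Icc 1 n, (Z i a : ℝ) - ∑ i ∈ Finset.Icc 1 (τ n a), (Z i a : ℝ)) / B n := by
  intro ε hε
  have hlim : Tendsto (fun n => μ.real {a | w n < |(τ n a : ℝ) - n|}
      + 5 * C.toReal / ε ^ β * (w n / B n ^ β)) atTop (𝓝 0) := by
    simpa using hw.add (hwB.const_mul (5 * C.toReal / ε ^ β))
  refine squeeze_zero' (Eventually.of_forall fun n => measureReal_nonneg) ?_ hlim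
  filter_upwards [hB, hw0] with n hBn hwn
  set v : ℕ := ⌈w n⌉₊ with hv
  set s : Finset ℕ := Finset.Icc (n - v) (n + v) with hs
  have hcard : (s.card : ℝ) ≤ 5 * w n := by
    have e1 : s.card ≤ 2 * v + 1 := by
      rw [hs, Nat.card_Icc]; omega
    have e2 : (v : ℝ) < w n + 1 := Nat.ceil_lt_add_one (by linarith)
    have e3 : (s.card : ℝ) ≤ 2 * v + 1 := by exact_mod_cast e1
    linarith
  have hsub : {a | ε < |(∑ i ∈ Finset.Icc 1 n, (Z i a : ℝ)
        - ∑ i ∈ Finset.Icc 1 (τ n a), (Z i a : ℝ)) / B n|}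
      ⊆ {a | w n < |(τ n a : ℝ) - n|} ∪ {a | ε * B n < ∑ i ∈ s, (Z i a : ℝ)} := by
    intro a ha
    by_cases hc : w n < |(τ n a : ℝ) - n|
    · exact Or.inl hc
    · refine Or.inr ?_
      have ha : ε < |(∑ i ∈ Finset.Icc 1 n, (Z i a : ℝ)
        - ∑ i ∈ Finset.Icc 1 (τ n a), (Z i a : ℝ)) / B n| := ha
      change ε * B n < ∑ i ∈ s, (Z i a : ℝ)
      rw [abs_div, abs_of_pos hBn, lt_div_iff₀ hBn] at ha
      refine ha.trans_le ?_
      have hle := abs_le.mp ((not_lt.mp hc).trans (Nat.le_ceil (w n)))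
      have hτ1 : τ n a ≤ n + v := by
        have : (τ n a : ℝ) ≤ n + v := by linarith [hle.2]
        exact_mod_cast this
      have hτ2 : n ≤ τ n a + v := by
        have : (n : ℝ) ≤ τ n a + v := by linarith [hle.1]
        exact_mod_cast this
      have key : ∀ p q : ℕ, p ≤ n + v → n ≤ q + v →
          ∑ i ∈ Finset.Icc 1 p, (Z i a : ℝ) ≤ ∑ i ∈ Finset.Icc 1 q, (Z i a : ℝ)
            + ∑ i ∈ s, (Z i a : ℝ) := by
        intro p q hp hq
        have hsub : Finset.Icc 1 p ⊆ Finset.Icc 1 q ∪ s := by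
          intro i hi
          rw [Finset.mem_union, hs, Finset.mem_Icc, Finset.mem_Icc]
          rw [Finset.mem_Icc] at hi
          omega
        refine (Finset.sum_le_sum_of_subset_of_nonneg hsub
          fun i _ _ => Nat.cast_nonneg (Z i a)).trans ?_
        rw [← Finset.sum_union_inter]
        exact le_add_of_nonneg_right (Finset.sum_nonneg fun i _ => Nat.cast_nonneg _)
      rw [abs_le]
      constructor
      · linarith [key (τ n a) n hτ1 (by omega)]
      · linarith [key n (τ n a) (by omega) hτ2]
  refine (measureReal_mono hsub).trans ((measureReal_union_le _ _).trans ?_)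
  gcongr
  refine (measureReal_sum_gt_le hZ h0 h1 hC hM s (by positivity)).trans ?_
  rw [Real.mul_rpow hε.le hBn.le]
  have : 0 < ε ^ β := Real.rpow_pos_of_pos hε β
  have : 0 < B n ^ β := Real.rpow_pos_of_pos hBn β
  rw [div_mul_div_comm]
  rw [show 5 * C.toReal * w n = 5 * w n * C.toReal by ring]
  gcongr

end Window

lemma normB_of_ne {κ : ℝ} (h : κ ≠ 2) (m : ℕ) : normB κ m = (m : ℝ) ^ (1 / κ) := if_neg h

lemma normB_two (m : ℕ) : normB 2 m = ((m : ℝ) * Real.log m) ^ (1 / 2 : ℝ) := if_pos rfl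

lemma tendsto_normB {κ : ℝ} (h0 : 0 < κ) : Tendsto (normB κ) atTop atTop := by
  by_cases h : κ = 2
  · subst h
    simp only [funext normB_two]
    exact (tendsto_rpow_atTop (by norm_num)).comp (tendsto_natCast_atTop_atTop.atTop_mul_atTop₀
      (Real.tendsto_log_atTop.comp tendsto_natCast_atTop_atTop))
  · simp only [funext (normB_of_ne h)]
    exact (tendsto_rpow_atTop (by positivity)).comp tendsto_natCast_atTop_atTop

/-- For some moment exponent `β`, the sum of the `β`-th moments over a window of length of order
`√m` is negligible compared with `B_m ^ β`. -/
lemma exists_moment_exponent {κ : ℝ} (h0 : 0 < κ) (h2 : κ ≤ 2) :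
    ∃ β : ℝ, 0 < β ∧ β ≤ 1 ∧ β < κ ∧
      Tendsto (fun m : ℕ => normB κ m ^ β / √(m : ℝ)) atTop atTop := by
  rcases h2.eq_or_lt with h | h
  · subst h
    refine ⟨1, one_pos, le_rfl, by norm_num, ?_⟩
    have := (tendsto_rpow_atTop (show (0 : ℝ) < 1 / 2 by norm_num)).comp
      (Real.tendsto_log_atTop.comp tendsto_natCast_atTop_atTop)
    refine this.congr' ?_
    filter_upwards [eventually_ge_atTop 1] with m hm
    have hm : (1 : ℝ) ≤ m := by exact_mod_cast hm
    have hl : 0 ≤ Real.log m := Real.log_nonneg hm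
    rw [normB_two, Real.rpow_one, Real.mul_rpow (by linarith) hl, ← Real.sqrt_eq_rpow (m : ℝ)]
    rw [mul_div_cancel_left₀ _ (by positivity)]
    rfl
  · have hmin : κ / 2 < min κ 1 := lt_min (by linarith) (by linarith)
    obtain ⟨β, hb1, hb2⟩ := exists_between hmin
    refine ⟨β, by linarith, (hb2.trans_le (min_le_right _ _)).le,
      hb2.trans_le (min_le_left _ _), ?_⟩
    have hpos : 0 < 1 / κ * β - 1 / 2 := by
      rw [sub_pos, one_div_mul_eq_div, lt_div_iff₀ h0]
      linarith
    refine ((tendsto_rpow_atTop hpos).comp tendsto_natCast_atTop_atTop).congr' ?_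
    filter_upwards [eventually_ge_atTop 1] with m hm
    have hm : (0 : ℝ) < m := by exact_mod_cast hm
    rw [normB_of_ne h.ne, ← Real.rpow_mul hm.le, Real.sqrt_eq_rpow, ← Real.rpow_sub hm]
    rfl

lemma tendsto_floor_div {μ : ℝ} (hμ : 0 < μ) :
    Tendsto (fun n : ℕ => ⌊(n : ℝ) / μ⌋₊) atTop atTop :=
  tendsto_nat_floor_atTop.comp (tendsto_natCast_atTop_atTop.atTop_div_const hμ)

section HittingTimeLaw

variable {P : Measure Env} [IsProbabilityMeasure P] {κ μ : ℝ} {Ω' : Type*} [MeasurableSpace Ω']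
  {Pr : Measure Ω'} [IsProbabilityMeasure Pr] {env : Ω' → Env} {Z : ℕ → Ω' → ℕ}
  {η : ℕ → Ω' → ℕ} {A : ℕ → ℝ} {ν γ : Measure ℝ} [IsProbabilityMeasure ν] [IsProbabilityMeasure γ]

/-- The random index `η_m`, `m = ⌊n / μ⌋`, in the limit law for sums of the branching process may
be replaced by `n`. -/
theorem IsBranching.cdfTendsto_sum (hκ : κ ≤ 2) (hB : ConditionB P κ)
    (hZ : IsBranching Pr P env Z) (hμ : 0 < μ)
    (hCLT : TendstoInDistribution (fun (k : ℕ) a => ((η k a : ℝ) - (k : ℝ) * μ) / √(k : ℝ)) atTop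
      id (fun _ => Pr) γ)
    (hν : ∀ a, ν {a} = 0)
    (hStable : TendstoInDistribution
      (fun (k : ℕ) a => ((∑ i ∈ Finset.Icc 1 (η k a), (Z i a : ℝ)) - A k) / normB κ k) atTop
      id (fun _ => Pr) ν) :
    CdfTendsto Pr (fun n a => ((∑ i ∈ Finset.Icc 1 n, (Z i a : ℝ)) - A ⌊(n : ℝ) / μ⌋₊)
      / normB κ ⌊(n : ℝ) / μ⌋₊) (cdf ν) := by
  obtain ⟨β, h0, h1, hβκ, hu⟩ := exists_moment_exponent hB.kappa_pos hκ
  obtain ⟨C, hC, hM⟩ := hZ.exists_moment_bound hB h0 h1 hβκ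
  set u : ℕ → ℝ := fun m => normB κ m ^ β / √(m : ℝ) with hu_def
  have hmt := tendsto_floor_div hμ
  set m : ℕ → ℕ := fun n => ⌊(n : ℝ) / μ⌋₊ with hm_def
  refine ((cdfTendsto_of_tendstoInDistribution hν hStable).comp hmt).perturb
    (continuous_cdf_of_singleton hν) ?_
  -- The half-width `w` of the window of indices has to exceed `√m`, the order of the fluctuations
  -- of `η_m`, by a factor that tends to infinity, while `w = o(B_m ^ β)`, where
  -- `B_m ^ β = √m * u m`; the summand `μ` accounts for the integer part in `m = ⌊n / μ⌋`.
  set w : ℕ → ℝ := fun n => √(m n : ℝ) * √(u (m n)) + μ with hw_def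
  have hBt : Tendsto (fun n => normB κ (m n)) atTop atTop := (tendsto_normB hB.kappa_pos).comp hmt
  have hsu : Tendsto (fun k => √(u k)) atTop atTop := Real.tendsto_sqrt_atTop.comp hu
  have hsm : Tendsto (fun k : ℕ => √(k : ℝ)) atTop atTop :=
    Real.tendsto_sqrt_atTop.comp tendsto_natCast_atTop_atTop
  have hr : Tendsto (fun k => (√(u k))⁻¹) atTop (𝓝 0) := tendsto_inv_atTop_zero.comp hsu
  have hev : ∀ᶠ k : ℕ in atTop, 0 < √(k : ℝ) ∧ 0 < √(u k) ∧ 0 < u k ∧ 0 < normB κ k ∧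
      1 ≤ √(k : ℝ) * √(u k) :=
    (hsm.eventually_gt_atTop 0).and ((hsu.eventually_gt_atTop 0).and
      ((hu.eventually_gt_atTop 0).and (((tendsto_normB hB.kappa_pos).eventually_gt_atTop 0).and
        ((hsm.atTop_mul_atTop₀ hsu).eventually_ge_atTop 1))))
  have hkey := inProbZero_sum_sub_sum (μ := Pr) hZ.measurable_branching h0 h1 hC hM
    (τ := fun n => η (m n)) (w := w) (B := fun n => normB κ (m n))
    (hBt.eventually_gt_atTop 0) ?_ ?_ ?_
  · refine hkey.of_abs_le (Eventually.of_forall fun n => Eventually.of_forall fun a => le_of_eq ?_)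
    congr 1
    ring
  · filter_upwards [hmt.eventually hev] with n hn
    simp only [hw_def]
    linarith [hn.2.2.2.2]
  · have h3 := (inProbZero_mul_of_tendstoInDistribution hCLT hr).comp hmt 1 one_pos
    refine squeeze_zero' (Eventually.of_forall fun n => measureReal_nonneg) ?_ h3
    filter_upwards [hmt.eventually hev] with n hn
    refine measureReal_mono fun a ha => ?_
    have ha : w n < |(η (m n) a : ℝ) - n| := ha
    change 1 < |(√(u (m n)))⁻¹ * (((η (m n) a : ℝ) - (m n : ℝ) * μ) / √(m n : ℝ))|
    have hmn : |(m n : ℝ) * μ - n| ≤ μ := by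
      have e1 : (m n : ℝ) ≤ n / μ := Nat.floor_le (by positivity)
      have e2 : (n : ℝ) / μ < m n + 1 := Nat.lt_floor_add_one _
      rw [le_div_iff₀ hμ] at e1
      rw [div_lt_iff₀ hμ] at e2
      rw [abs_le]
      constructor <;> linarith
    have h4 : √(m n : ℝ) * √(u (m n)) < |(η (m n) a : ℝ) - (m n : ℝ) * μ| := by
      have := abs_add_le ((η (m n) a : ℝ) - (m n : ℝ) * μ) ((m n : ℝ) * μ - n)
      rw [sub_add_sub_cancel] at this
      simp only [hw_def] at ha
      linarith
    rw [abs_mul, abs_div, abs_of_pos hn.1, abs_of_pos (inv_pos.mpr hn.2.1), inv_mul_eq_div, div_div,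
      one_lt_div (mul_pos hn.1 hn.2.1)]
    exact h4
  · have h5 : Tendsto (fun k => (√(u k))⁻¹ + μ * (normB κ k ^ β)⁻¹) atTop (𝓝 0) := by
      have := ((tendsto_rpow_atTop h0).comp (tendsto_normB hB.kappa_pos)).inv_tendsto_atTop
      simpa using hr.add (this.const_mul μ)
    refine (h5.comp hmt).congr' ?_
    filter_upwards [hmt.eventually hev] with n hn
    have h6 : normB κ (m n) ^ β = √(m n : ℝ) * (√(u (m n)) * √(u (m n))) := by
      rw [Real.mul_self_sqrt hn.2.2.1.le, hu_def]
      field_simp [hn.1.ne']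
    have h7 := hn.1
    have h8 := hn.2.1
    simp only [Function.comp_apply, hw_def]
    rw [add_div, div_eq_mul_inv μ, h6]
    congr 1
    field_simp

/-- The limit law of the hitting times `T_n` of the walk under its annealed law `W`. -/
theorem IsBranching.cdfTendsto_hitTime (hκ : κ ≤ 2) (hB : ConditionB P κ)
    (hZ : IsBranching Pr P env Z) (hμ : 0 < μ)
    (hCLT : TendstoInDistribution (fun (k : ℕ) a => ((η k a : ℝ) - (k : ℝ) * μ) / √(k : ℝ)) atTop
      id (fun _ => Pr) γ)
    (hν : ∀ a, ν {a} = 0)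
    (hStable : TendstoInDistribution
      (fun (k : ℕ) a => ((∑ i ∈ Finset.Icc 1 (η k a), (Z i a : ℝ)) - A k) / normB κ k) atTop
      id (fun _ => Pr) ν)
    {W : Measure (ℕ → ℤ)} [IsProbabilityMeasure W] (hW : AnnealedWalk P W) :
    CdfTendsto W (fun n y => ((hitTime n y : ℝ) - (n + 2 * A ⌊(n : ℝ) / μ⌋₊))
      / (2 * normB κ ⌊(n : ℝ) / μ⌋₊)) (cdf ν) := by
  have hF := continuous_cdf_of_singleton hν
  have hBt : Tendsto (fun n : ℕ => normB κ ⌊(n : ℝ) / μ⌋₊) atTop atTop :=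
    (tendsto_normB hB.kappa_pos).comp (tendsto_floor_div hμ)
  have h1 := hZ.cdfTendsto_sum hκ hB hμ hCLT hν hStable
  have h2 : CdfTendsto Pr (fun n a => ((progeny n (fun i => Z i a) : ℝ) - A ⌊(n : ℝ) / μ⌋₊)
      / normB κ ⌊(n : ℝ) / μ⌋₊) (cdf ν) := by
    refine h1.perturb hF ((InProbZero.of_ae_tendsto
      (D := fun n a => (Z 0 a : ℝ) * (normB κ ⌊(n : ℝ) / μ⌋₊)⁻¹) (fun n => ?_) ?_).of_abs_le ?_)
    · exact ((measurable_from_top (f := fun k : ℕ => (k : ℝ))).comp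
        (hZ.measurable_branching 0)).mul_const _
    · exact Eventually.of_forall fun a => by simpa using hBt.inv_tendsto_atTop.const_mul (Z 0 a : ℝ)
    · refine Eventually.of_forall fun n => Eventually.of_forall fun a => le_of_eq ?_
      congr 1
      rw [← sub_div, progeny, Finset.range_eq_Ico, Finset.sum_eq_sum_Ico_succ_bot n.succ_pos]
      rw [show Finset.Ico (0 + 1) (n + 1) = Finset.Icc 1 n by ext; simp]
      push_cast
      ring
  -- The reflected hitting time is distributed as `n` plus twice the total progeny.
  have h3 : CdfTendsto W (fun n y => ((cutSum 1 n y : ℝ) - (n + 2 * A ⌊(n : ℝ) / μ⌋₊))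
      / (2 * normB κ ⌊(n : ℝ) / μ⌋₊)) (cdf ν) := by
    intro x
    refine (h2 x).congr fun n => ?_
    have := hZ.measure_progeny_eq hB hW n
      {c | ((c : ℝ) - (n + 2 * A ⌊(n : ℝ) / μ⌋₊)) / (2 * normB κ ⌊(n : ℝ) / μ⌋₊) ≤ x}
    rw [measureReal_def, measureReal_def]
    congr 1
    refine Eq.trans ?_ this.symm
    congr 1
    ext a
    change _ / _ ≤ x ↔ (((n + 2 * progeny n (fun i => Z i a) : ℕ) : ℝ) - _) / _ ≤ x
    rw [← mul_div_mul_left _ (normB κ ⌊(n : ℝ) / μ⌋₊) two_ne_zero]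
    push_cast
    ring_nf
  refine h3.perturb hF (InProbZero.of_ae_tendsto (fun n => ?_) ?_)
  · have c1 : Measurable fun y => (hitTime n y : ℝ) :=
      (measurable_from_top (f := fun k : ℕ => (k : ℝ))).comp (measurable_hitTime n)
    have c2 : Measurable fun y => (cutSum 1 n y : ℝ) :=
      (measurable_from_top (f := fun k : ℕ => (k : ℝ))).comp (measurable_cutSum 1 n)
    exact ((c1.sub_const _).div_const _).sub ((c2.sub_const _).div_const _)
  · filter_upwards [hW.good] with y hy
    obtain ⟨L, hL⟩ := hy.exists_hitTime_le
    have hlim : Tendsto (fun n : ℕ => (L : ℝ) * (normB κ ⌊(n : ℝ) / μ⌋₊)⁻¹) atTop (𝓝 0) := by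
      simpa using hBt.inv_tendsto_atTop.const_mul (L : ℝ)
    refine squeeze_zero' ?_ ?_ hlim
    · filter_upwards [hBt.eventually_gt_atTop 0] with n hn
      rw [← sub_div]
      have : (cutSum 1 n y : ℝ) ≤ hitTime n y := by exact_mod_cast cutSum_le 1 n y
      exact div_nonneg (by linarith) (by linarith)
    · filter_upwards [hBt.eventually_gt_atTop 0] with n hn
      rw [← sub_div, ← div_eq_mul_inv]
      have h4 : (hitTime n y : ℝ) ≤ cutSum 1 n y + L := by exact_mod_cast hL n
      have : (0 : ℝ) ≤ L := Nat.cast_nonneg L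
      gcongr <;> linarith

end HittingTimeLaw

/-! ### From hitting times to the position of the walk -/

section Inversion

variable {P : Measure Env} {W : Measure (ℕ → ℤ)} [IsProbabilityMeasure W]

/-- The walk is bounded below, uniformly with high probability. -/
lemma AnnealedWalk.tendsto_measure_lt (hW : AnnealedWalk P W) :
    Tendsto (fun ζ : ℕ => W.real {y | ∃ k, y k < -(ζ : ℤ)}) atTop (𝓝 0) := by
  have hm : ∀ ζ : ℕ, MeasurableSet {y : ℕ → ℤ | ∃ k, y k < -(ζ : ℤ)} := by
    intro ζ
    have : {y : ℕ → ℤ | ∃ k, y k < -(ζ : ℤ)} = ⋃ k, {y | y k < -(ζ : ℤ)} := by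
      ext y; simp
    rw [this]
    exact MeasurableSet.iUnion fun k => measurableSet_lt (measurable_pi_apply k) measurable_const
  have hanti : Antitone fun ζ : ℕ => {y : ℕ → ℤ | ∃ k, y k < -(ζ : ℤ)} := by
    rintro ζ ζ' h y ⟨k, hk⟩
    exact ⟨k, by have : (ζ : ℤ) ≤ ζ' := by exact_mod_cast h
                 linarith⟩
  have h1 := tendsto_measure_iInter_atTop (μ := W) (fun ζ => (hm ζ).nullMeasurableSet) hanti
    ⟨0, measure_ne_top _ _⟩
  have h0 : W (⋂ ζ : ℕ, {y : ℕ → ℤ | ∃ k, y k < -(ζ : ℤ)}) = 0 := by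
    rw [← compl_compl (⋂ ζ : ℕ, {y : ℕ → ℤ | ∃ k, y k < -(ζ : ℤ)})]
    refine mem_ae_iff.mp ?_
    filter_upwards [hW.good] with y hy hmem
    obtain ⟨L, hL⟩ := (hy.2.eventually_ge_atTop 0).exists_forall_of_atTop
    obtain ⟨M, hM⟩ : ∃ M : ℕ, ∀ k < L, -(M : ℤ) ≤ y k := by
      refine ⟨∑ k ∈ Finset.range L, (y k).natAbs, fun k hk => ?_⟩
      have : (y k).natAbs ≤ ∑ k ∈ Finset.range L, (y k).natAbs :=
        Finset.single_le_sum (f := fun k => (y k).natAbs) (fun _ _ => Nat.zero_le _)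
          (Finset.mem_range.mpr hk)
      omega
    obtain ⟨k, hk⟩ := Set.mem_iInter.mp hmem M
    by_cases hkL : k < L
    · have := hM k hkL; omega
    · have := hL k (not_lt.mp hkL); omega
  rw [h0] at h1
  exact (ENNReal.tendsto_toReal ENNReal.zero_ne_top).comp h1

/-- The events `{y_n < N_n}` and `{T_{N_n} > n}` have the same asymptotic probability: after time
`T_{N_n + ζ}` the walk goes back below `N_n` with a probability that is small when `ζ` is large. -/
lemma AnnealedWalk.tendsto_lt (hW : AnnealedWalk P W) {N : ℕ → ℕ} {q : ℝ}
    (h : ∀ ζ : ℕ, Tendsto (fun n => W.real {y | hitTime (N n + ζ) y ≤ n}) atTop (𝓝 q)) :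
    Tendsto (fun n => W.real {y | y n < N n}) atTop (𝓝 (1 - q)) := by
  have hcompl : ∀ k n : ℕ, W.real {y | n < hitTime k y} = 1 - W.real {y | hitTime k y ≤ n} := by
    intro k n
    rw [← probReal_compl_eq_one_sub (measurableSet_le (measurable_hitTime k) measurable_const)]
    congr 1
    ext y
    simp
  have hlow : ∀ n, 1 - W.real {y | hitTime (N n + 0) y ≤ n} ≤ W.real {y | y n < N n} := by
    intro n
    rw [← hcompl]
    refine ENNReal.toReal_mono (measure_ne_top _ _) (measure_mono_ae ?_)
    filter_upwards [hW.good] with y hy h1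
    exact hy.lt_of_lt_hitTime h1
  have hup : ∀ ζ n : ℕ, W.real {y | y n < N n}
      ≤ 1 - W.real {y | hitTime (N n + ζ) y ≤ n} + W.real {y | ∃ k, y k < -(ζ : ℤ)} := by
    intro ζ n
    rw [← hcompl]
    -- If `T_{N n + ζ} ≤ n` and `y n < N n`, then the path after `T_{N n + ζ}`, seen from `N n + ζ`,
    -- goes below `-ζ`.
    have hinv : W.real ((afterOne^[N n + ζ]) ⁻¹' {y | ∃ k, y k < -(ζ : ℤ)})
        ≤ W.real {y | ∃ k, y k < -(ζ : ℤ)} :=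
      ENNReal.toReal_mono (measure_ne_top _ _) ((hW.preserving.iterate _).measure_preimage_le _)
    refine (measureReal_mono ?_).trans ((measureReal_union_le {y | n < hitTime (N n + ζ) y}
      ((afterOne^[N n + ζ]) ⁻¹' {y | ∃ k, y k < -(ζ : ℤ)})).trans (by gcongr))
    intro y hy
    by_cases hc : n < hitTime (N n + ζ) y
    · exact Or.inl hc
    · refine Or.inr ⟨n - hitTime (N n + ζ) y, ?_⟩
      rw [iterate_afterOne_apply, Nat.add_sub_cancel' (not_lt.mp hc)]
      have hy : y n < N n := hy
      push_cast
      linarith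
  rw [Metric.tendsto_nhds]
  intro ε hε
  obtain ⟨ζ, hζ⟩ := (hW.tendsto_measure_lt.eventually_lt_const
    (show 0 < ε / 2 by linarith)).exists
  filter_upwards [(h 0).eventually_lt_const (show q < q + ε by linarith),
    (h ζ).eventually_const_lt (show q - ε / 2 < q by linarith)] with n h1 h2
  rw [Real.dist_eq, abs_lt]
  constructor <;> linarith [hlow n, hup ζ n]

/-- Inversion of a limit law for the hitting times, for thresholds `c n` such that replacing
`c n` by an integer at bounded distance does not matter. -/
lemma AnnealedWalk.tendsto_le (hW : AnnealedWalk P W) {g s : ℕ → ℝ} {F : ℝ → ℝ}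
    (hF : Continuous F)
    (hT : CdfTendsto W (fun n y => ((hitTime n y : ℝ) - g n) / s n) F)
    (hs : ∀ᶠ n in atTop, 0 < s n) {c : ℕ → ℝ} {x : ℝ} (hc : Tendsto c atTop atTop)
    (hx : ∀ N : ℕ → ℕ, (∃ L : ℝ, ∀ᶠ n in atTop, |(N n : ℝ) - c n| ≤ L) →
      Tendsto (fun n : ℕ => ((n : ℝ) - g (N n)) / s (N n)) atTop (𝓝 x)) :
    Tendsto (fun n => W.real {y | (y n : ℝ) ≤ c n}) atTop (𝓝 (1 - F x)) := by
  have hfloor : Tendsto (fun n => ⌊c n⌋₊) atTop atTop := tendsto_nat_floor_atTop.comp hc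
  have hmain : Tendsto (fun n => W.real {y | y n < ((⌊c n⌋₊ + 1 : ℕ) : ℤ)}) atTop (𝓝 (1 - F x)) := by
    refine hW.tendsto_lt (N := fun n => ⌊c n⌋₊ + 1) fun ζ => ?_
    have hN : Tendsto (fun n => ⌊c n⌋₊ + 1 + ζ) atTop atTop :=
      tendsto_atTop_mono (fun n => by omega) hfloor
    have h1 := (hT.comp hN).threshold hF (hx (fun n => ⌊c n⌋₊ + 1 + ζ) ⟨1 + ζ, ?_⟩)
    · refine h1.congr' ?_
      filter_upwards [hN.eventually hs] with n hn
      congr 1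
      ext y
      rw [Set.mem_ofPred_eq, Set.mem_ofPred_eq, div_le_div_iff_of_pos_right hn, sub_le_sub_iff_right,
        Nat.cast_le]
    · filter_upwards [hc.eventually_ge_atTop 0] with n hn
      have e1 : (⌊c n⌋₊ : ℝ) ≤ c n := Nat.floor_le hn
      have e2 : c n < ⌊c n⌋₊ + 1 := Nat.lt_floor_add_one _
      have e3 : (0 : ℝ) ≤ ζ := Nat.cast_nonneg ζ
      push_cast
      rw [abs_le]
      constructor <;> linarith
  refine hmain.congr' ?_
  filter_upwards [hc.eventually_ge_atTop 0] with n hn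
  congr 1
  ext y
  change y n < ((⌊c n⌋₊ + 1 : ℕ) : ℤ) ↔ (y n : ℝ) ≤ c n
  rw [← Int.le_floor, Nat.cast_succ, Int.lt_add_one_iff, Int.natCast_floor_eq_floor hn]

end Inversion

/-! ### Almost sure convergence of Birkhoff averages -/

section Birkhoff

variable {α : Type*} {T : α → α} {f g : α → ℝ}

/-- The maximum of the Birkhoff sums `S_0, …, S_N` of `g`. -/
noncomputable def birkhoffMax (T : α → α) (g : α → ℝ) : ℕ → α → ℝ
  | 0 => fun _ => 0
  | N + 1 => fun x => max 0 (g x + birkhoffMax T g N (T x))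

lemma birkhoffMax_nonneg (N : ℕ) (x : α) : 0 ≤ birkhoffMax T g N x := by
  cases N with
  | zero => exact le_rfl
  | succ N => exact le_max_left _ _

lemma birkhoffMax_le_succ (N : ℕ) (x : α) : birkhoffMax T g N x ≤ birkhoffMax T g (N + 1) x := by
  induction N generalizing x with
  | zero => exact birkhoffMax_nonneg _ _
  | succ N ih => exact max_le_max le_rfl (add_le_add le_rfl (ih _))

lemma birkhoffSum_le_birkhoffMax (n : ℕ) (x : α) : birkhoffSum T g n x ≤ birkhoffMax T g n x := by
  induction n generalizing x with
  | zero => rw [birkhoffSum_zero]; exact le_rfl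
  | succ n ih =>
    rw [birkhoffSum_succ']
    exact (add_le_add le_rfl (ih _)).trans (le_max_right _ _)

/-- The set where the upper limit of the Birkhoff averages of `f` exceeds `a`. -/
def exceedSet (T : α → α) (f : α → ℝ) (a : ℝ) : Set α :=
  {x | ∃ k : ℕ, ∃ᶠ n : ℕ in atTop, (a + ((k : ℝ) + 1)⁻¹) * n ≤ birkhoffSum T f n x}

/-- Passing from `x` to `T x` changes Birkhoff sums by a bounded amount, which costs one unit of the
index `k`. -/
lemma preimage_exceedSet (a : ℝ) : T ⁻¹' exceedSet T f a = exceedSet T f a := by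
  have key : ∀ (k : ℕ) (c : ℝ), ∀ᶠ n : ℕ in atTop,
      c ≤ ((k : ℝ) + 1)⁻¹ * n - ((k + 1 : ℕ) + 1 : ℝ)⁻¹ * n := by
    intro k c
    have hpos : 0 < ((k : ℝ) + 1)⁻¹ - ((k + 1 : ℕ) + 1 : ℝ)⁻¹ := by
      rw [sub_pos]
      push_cast
      gcongr
      linarith
    have := (tendsto_natCast_atTop_atTop (R := ℝ)).const_mul_atTop hpos
    filter_upwards [this.eventually_ge_atTop c] with n hn
    linarith
  ext x
  constructor
  · rintro ⟨k, hk⟩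
    refine ⟨k + 1, ?_⟩
    have h1 : ∃ᶠ n : ℕ in atTop,
        (a + ((k + 1 : ℕ) + 1 : ℝ)⁻¹) * (n + 1 : ℕ) ≤ birkhoffSum T f (n + 1) x := by
      refine (hk.and_eventually (key k (a + ((k + 1 : ℕ) + 1 : ℝ)⁻¹ - f x))).mono ?_
      rintro n ⟨h1, h2⟩
      rw [birkhoffSum_succ']
      push_cast at h2 ⊢
      nlinarith
    rw [frequently_atTop] at h1 ⊢
    intro N
    obtain ⟨n, hn, h2⟩ := h1 N
    exact ⟨n + 1, by omega, h2⟩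
  · rintro ⟨k, hk⟩
    refine ⟨k + 1, ?_⟩
    have h1 : ∃ᶠ n : ℕ in atTop,
        (a + ((k + 1 : ℕ) + 1 : ℝ)⁻¹) * (n - 1 : ℕ) ≤ birkhoffSum T f (n - 1) (T x) := by
      refine ((hk.and_eventually (key k (f x - (a + ((k + 1 : ℕ) + 1 : ℝ)⁻¹)))).and_eventually
        (eventually_ge_atTop 1)).mono ?_
      rintro n ⟨⟨h1, h2⟩, hn⟩
      obtain ⟨m, rfl⟩ : ∃ m, n = m + 1 := ⟨n - 1, by omega⟩
      rw [birkhoffSum_succ'] at h1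
      rw [Nat.add_sub_cancel]
      push_cast at h1 h2 ⊢
      nlinarith
    rw [frequently_atTop] at h1 ⊢
    intro N
    obtain ⟨n, hn, h2⟩ := h1 (N + 1)
    exact ⟨n - 1, by omega, h2⟩

variable [MeasurableSpace α] {μ : Measure α}

lemma integrable_birkhoffMax (hT : MeasurePreserving T μ μ) (hg : Integrable g μ) (N : ℕ) :
    Integrable (birkhoffMax T g N) μ := by
  induction N with
  | zero => exact integrable_zero _ _ _
  | succ N ih => exact (integrable_zero _ _ _).sup (hg.add (hT.integrable_comp_of_integrable ih))

lemma measurable_birkhoffMax (hT : Measurable T) (hg : Measurable g) (N : ℕ) :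
    Measurable (birkhoffMax T g N) := by
  induction N with
  | zero => exact measurable_const
  | succ N ih => exact measurable_const.max (hg.add (ih.comp hT))

/-- The maximal ergodic theorem. -/
theorem integral_nonneg_of_exists_birkhoffSum_pos (hT : MeasurePreserving T μ μ)
    (hgm : Measurable g) (hg : Integrable g μ) (h : ∀ᵐ x ∂μ, ∃ n, 0 < birkhoffSum T g n x) :
    0 ≤ ∫ x, g x ∂μ := by
  set M := birkhoffMax T g with hM
  have hset : ∀ N, MeasurableSet {x | 0 < M N x} := fun N =>
    measurableSet_lt measurable_const (measurable_birkhoffMax hT.measurable hgm N)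
  have hlim : Tendsto (fun N => ∫ x, {x | 0 < M N x}.indicator g x ∂μ) atTop (𝓝 (∫ x, g x ∂μ)) := by
    refine tendsto_integral_of_dominated_convergence (fun x => ‖g x‖)
      (fun N => (hgm.indicator (hset N)).aestronglyMeasurable) hg.norm
      (fun N => Eventually.of_forall fun x => norm_indicator_le_norm_self _ _) ?_
    filter_upwards [h] with x ⟨n, hn⟩
    refine tendsto_const_nhds.congr' ?_
    filter_upwards [eventually_ge_atTop n] with N hN
    have : 0 < M N x := (hn.trans_le (birkhoffSum_le_birkhoffMax n x)).trans_le
      (monotone_nat_of_le_succ (fun N => birkhoffMax_le_succ (T := T) (g := g) N x) hN)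
    exact (Set.indicator_of_mem (s := {x | 0 < M N x}) this g).symm
  refine ge_of_tendsto' hlim fun N => ?_
  have hi := integrable_birkhoffMax hT hg N
  have hiT := hT.integrable_comp_of_integrable hi
  have hcomp : ∫ x, M N (T x) ∂μ = ∫ x, M N x ∂μ := by
    conv_rhs => rw [← hT.map_eq]
    rw [integral_map hT.measurable.aemeasurable]
    exact (measurable_birkhoffMax hT.measurable hgm N).aestronglyMeasurable
  have h0 : 0 = ∫ x, (M N x - M N (T x)) ∂μ := by
    have := integral_sub hi hiT
    simp only [Function.comp_apply] at this
    rw [this, hcomp, sub_self]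
  refine h0.le.trans ?_
  refine integral_mono (hi.sub hiT) (hg.indicator (hset N)) fun x => ?_
  by_cases hx : 0 < M N x
  · rw [Set.indicator_of_mem (s := {x | 0 < M N x}) hx g]
    cases N with
    | zero => exact absurd hx (lt_irrefl _)
    | succ N =>
      have h1 : M (N + 1) x = g x + M N (T x) := by
        rcases le_total 0 (g x + M N (T x)) with h2 | h2
        · exact max_eq_right h2
        · exact absurd (show M (N + 1) x = 0 from max_eq_left h2) hx.ne'
      have h2 := birkhoffMax_le_succ (T := T) (g := g) N (T x)
      change M (N + 1) x - M (N + 1) (T x) ≤ g x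
      rw [h1]
      linarith
  · rw [Set.indicator_of_notMem (s := {x | 0 < M N x}) hx g]
    have h2 := birkhoffMax_nonneg (T := T) (g := g) N (T x)
    change M N x - M N (T x) ≤ 0
    linarith

lemma measurable_birkhoffSum (hT : Measurable T) (hf : Measurable f) (n : ℕ) :
    Measurable (birkhoffSum T f n) :=
  Finset.measurable_sum (f := fun k x => f (T^[k] x)) (Finset.range n) fun k _ =>
    hf.comp (hT.iterate k)

lemma measurableSet_exceedSet (hT : Measurable T) (hf : Measurable f) (a : ℝ) :
    MeasurableSet (exceedSet T f a) := by
  have : exceedSet T f a = ⋃ k : ℕ, ⋂ N : ℕ, ⋃ n : ℕ, ⋃ _ : N ≤ n,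
      {x | (a + ((k : ℝ) + 1)⁻¹) * n ≤ birkhoffSum T f n x} := by
    ext x
    simp [exceedSet, frequently_atTop]
  rw [this]
  exact MeasurableSet.iUnion fun k => MeasurableSet.iInter fun N => MeasurableSet.iUnion fun n =>
    MeasurableSet.iUnion fun _ => measurableSet_le measurable_const (measurable_birkhoffSum hT hf n)

variable [IsProbabilityMeasure μ]

/-- The maximal ergodic theorem for `f - a` on the invariant set `exceedSet T f a`. -/
lemma mul_measure_exceedSet_le (hT : MeasurePreserving T μ μ) (hfm : Measurable f)
    (hf : Integrable f μ) (a : ℝ) :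
    a * μ.real (exceedSet T f a) ≤ ∫ x in exceedSet T f a, f x ∂μ := by
  have hE := measurableSet_exceedSet hT.measurable hfm a
  set E := exceedSet T f a with hEdef
  have hTE : MeasurePreserving T (μ.restrict E) (μ.restrict E) := by
    have := hT.restrict_preimage hE
    rwa [hEdef, preimage_exceedSet] at this
  have h := integral_nonneg_of_exists_birkhoffSum_pos hTE (g := fun x => f x - a)
    (hfm.sub_const a) (hf.restrict.sub (integrable_const a)) ?_
  · rw [integral_sub hf.restrict (integrable_const a), setIntegral_const, smul_eq_mul] at h
    linarith
  · rw [ae_restrict_iff' hE]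
    refine Eventually.of_forall ?_
    rintro x ⟨k, hk⟩
    obtain ⟨n, h1, h2⟩ := (hk.and_eventually (eventually_ge_atTop 1)).exists
    refine ⟨n, ?_⟩
    have h3 : birkhoffSum T (fun x => f x - a) n x = birkhoffSum T f n x - n * a := by
      simp [birkhoffSum, Finset.sum_sub_distrib]
    have h4 : (1 : ℝ) ≤ n := by exact_mod_cast h2
    have h5 : 0 < ((k : ℝ) + 1)⁻¹ := by positivity
    rw [h3]
    nlinarith

/-- If the Birkhoff averages converge in probability to a constant, then the integral over an
invariant set is that constant times the measure of the set. -/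
lemma setIntegral_eq_of_tendstoInMeasure (hT : MeasurePreserving T μ μ) (hfm : Measurable f)
    (hf : Integrable f μ) {c : ℝ}
    (h : TendstoInMeasure μ (fun n x => birkhoffSum T f n x / n) atTop fun _ => c) {E : Set α}
    (hE : MeasurableSet E) (hinv : T ⁻¹' E = E) : ∫ x in E, f x ∂μ = c * μ.real E := by
  -- The averages are uniformly integrable, so they converge in `L¹`; their integral over an
  -- invariant set does not depend on `n`.
  have hid : ∀ i : ℕ, IdentDistrib (fun x => f (T^[i] x)) (fun x => f (T^[0] x)) μ μ := by
    intro i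
    refine ⟨(hfm.comp (hT.measurable.iterate i)).aemeasurable,
      (hfm.comp (hT.measurable.iterate 0)).aemeasurable, ?_⟩
    change μ.map (f ∘ T^[i]) = μ.map (f ∘ T^[0])
    rw [← Measure.map_map hfm (hT.measurable.iterate i),
      ← Measure.map_map hfm (hT.measurable.iterate 0), (hT.iterate i).map_eq,
      (hT.iterate 0).map_eq]
  have hui := uniformIntegrable_average_real le_rfl
    (MemLp.uniformIntegrable_of_identDistrib (j := 0) le_rfl ENNReal.one_ne_top
      (memLp_one_iff_integrable.mpr (show Integrable (fun x => f (T^[0] x)) μ from hf)) hid)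
  have hfun : (fun n : ℕ => (∑ i ∈ Finset.range n, fun x => f (T^[i] x)) / (n : α → ℝ))
      = fun n x => birkhoffSum T f n x / n := by
    funext n x
    simp [birkhoffSum]
  rw [hfun] at hui
  have hint : ∀ i : ℕ, Integrable (fun x => f (T^[i] x)) μ := fun i =>
    (hT.iterate i).integrable_comp_of_integrable hf
  have hS : ∀ n, Integrable (fun x => birkhoffSum T f n x / n) μ := fun n =>
    (integrable_finsetSum _ fun i _ => hint i).div_const _
  have hL1 := tendsto_Lp_finite_of_tendstoInMeasure le_rfl ENNReal.one_ne_top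
    (fun n => (hS n).aestronglyMeasurable) (memLp_const c) hui.2.1 h
  have hlim := tendsto_setIntegral_of_L1' (fun _ => c) aestronglyMeasurable_const
    (Eventually.of_forall hS) hL1 E
  rw [setIntegral_const, smul_eq_mul, mul_comm] at hlim
  refine tendsto_nhds_unique (tendsto_const_nhds.congr' ?_) hlim
  have hTE : MeasurePreserving T (μ.restrict E) (μ.restrict E) := by
    have := hT.restrict_preimage hE
    rwa [hinv] at this
  filter_upwards [eventually_ge_atTop 1] with n hn
  have hn : (n : ℝ) ≠ 0 := by positivity
  have heq : ∀ i : ℕ, ∫ x in E, f (T^[i] x) ∂μ = ∫ x in E, f x ∂μ := by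
    intro i
    conv_rhs => rw [← (hTE.iterate i).map_eq]
    rw [integral_map (hT.measurable.iterate i).aemeasurable hfm.aestronglyMeasurable]
  rw [integral_div]
  simp only [birkhoffSum]
  rw [integral_finsetSum _ fun i _ => (hint i).restrict, Finset.sum_congr rfl fun i _ => heq i,
    Finset.sum_const, Finset.card_range, nsmul_eq_mul, mul_div_cancel_left₀ _ hn]

lemma ae_eventually_birkhoffSum_lt (hT : MeasurePreserving T μ μ) (hfm : Measurable f)
    (hf : Integrable f μ) {c : ℝ}
    (h : TendstoInMeasure μ (fun n x => birkhoffSum T f n x / n) atTop fun _ => c) :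
    ∀ᵐ x ∂μ, ∀ ε : ℝ, 0 < ε → ∀ᶠ n : ℕ in atTop, birkhoffSum T f n x < (c + ε) * n := by
  have hnull : ∀ j : ℕ, μ (exceedSet T f (c + ((j : ℝ) + 1)⁻¹)) = 0 := by
    intro j
    have h1 := mul_measure_exceedSet_le hT hfm hf (c + ((j : ℝ) + 1)⁻¹)
    rw [setIntegral_eq_of_tendstoInMeasure hT hfm hf h
      (measurableSet_exceedSet hT.measurable hfm _) (preimage_exceedSet _)] at h1
    have h2 : 0 < ((j : ℝ) + 1)⁻¹ := by positivity
    have h3 : μ.real (exceedSet T f (c + ((j : ℝ) + 1)⁻¹)) ≤ 0 := by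
      by_contra hne
      nlinarith
    exact (measureReal_eq_zero_iff).mp (le_antisymm h3 measureReal_nonneg)
  filter_upwards [ae_all_iff.mpr fun j => measure_eq_zero_iff_ae_notMem.mp (hnull j)]
    with x hx ε hε
  obtain ⟨j, hj⟩ := exists_nat_one_div_lt (show 0 < ε / 2 by linarith)
  have h1 : ¬ ∃ᶠ n : ℕ in atTop,
      (c + ((j : ℝ) + 1)⁻¹ + ((j : ℝ) + 1)⁻¹) * n ≤ birkhoffSum T f n x := fun h2 => hx j ⟨j, h2⟩
  rw [not_frequently] at h1
  filter_upwards [h1] with n hn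
  rw [one_div] at hj
  have : (0 : ℝ) ≤ n := Nat.cast_nonneg n
  nlinarith [not_le.mp hn]

/-- Birkhoff averages of an integrable function that converge in probability to a constant
converge almost surely. -/
theorem ae_tendsto_birkhoffSum_div (hT : MeasurePreserving T μ μ) (hfm : Measurable f)
    (hf : Integrable f μ) {c : ℝ}
    (h : TendstoInMeasure μ (fun n x => birkhoffSum T f n x / n) atTop fun _ => c) :
    ∀ᵐ x ∂μ, Tendsto (fun n : ℕ => birkhoffSum T f n x / n) atTop (𝓝 c) := by
  have hneg : TendstoInMeasure μ (fun n x => birkhoffSum T (fun x => -f x) n x / n) atTop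
      fun _ => -c := by
    intro ε hε
    refine (h ε hε).congr fun n => ?_
    congr 1
    ext x
    have : birkhoffSum T (fun x => -f x) n x = -birkhoffSum T f n x := birkhoffSum_neg _ _ _ _
    change ε ≤ edist (birkhoffSum T f n x / n) c
      ↔ ε ≤ edist (birkhoffSum T (fun x => -f x) n x / n) (-c)
    rw [this, neg_div, edist_neg_neg]
  filter_upwards [ae_eventually_birkhoffSum_lt hT hfm hf h,
    ae_eventually_birkhoffSum_lt hT hfm.neg hf.neg hneg] with x h1 h2
  rw [Metric.tendsto_nhds]
  intro ε hε
  filter_upwards [h1 ε hε, h2 ε hε, eventually_ge_atTop 1] with n h3 h4 hn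
  have hn : (0 : ℝ) < n := by exact_mod_cast hn
  have h5 : birkhoffSum T (fun x => -f x) n x = -birkhoffSum T f n x := birkhoffSum_neg _ _ _ _
  have h4 : birkhoffSum T (fun x => -f x) n x < (-c + ε) * n := h4
  rw [h5] at h4
  rw [Real.dist_eq, abs_lt, lt_sub_iff_add_lt, sub_lt_iff_lt_add, div_lt_iff₀ hn, lt_div_iff₀ hn]
  constructor <;> linarith

end Birkhoff

/-! ### The speed of the walk -/

/-- If `T_n / n → α`, then `y_n / n → α⁻¹`: between `T_m` and `T_{m+1}` the walk stays close to
`m`, as its distance to the maximum is bounded by the increments of the hitting times. -/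
lemma GoodPath.tendsto_div {y : ℕ → ℤ} (h : GoodPath y) {α : ℝ} (hα : 0 < α)
    (hT : Tendsto (fun n : ℕ => (hitTime n y : ℝ) / n) atTop (𝓝 α)) :
    Tendsto (fun n : ℕ => (y n : ℝ) / n) atTop (𝓝 α⁻¹) := by
  have hTtop : Tendsto (fun n : ℕ => (hitTime n y : ℝ)) atTop atTop := by
    refine (hT.pos_mul_atTop hα (tendsto_natCast_atTop_atTop (R := ℝ))).congr' ?_
    filter_upwards [eventually_ge_atTop 1] with n hn
    rw [div_mul_cancel₀ _ (by positivity)]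
  have hex : ∀ n : ℕ, ∃ m, hitTime m y ≤ n ∧ n < hitTime (m + 1) y := by
    intro n
    have h1 : ∃ m, n < hitTime m y := by
      obtain ⟨m, hm⟩ := (hTtop.eventually_gt_atTop (n : ℝ)).exists
      exact ⟨m, by exact_mod_cast hm⟩
    classical
    have h2 := Nat.find_spec h1
    have h3 : Nat.find h1 ≠ 0 := by
      intro h0
      rw [h0, hitTime_zero] at h2
      exact Nat.not_lt_zero _ h2
    refine ⟨Nat.find h1 - 1, not_lt.mp (Nat.find_min h1 (by omega)), ?_⟩
    rwa [Nat.sub_add_cancel (by omega)]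
  choose m hm1 hm2 using hex
  have hmt : Tendsto m atTop atTop := by
    refine tendsto_atTop.mpr fun M => ?_
    filter_upwards [eventually_ge_atTop (hitTime M y)] with n hn
    by_contra hlt
    have := hitTime_mono y (show m n + 1 ≤ M by omega)
    have h1 : hitTime (m n + 1) y ≤ hitTime M y := this
    have := hm2 n
    omega
  have hone : Tendsto (fun k : ℕ => ((k + 1 : ℕ) : ℝ) / k) atTop (𝓝 1) := by
    have := (tendsto_inv_atTop_nhds_zero_nat (𝕜 := ℝ)).const_add 1
    rw [add_zero] at this
    refine this.congr' ?_
    filter_upwards [eventually_ge_atTop 1] with k hk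
    have hk : (0 : ℝ) < k := by exact_mod_cast hk
    push_cast
    field_simp
  have hsucc : Tendsto (fun k : ℕ => (hitTime (k + 1) y : ℝ) / k) atTop (𝓝 α) := by
    have h1 : Tendsto (fun k : ℕ => (hitTime (k + 1) y : ℝ) / (k + 1 : ℕ) * (((k + 1 : ℕ) : ℝ) / k))
        atTop (𝓝 (α * 1)) :=
      ((tendsto_add_atTop_iff_nat (f := fun n : ℕ => (hitTime n y : ℝ) / n) 1).mpr hT).mul hone
    rw [mul_one] at h1
    refine h1.congr' ?_
    filter_upwards [eventually_ge_atTop 1] with k hk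
    have hk : (0 : ℝ) < k := by exact_mod_cast hk
    push_cast
    field_simp
  have hnm : Tendsto (fun n : ℕ => (n : ℝ) / m n) atTop (𝓝 α) := by
    refine tendsto_of_tendsto_of_tendsto_of_le_of_le (hT.comp hmt) (hsucc.comp hmt)
      (fun n => ?_) (fun n => ?_)
    · have : (hitTime (m n) y : ℝ) ≤ n := by exact_mod_cast hm1 n
      change (hitTime (m n) y : ℝ) / (m n : ℕ) ≤ _
      gcongr
    · have : (n : ℝ) ≤ hitTime (m n + 1) y := by exact_mod_cast (hm2 n).le
      change _ ≤ (hitTime (m n + 1) y : ℝ) / (m n : ℕ)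
      gcongr
  have hym : Tendsto (fun n : ℕ => (y n : ℝ) / m n) atTop (𝓝 1) := by
    have hlow : Tendsto (fun k : ℕ => 1 - ((hitTime (k + 1) y : ℝ) / k - (hitTime k y : ℝ) / k))
        atTop (𝓝 1) := by
      simpa using (hsucc.sub hT).const_sub 1
    refine tendsto_of_tendsto_of_tendsto_of_le_of_le' (hlow.comp hmt) tendsto_const_nhds ?_ ?_
    · filter_upwards [hmt.eventually_ge_atTop 1] with n hn
      have hn : (0 : ℝ) < m n := by exact_mod_cast hn
      have h1 := h.sub_le (hm1 n) (hm2 n)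
      have h2 : (m n : ℝ) - y n ≤ hitTime (m n + 1) y - hitTime (m n) y := by exact_mod_cast h1
      change 1 - ((hitTime (m n + 1) y : ℝ) / (m n : ℕ) - (hitTime (m n) y : ℝ) / (m n : ℕ)) ≤ _
      rw [← sub_div, sub_le_iff_le_add, ← add_div, le_div_iff₀ hn]
      linarith
    · filter_upwards [hmt.eventually_ge_atTop 1] with n hn
      have hn : (0 : ℝ) < m n := by exact_mod_cast hn
      have h1 := h.lt_of_lt_hitTime (hm2 n)
      have h2 : y n ≤ m n := by push_cast at h1; omega
      have h3 : (y n : ℝ) ≤ m n := by exact_mod_cast h2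
      rw [div_le_one hn]
      exact h3
  have := hym.mul (hnm.inv₀ hα.ne')
  rw [one_mul] at this
  refine this.congr' ?_
  filter_upwards [hmt.eventually_ge_atTop 1] with n hn
  have hn : (0 : ℝ) < m n := by exact_mod_cast hn
  rw [inv_div, div_mul_div_cancel₀ hn.ne']

lemma measurable_natCast_comp {α : Type*} [MeasurableSpace α] {f : α → ℕ} (hf : Measurable f) :
    Measurable fun a => (f a : ℝ) :=
  (measurable_from_top (f := fun k : ℕ => (k : ℝ))).comp hf

/-- A law of large numbers in probability for the hitting times, when `T_1` is integrable, gives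
the almost sure speed of the walk. -/
theorem AnnealedWalk.ae_tendsto_div {P : Measure Env} {W : Measure (ℕ → ℤ)} [IsProbabilityMeasure W]
    (hW : AnnealedWalk P W) (hfin : ∫⁻ y, (hitOne y : ℝ≥0∞) ∂W < ⊤) {α : ℝ} (hα : 0 < α)
    (hT : InProbZero W fun n y => (hitTime n y : ℝ) / n - α) :
    ∀ᵐ y ∂W, Tendsto (fun n : ℕ => (y n : ℝ) / n) atTop (𝓝 α⁻¹) := by
  have hcast : ∀ (n : ℕ) (y : ℕ → ℤ),
      birkhoffSum afterOne (fun y => (hitOne y : ℝ)) n y = hitTime n y := by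
    intro n y
    simp [birkhoffSum, hitTime]
  have hm : Measurable fun y => (hitOne y : ℝ) := measurable_natCast_comp measurable_hitOne
  have hint : Integrable (fun y => (hitOne y : ℝ)) W := by
    refine ⟨hm.aestronglyMeasurable, ?_⟩
    simpa [HasFiniteIntegral] using hfin
  have hmeas : TendstoInMeasure W
      (fun n y => birkhoffSum afterOne (fun y => (hitOne y : ℝ)) n y / n) atTop fun _ => α := by
    rw [tendstoInMeasure_iff_measureReal_norm]
    intro ε hε
    refine squeeze_zero (fun n => measureReal_nonneg) (fun n => measureReal_mono ?_)
      (hT (ε / 2) (by linarith))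
    intro y hy
    have hy : ε ≤ ‖birkhoffSum afterOne (fun y => (hitOne y : ℝ)) n y / n - α‖ := hy
    rw [hcast, Real.norm_eq_abs] at hy
    change ε / 2 < |(hitTime n y : ℝ) / n - α|
    linarith
  filter_upwards [hW.good, ae_tendsto_birkhoffSum_div hW.preserving hm hint hmeas] with y h1 h2
  simp only [hcast] at h2
  exact h1.tendsto_div hα h2

/-! ### Regular variation of the norming sequence -/

lemma tendsto_log_div_log {k : ℕ → ℕ} {t : ℕ → ℝ} {r : ℝ} (hr : 0 < r) (ht : Tendsto t atTop atTop)
    (hk : Tendsto (fun n => (k n : ℝ) / t n) atTop (𝓝 r)) :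
    Tendsto (fun n => Real.log (k n) / Real.log (t n)) atTop (𝓝 1) := by
  have hlog : Tendsto (fun n => Real.log (t n)) atTop atTop := Real.tendsto_log_atTop.comp ht
  have h1 := ((hk.log hr.ne').mul hlog.inv_tendsto_atTop).const_add 1
  rw [mul_zero, add_zero] at h1
  refine h1.congr' ?_
  filter_upwards [ht.eventually_gt_atTop 0, hlog.eventually_gt_atTop 0,
    hk.eventually_const_lt hr] with n h2 h3 h4
  have h5 : (k n : ℝ) ≠ 0 := by
    intro h0
    rw [h0, zero_div] at h4
    exact lt_irrefl _ h4
  rw [Real.log_div h5 h2.ne']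
  simp only [Pi.inv_apply]
  field_simp
  ring

/-- The norming sequence is regularly varying with index `1 / κ`. -/
lemma tendsto_normB_div_normB {κ : ℝ} (h0 : 0 < κ) {k : ℕ → ℕ} {r : ℝ} (hr : 0 < r)
    (hk : Tendsto (fun n : ℕ => (k n : ℝ) / n) atTop (𝓝 r)) :
    Tendsto (fun n : ℕ => normB κ (k n) / normB κ n) atTop (𝓝 (r ^ (1 / κ))) := by
  by_cases h : κ = 2
  · subst h
    have h1 := (hk.mul (tendsto_log_div_log hr tendsto_natCast_atTop_atTop hk)).rpow_const
      (p := 1 / 2) (Or.inr (by norm_num))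
    rw [mul_one] at h1
    refine h1.congr fun n => ?_
    rw [normB_two, normB_two, ← Real.div_rpow, div_mul_div_comm]
    · exact mul_nonneg (Nat.cast_nonneg _) (Real.log_natCast_nonneg _)
    · exact mul_nonneg (Nat.cast_nonneg _) (Real.log_natCast_nonneg _)
  · refine (hk.rpow_const (p := 1 / κ) (Or.inr (by positivity))).congr fun n => ?_
    rw [normB_of_ne h, normB_of_ne h, Real.div_rpow (Nat.cast_nonneg _) (Nat.cast_nonneg _)]

lemma tendsto_normB_div {κ : ℝ} (h1 : 1 < κ) :
    Tendsto (fun n : ℕ => normB κ n / n) atTop (𝓝 0) := by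
  by_cases h : κ = 2
  · subst h
    have h2 : Tendsto (fun n : ℕ => Real.log n / n) atTop (𝓝 0) :=
      (Real.isLittleO_log_id_atTop.tendsto_div_nhds_zero).comp tendsto_natCast_atTop_atTop
    have h3 := h2.rpow_const (p := 1 / 2) (Or.inr (by norm_num))
    rw [Real.zero_rpow (by norm_num)] at h3
    refine h3.congr' ?_
    filter_upwards [eventually_ge_atTop 1] with n hn
    have hn : (0 : ℝ) < n := by exact_mod_cast hn
    have hl := Real.log_natCast_nonneg n
    rw [normB_two, Real.div_rpow hl hn.le, Real.mul_rpow hn.le hl, ← Real.sqrt_eq_rpow,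
      ← Real.sqrt_eq_rpow]
    rw [div_eq_div_iff (by positivity) hn.ne']
    linear_combination (-√(Real.log n)) * Real.mul_self_sqrt hn.le
  · have hneg : 0 < 1 - 1 / κ := by
      rw [sub_pos, div_lt_one (by linarith)]
      exact h1
    refine ((tendsto_rpow_neg_atTop hneg).comp tendsto_natCast_atTop_atTop).congr' ?_
    filter_upwards [eventually_ge_atTop 1] with n hn
    have hn : (0 : ℝ) < n := by exact_mod_cast hn
    rw [normB_of_ne h, Function.comp_apply, neg_sub, Real.rpow_sub_one hn.ne']

lemma tendsto_floor_div_div {μ : ℝ} (hμ : 0 < μ) {N : ℕ → ℕ} {t : ℕ → ℝ} {r : ℝ}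
    (ht : Tendsto t atTop atTop) (h : Tendsto (fun n => (N n : ℝ) / t n) atTop (𝓝 r)) :
    Tendsto (fun n => ((⌊(N n : ℝ) / μ⌋₊ : ℕ) : ℝ) / t n) atTop (𝓝 (r / μ)) := by
  have h1 : Tendsto (fun n => (N n : ℝ) / t n / μ - (t n)⁻¹) atTop (𝓝 (r / μ)) := by
    simpa using (h.div_const μ).sub ht.inv_tendsto_atTop
  refine tendsto_of_tendsto_of_tendsto_of_le_of_le' h1 (h.div_const μ) ?_ ?_
  · filter_upwards [ht.eventually_gt_atTop 0] with n hn
    have := Nat.lt_floor_add_one ((N n : ℝ) / μ)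
    rw [div_right_comm, ← one_div, ← sub_div]
    gcongr
    linarith
  · filter_upwards [ht.eventually_gt_atTop 0] with n hn
    rw [div_right_comm]
    gcongr
    exact Nat.floor_le (by positivity)

/-! ### The limit laws for `κ ≠ 1` -/

section LimitLaws

variable {P : Measure Env} {W : Measure (ℕ → ℤ)} [IsProbabilityMeasure W] {κ μ : ℝ} {A : ℕ → ℝ}
  {F : ℝ → ℝ}

lemma tendsto_div_of_abs_sub_le {N : ℕ → ℕ} {c t : ℕ → ℝ} {r L : ℝ} (ht : Tendsto t atTop atTop)
    (hc : Tendsto (fun n => c n / t n) atTop (𝓝 r)) (hL : ∀ᶠ n in atTop, |(N n : ℝ) - c n| ≤ L) :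
    Tendsto (fun n => (N n : ℝ) / t n) atTop (𝓝 r) := by
  have h1 : Tendsto (fun n => ((N n : ℝ) - c n) / t n) atTop (𝓝 0) := by
    refine squeeze_zero_norm' ?_ (show Tendsto (fun n => L * (t n)⁻¹) atTop (𝓝 0) by
      simpa using ht.inv_tendsto_atTop.const_mul L)
    filter_upwards [hL, ht.eventually_gt_atTop 0] with n h2 h3
    rw [Real.norm_eq_abs, abs_div, abs_of_pos h3, div_eq_mul_inv]
    gcongr
  have h2 := h1.add hc
  rw [zero_add] at h2
  refine h2.congr fun n => ?_
  rw [← add_div, sub_add_cancel]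

/-- For `κ < 1` there is no centering, and the deterministic part `N_n ∼ z n ^ κ` of the hitting
time is negligible compared with `n`. -/
lemma AnnealedWalk.tendsto_le_of_lt_one (hW : AnnealedWalk P W) (h0 : 0 < κ) (h1 : κ < 1)
    (hμ : 0 < μ) (hF : Continuous F)
    (hT : CdfTendsto W (fun n y => ((hitTime n y : ℝ) - (n + 2 * A ⌊(n : ℝ) / μ⌋₊))
      / (2 * normB κ ⌊(n : ℝ) / μ⌋₊)) F) (hA : ∀ m, A m = 0) {z : ℝ} (hz : 0 < z) :
    Tendsto (fun n : ℕ => W.real {y | (y n : ℝ) ≤ z * (n : ℝ) ^ κ}) atTop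
      (𝓝 (1 - F (μ ^ (1 / κ) / 2 * z ^ (-1 / κ)))) := by
  have ht : Tendsto (fun n : ℕ => (n : ℝ) ^ κ) atTop atTop :=
    (tendsto_rpow_atTop h0).comp tendsto_natCast_atTop_atTop
  have hBt : Tendsto (fun n : ℕ => normB κ ⌊(n : ℝ) / μ⌋₊) atTop atTop :=
    (tendsto_normB h0).comp (tendsto_floor_div hμ)
  refine hW.tendsto_le hF hT ?_ (ht.const_mul_atTop hz) ?_
  · filter_upwards [hBt.eventually_gt_atTop 0] with n hn
    linarith
  · rintro N ⟨L, hL⟩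
    have hcN : Tendsto (fun n : ℕ => z * (n : ℝ) ^ κ / (n : ℝ) ^ κ) atTop (𝓝 z) := by
      refine tendsto_const_nhds.congr' ?_
      filter_upwards [ht.eventually_gt_atTop 0] with n hn
      rw [mul_div_cancel_right₀ _ hn.ne']
    have hN := tendsto_div_of_abs_sub_le ht hcN hL
    have hm := tendsto_floor_div_div hμ ht hN
    have hzμ : 0 < z / μ := div_pos hz hμ
    have hB : Tendsto (fun n : ℕ => normB κ ⌊(N n : ℝ) / μ⌋₊ / n) atTop
        (𝓝 ((z / μ) ^ (1 / κ))) := by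
      refine (hm.rpow_const (p := 1 / κ) (Or.inr (by positivity))).congr fun n => ?_
      rw [normB_of_ne (by linarith), Real.div_rpow (Nat.cast_nonneg _) (by positivity),
        ← Real.rpow_mul (Nat.cast_nonneg n), mul_one_div_cancel h0.ne', Real.rpow_one]
    have hNn : Tendsto (fun n : ℕ => (N n : ℝ) / n) atTop (𝓝 0) := by
      have h2 : Tendsto (fun n : ℕ => (n : ℝ) ^ κ / n) atTop (𝓝 0) := by
        refine ((tendsto_rpow_neg_atTop (show 0 < 1 - κ by linarith)).comp
          tendsto_natCast_atTop_atTop).congr' ?_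
        filter_upwards [eventually_ge_atTop 1] with n hn
        have hn : (0 : ℝ) < n := by exact_mod_cast hn
        rw [Function.comp_apply, neg_sub, Real.rpow_sub_one hn.ne']
      have h3 := hN.mul h2
      rw [mul_zero] at h3
      refine h3.congr' ?_
      filter_upwards [ht.eventually_gt_atTop 0] with n hn
      rw [div_mul_div_cancel₀ hn.ne']
    have hlim := (hNn.const_sub 1).div (hB.const_mul 2) (by positivity)
    have hval : (1 - 0) / (2 * (z / μ) ^ (1 / κ)) = μ ^ (1 / κ) / 2 * z ^ (-1 / κ) := by
      rw [Real.div_rpow hz.le hμ.le, neg_div, Real.rpow_neg hz.le]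
      generalize z ^ (1 / κ) = p
      generalize μ ^ (1 / κ) = q
      rw [sub_zero, one_div, mul_inv, inv_div]
      ring
    rw [hval] at hlim
    refine hlim.congr' ?_
    filter_upwards [eventually_ge_atTop 1] with n hn
    have hn : (0 : ℝ) < n := by exact_mod_cast hn
    rw [hA, mul_zero, add_zero, Pi.div_apply, one_sub_div hn.ne', ← mul_div_assoc,
      div_div_div_cancel_right₀ hn.ne']

variable {c₂ : ℝ}

lemma tendsto_floor_div_natCast (hμ : 0 < μ) :
    Tendsto (fun n : ℕ => ((⌊(n : ℝ) / μ⌋₊ : ℕ) : ℝ) / n) atTop (𝓝 (1 / μ)) := by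
  refine tendsto_floor_div_div hμ (N := fun n => n) tendsto_natCast_atTop_atTop ?_
  refine tendsto_const_nhds.congr' ?_
  filter_upwards [eventually_ge_atTop 1] with n hn
  rw [div_self (by positivity)]

/-- A weak law of large numbers for the hitting times. -/
lemma AnnealedWalk.inProbZero_hitTime_div (h1 : 1 < κ) (hμ : 0 < μ)
    (hF0 : Tendsto F atBot (𝓝 0)) (hF1 : Tendsto F atTop (𝓝 1))
    (hT : CdfTendsto W (fun n y => ((hitTime n y : ℝ) - (n + 2 * A ⌊(n : ℝ) / μ⌋₊))
      / (2 * normB κ ⌊(n : ℝ) / μ⌋₊)) F) (hA : ∀ m : ℕ, A m = c₂ * m) :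
    InProbZero W fun n y => (hitTime n y : ℝ) / n - (1 + 2 * c₂ / μ) := by
  have hm := tendsto_floor_div_natCast hμ
  have hBt : Tendsto (fun n : ℕ => normB κ ⌊(n : ℝ) / μ⌋₊) atTop atTop :=
    (tendsto_normB (by linarith)).comp (tendsto_floor_div hμ)
  have hr : Tendsto (fun n : ℕ => 2 * normB κ ⌊(n : ℝ) / μ⌋₊ / n) atTop (𝓝 0) := by
    have h2 := ((tendsto_normB_div h1).comp (tendsto_floor_div hμ)).mul (hm.const_mul 2)
    rw [zero_mul] at h2
    refine h2.congr' ?_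
    filter_upwards [(tendsto_floor_div hμ).eventually_ge_atTop 1] with n hn
    have hn : (0 : ℝ) < ⌊(n : ℝ) / μ⌋₊ := by exact_mod_cast hn
    change normB κ ⌊(n : ℝ) / μ⌋₊ / (⌊(n : ℝ) / μ⌋₊ : ℕ) * _ = _
    field_simp
  have hb := hT.mul_tendsto_zero (fun n =>
    ((measurable_natCast_comp (measurable_hitTime n)).sub_const _).div_const _) hF0 hF1 hr
  have hc : Tendsto (fun n : ℕ => 2 * c₂ * (((⌊(n : ℝ) / μ⌋₊ : ℕ) : ℝ) / n - 1 / μ)) atTop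
      (𝓝 0) := by
    simpa using (hm.sub_const (1 / μ)).const_mul (2 * c₂)
  refine (hb.add (InProbZero.const hc)).of_abs_le ?_
  filter_upwards [eventually_ge_atTop 1, hBt.eventually_gt_atTop 0] with n hn h3
  refine Eventually.of_forall fun y => le_of_eq ?_
  have hn : (0 : ℝ) < n := by exact_mod_cast hn
  congr 1
  rw [hA]
  field_simp
  ring

/-- For `κ > 1` the centering is linear, and the norming is regularly varying and of order
`o(n)`. -/
lemma AnnealedWalk.tendsto_le_of_one_lt (hW : AnnealedWalk P W) (h1 : 1 < κ) (hμ : 0 < μ)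
    (hF : Continuous F)
    (hT : CdfTendsto W (fun n y => ((hitTime n y : ℝ) - (n + 2 * A ⌊(n : ℝ) / μ⌋₊))
      / (2 * normB κ ⌊(n : ℝ) / μ⌋₊)) F) (hc₂ : 0 < c₂) (hA : ∀ m : ℕ, A m = c₂ * m)
    {α : ℝ} (hα : α = 1 + 2 * c₂ / μ) (z : ℝ) :
    Tendsto (fun n : ℕ => W.real {y | (y n : ℝ) ≤ n * α⁻¹ + z * normB κ n}) atTop
      (𝓝 (1 - F (-(α / (2 * (α⁻¹ / μ) ^ (1 / κ)) * z)))) := by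
  have hα0 : 0 < α := by rw [hα]; positivity
  have hb := tendsto_normB_div h1
  have hB1 := tendsto_normB (show 0 < κ by linarith)
  have hcn : Tendsto (fun n : ℕ => (n * α⁻¹ + z * normB κ n) / n) atTop (𝓝 α⁻¹) := by
    have h2 := (hb.const_mul z).const_add α⁻¹
    rw [mul_zero, add_zero] at h2
    refine h2.congr' ?_
    filter_upwards [eventually_ge_atTop 1] with n hn
    have hn : (0 : ℝ) < n := by exact_mod_cast hn
    field_simp
  have hBt : Tendsto (fun n : ℕ => normB κ ⌊(n : ℝ) / μ⌋₊) atTop atTop :=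
    hB1.comp (tendsto_floor_div hμ)
  refine hW.tendsto_le hF hT ?_ ?_ ?_
  · filter_upwards [hBt.eventually_gt_atTop 0] with n hn
    linarith
  · refine (hcn.pos_mul_atTop (inv_pos.mpr hα0) (tendsto_natCast_atTop_atTop (R := ℝ))).congr' ?_
    filter_upwards [eventually_ge_atTop 1] with n hn
    rw [div_mul_cancel₀ _ (by positivity)]
  · rintro N ⟨L, hL⟩
    have hN := tendsto_div_of_abs_sub_le tendsto_natCast_atTop_atTop hcn hL
    have hm := tendsto_floor_div_div hμ tendsto_natCast_atTop_atTop hN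
    have hpos : 0 < α⁻¹ / μ := by positivity
    have hBr := tendsto_normB_div_normB (show 0 < κ by linarith) hpos hm
    have hnum : Tendsto (fun n : ℕ => ((n : ℝ) - (N n + 2 * A ⌊(N n : ℝ) / μ⌋₊)) / normB κ n)
        atTop (𝓝 (-(α * z))) := by
      have hsmall : Tendsto (fun n : ℕ => ((n : ℝ) - (N n + 2 * A ⌊(N n : ℝ) / μ⌋₊) + α * z * normB κ n)
          / normB κ n) atTop (𝓝 0) := by
        refine squeeze_zero_norm' ?_ (show Tendsto (fun n => (α * L + 2 * c₂) * (normB κ n)⁻¹)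
          atTop (𝓝 0) by simpa using hB1.inv_tendsto_atTop.const_mul (α * L + 2 * c₂))
        filter_upwards [hL, hB1.eventually_gt_atTop 0] with n h2 h3
        rw [Real.norm_eq_abs, abs_div, abs_of_pos h3, div_eq_mul_inv]
        refine mul_le_mul_of_nonneg_right ?_ (by positivity)
        set m := ⌊(N n : ℝ) / μ⌋₊ with hm_def
        have e1 : (m : ℝ) ≤ N n / μ := Nat.floor_le (by positivity)
        have e2 : (N n : ℝ) / μ < m + 1 := Nat.lt_floor_add_one _
        have e3 : (n : ℝ) - (N n + 2 * A m) + α * z * normB κ n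
            = -α * (N n - (n * α⁻¹ + z * normB κ n)) + 2 * c₂ * (N n / μ - m) := by
          rw [hA, hα]
          rw [hα] at hα0
          field_simp
          ring
        rw [e3]
        refine (abs_add_le _ _).trans (add_le_add ?_ ?_)
        · rw [abs_mul, abs_neg, abs_of_pos hα0]
          gcongr
        · rw [abs_mul, abs_of_pos (by positivity)]
          have : |(N n : ℝ) / μ - m| ≤ 1 := by
            rw [abs_le]
            constructor <;> linarith
          nlinarith
      have h4 := hsmall.sub_const (α * z)
      rw [zero_sub] at h4
      refine h4.congr' ?_
      filter_upwards [hB1.eventually_gt_atTop 0] with n h3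
      field_simp
      ring
    have hlim := hnum.div (hBr.const_mul 2) (by positivity)
    have hval : -(α * z) / (2 * (α⁻¹ / μ) ^ (1 / κ)) = -(α / (2 * (α⁻¹ / μ) ^ (1 / κ)) * z) := by
      ring
    rw [hval] at hlim
    refine hlim.congr' ?_
    filter_upwards [hB1.eventually_gt_atTop 0] with n hn
    rw [Pi.div_apply, ← mul_div_assoc, div_div_div_cancel_right₀ hn.ne']

end LimitLaws

/-! ### Affine images of stable laws -/

lemma charFun_map_div_sub (ν : Measure ℝ) [IsProbabilityMeasure ν] (c a t : ℝ) :
    charFun (ν.map fun x => x / c - a) t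
      = Complex.exp (((-(a * t) : ℝ) : ℂ) * Complex.I) * charFun ν (t / c) := by
  rw [charFun_apply_real, charFun_apply_real, integral_map (by fun_prop) (by fun_prop),
    ← integral_const_mul]
  refine integral_congr_ae (Eventually.of_forall fun x => ?_)
  simp only
  rw [← Complex.exp_add]
  congr 1
  push_cast
  ring

lemma cdf_map_div_sub (ν : Measure ℝ) [IsProbabilityMeasure ν] {c : ℝ} (hc : 0 < c) (a x : ℝ) :
    cdf (ν.map fun x => x / c - a) x = cdf ν (c * (x + a)) := by
  have : IsProbabilityMeasure (ν.map fun x => x / c - a) :=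
    Measure.isProbabilityMeasure_map (by fun_prop)
  rw [cdf_eq_real, cdf_eq_real, measureReal_def, measureReal_def,
    Measure.map_apply (by fun_prop) measurableSet_Iic]
  congr 2
  ext y
  change y / c - a ≤ x ↔ y ≤ c * (x + a)
  rw [sub_le_iff_le_add, div_le_iff₀ hc, mul_comm]

/-- The image of a probability measure on `ℝ` under `x ↦ x / c - a`. -/
noncomputable def affineImage (ν : ProbabilityMeasure ℝ) (c a : ℝ) : ProbabilityMeasure ℝ :=
  ⟨(ν : Measure ℝ).map fun x => x / c - a, Measure.isProbabilityMeasure_map (by fun_prop)⟩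

lemma cdf_affineImage (ν : ProbabilityMeasure ℝ) {c : ℝ} (hc : 0 < c) (a x : ℝ) :
    cdf (affineImage ν c a : Measure ℝ) x = cdf (ν : Measure ℝ) (c * (x + a)) :=
  cdf_map_div_sub _ hc a x

lemma IsStableLaw.affineImage_of_ne {κ b : ℝ} {ν : ProbabilityMeasure ℝ} (h : IsStableLaw κ b ν)
    (hκ : κ ≠ 1) {c : ℝ} (hc : 0 < c) : IsStableLaw κ (b * c ^ (-κ)) (affineImage ν c 0) := by
  intro t
  refine (charFun_map_div_sub _ c 0 t).trans ?_
  rw [h (t / c)]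
  have h1 : |t / c| = |t| / c := by rw [abs_div, abs_of_pos hc]
  have h2 : t / c / (|t| / c) = t / |t| := div_div_div_cancel_right₀ hc.ne' _ _
  have h3 : (|t| / c) ^ κ = |t| ^ κ * c ^ (-κ) := by
    rw [Real.div_rpow (abs_nonneg t) hc.le, Real.rpow_neg hc.le, div_eq_mul_inv]
  rw [h1, h2, h3, stableF, stableF, if_neg hκ, if_neg hκ, zero_mul, neg_zero, Complex.ofReal_zero,
    zero_mul, Complex.exp_zero, one_mul]
  congr 1
  push_cast
  ring

/-- For `κ = 1` rescaling has to be accompanied by a translation. -/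
lemma IsStableLaw.affineImage_one {b : ℝ} {ν : ProbabilityMeasure ℝ} (h : IsStableLaw 1 b ν)
    {c : ℝ} (hc : 0 < c) :
    IsStableLaw 1 (b / c) (affineImage ν c (b / c * (2 / Real.pi) * Real.log c)) := by
  intro t
  refine (charFun_map_div_sub _ c _ t).trans ?_
  rw [h (t / c)]
  by_cases ht : t = 0
  · subst ht
    simp
  have ht' : 0 < |t| := abs_pos.mpr ht
  have h1 : |t / c| = |t| / c := by rw [abs_div, abs_of_pos hc]
  have h2 : t / c / (|t| / c) = t / |t| := div_div_div_cancel_right₀ hc.ne' _ _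
  rw [h1, h2, stableF, stableF, if_pos rfl, if_pos rfl, abs_div, abs_of_pos hc,
    Real.log_div ht'.ne' hc.ne', Real.rpow_one, Real.rpow_one, ← Complex.exp_add]
  congr 1
  have h3 : ((|t| : ℝ) : ℂ) ≠ 0 := by exact_mod_cast ht'.ne'
  have h4 : (c : ℂ) ≠ 0 := by exact_mod_cast hc.ne'
  have h5 : (Real.pi : ℂ) ≠ 0 := by exact_mod_cast Real.pi_ne_zero
  push_cast
  field_simp
  ring

/-- The stable law with exponent `2` is symmetric. -/
lemma IsStableLaw.cdf_neg {b : ℝ} {ν : ProbabilityMeasure ℝ} (h : IsStableLaw 2 b ν) (hb : 0 < b)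
    (z : ℝ) : 1 - cdf (ν : Measure ℝ) (-z) = cdf (ν : Measure ℝ) z := by
  have hsymm : (ν : Measure ℝ).map (fun x => -x) = ν := by
    have : IsProbabilityMeasure ((ν : Measure ℝ).map fun x => -x) :=
      Measure.isProbabilityMeasure_map (by fun_prop)
    refine Measure.ext_of_charFun ?_
    funext t
    have h1 : charFun ((ν : Measure ℝ).map fun x => -x) t = charFun (ν : Measure ℝ) (-t) := by
      rw [charFun_apply_real, charFun_apply_real, integral_map (by fun_prop) (by fun_prop)]
      simp
    rw [h1, h t, h (-t), stableF, stableF, if_neg (by norm_num), if_neg (by norm_num), abs_neg,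
      div_mul_cancel₀ _ two_ne_zero, Real.tan_pi]
    simp
  have hatom := h.measure_singleton hb two_pos
  have h2 : (ν : Measure ℝ).real (Set.Iic z) = (ν : Measure ℝ).real (Set.Ici (-z)) := by
    conv_lhs => rw [← hsymm]
    rw [measureReal_def, measureReal_def, Measure.map_apply (by fun_prop) measurableSet_Iic]
    congr 2
    ext x
    simp
  have h3 : (ν : Measure ℝ).real (Set.Ici (-z)) = (ν : Measure ℝ).real (Set.Ioi (-z)) := by
    have : NullSingletonClass (ν : Measure ℝ) := ⟨hatom⟩
    exact measureReal_congr Ioi_ae_eq_Ici.symm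
  rw [cdf_eq_real, cdf_eq_real, h2, h3, ← Set.compl_Iic,
    probReal_compl_eq_one_sub measurableSet_Iic]

/-! ### The limit law for `κ = 1` -/

section Critical

variable {α : Type*} [MeasurableSpace α] {ρ : Measure α} [IsProbabilityMeasure ρ]
  {D Y : ℕ → α → ℝ} {F : ℝ → ℝ}

lemma InProbZero.mul_tendsto (h : InProbZero ρ D) {k : ℕ → ℝ} {u : ℝ}
    (hk : Tendsto k atTop (𝓝 u)) : InProbZero ρ fun n a => k n * D n a := by
  intro ε hε
  have hpos : 0 < |u| + 1 := by positivity
  refine squeeze_zero' (Eventually.of_forall fun n => measureReal_nonneg) ?_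
    (h (ε / (|u| + 1)) (by positivity))
  filter_upwards [hk.abs.eventually_lt_const (show |u| < |u| + 1 by linarith)] with n hn
  refine measureReal_mono fun a ha => ?_
  have ha : ε < |k n * D n a| := ha
  change ε / (|u| + 1) < |D n a|
  rw [div_lt_iff₀ hpos]
  rw [abs_mul] at ha
  nlinarith [abs_nonneg (D n a)]

lemma CdfTendsto.mul_tendsto_one (h : CdfTendsto ρ Y F) (hF : Continuous F)
    (hY : ∀ n, Measurable (Y n)) (h0 : Tendsto F atBot (𝓝 0)) (h1 : Tendsto F atTop (𝓝 1))
    {k : ℕ → ℝ} (hk : Tendsto k atTop (𝓝 1)) : CdfTendsto ρ (fun n a => k n * Y n a) F := by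
  refine h.perturb hF ((h.mul_tendsto_zero hY h0 h1 (r := fun n => k n - 1) ?_).of_abs_le
    (Eventually.of_forall fun n => Eventually.of_forall fun a => le_of_eq ?_))
  · simpa using hk.sub_const 1
  · congr 1
    ring

/-- If both `Y n` and its translates by `d n` converge in law to the same limit, then `d n` is
asymptotically nonpositive. -/
lemma CdfTendsto.eventually_translation_lt (h : CdfTendsto ρ Y F) {d : ℕ → ℝ}
    (hd : CdfTendsto ρ (fun n a => Y n a - d n) F) (h0 : Tendsto F atBot (𝓝 0))
    (h1 : Tendsto F atTop (𝓝 1)) {ε : ℝ} (hε : 0 < ε) : ∀ᶠ n in atTop, d n < ε := by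
  by_contra hne
  have hfr : ∃ᶠ n in atTop, ε ≤ d n := by
    rw [not_eventually] at hne
    exact hne.mono fun n hn => not_lt.mp hn
  have hle : ∀ x, F (x + ε) ≤ F x := by
    intro x
    refine le_of_tendsto_of_tendsto_of_frequently (h (x + ε)) (hd x) (hfr.mono fun n hn => ?_)
    refine measureReal_mono fun a ha => ?_
    have ha : Y n a ≤ x + ε := ha
    change Y n a - d n ≤ x
    linarith
  have hiter : ∀ (x : ℝ) (k : ℕ), F (x + k * ε) ≤ F x := by
    intro x k
    induction k with
    | zero => simp
    | succ k ih =>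
      refine le_trans (le_of_eq ?_) ((hle (x + k * ε)).trans ih)
      congr 1
      push_cast
      ring
  have hge : ∀ x, 1 ≤ F x := by
    intro x
    refine le_of_tendsto' (h1.comp (tendsto_atTop_add_const_left _ x
      ((tendsto_natCast_atTop_atTop (R := ℝ)).atTop_mul_const hε))) fun k => hiter x k
  have := ge_of_tendsto' h0 hge
  linarith

/-- Monotone functions that converge off one point to a continuous function converge there. -/
lemma tendsto_of_monotone_of_forall_ne {u : ℕ → ℝ → ℝ} {G : ℝ → ℝ} (hG : Continuous G)
    (hu : ∀ᶠ n in atTop, Monotone (u n)) {z₀ : ℝ}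
    (h : ∀ z, z ≠ z₀ → Tendsto (fun n => u n z) atTop (𝓝 (G z))) :
    Tendsto (fun n => u n z₀) atTop (𝓝 (G z₀)) := by
  rw [Metric.tendsto_nhds]
  intro ε hε
  obtain ⟨η, hη, hGη⟩ := Metric.continuous_iff.mp hG z₀ (ε / 2) (by linarith)
  have hη2 : 0 < η / 2 := by linarith
  have h4 := hGη (z₀ + η / 2) (by rw [Real.dist_eq, add_sub_cancel_left, abs_of_pos hη2]; linarith)
  have h5 := hGη (z₀ - η / 2) (by
    rw [Real.dist_eq, sub_sub_cancel_left, abs_neg, abs_of_pos hη2]; linarith)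
  rw [Real.dist_eq, abs_lt] at h4 h5
  filter_upwards [hu, (h (z₀ + η / 2) (by linarith)).eventually_lt_const
      (show G (z₀ + η / 2) < G (z₀ + η / 2) + ε / 2 by linarith),
    (h (z₀ - η / 2) (by linarith)).eventually_const_lt
      (show G (z₀ - η / 2) - ε / 2 < G (z₀ - η / 2) by linarith)] with n hm h1 h2
  have h6 := hm (show z₀ ≤ z₀ + η / 2 by linarith)
  have h7 := hm (show z₀ - η / 2 ≤ z₀ by linarith)
  rw [Real.dist_eq, abs_lt]
  constructor <;> linarith [h4.1, h4.2, h5.1, h5.2]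

end Critical

section CriticalWalk

variable {P : Measure Env} {W : Measure (ℕ → ℤ)} {g : ℕ → ℝ} {A₁ : ℝ} {F : ℝ → ℝ}

/-- Since `W` is invariant, increments of the hitting times obey the same weak laws as the hitting
times themselves. -/
lemma AnnealedWalk.inProbZero_iterate (hW : AnnealedWalk P W) {M : ℕ → ℕ} {r : ℕ → ℝ} {u : ℝ}
    (h : InProbZero W fun n y => (hitTime (M n) y : ℝ) / r n - u) (K : ℕ → ℕ) :
    InProbZero W fun n y => (hitTime (M n) (afterOne^[K n] y) : ℝ) / r n - u := by
  intro ε hε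
  refine (h ε hε).congr fun n => ?_
  have hm : MeasurableSet {y | ε < |(hitTime (M n) y : ℝ) / r n - u|} :=
    measurableSet_lt measurable_const
      (((measurable_natCast_comp (measurable_hitTime (M n))).div_const _).sub_const _).abs
  exact ((hW.preserving.iterate (K n)).measureReal_preimage hm.nullMeasurableSet).symm

variable [IsProbabilityMeasure W]

/-- The increments of the centering sequence are at most `o(n)`, as the increments of the hitting times
are tight. -/
lemma AnnealedWalk.eventually_centering_sub_le (hW : AnnealedWalk P W) (hF : Continuous F)
    (h0 : Tendsto F atBot (𝓝 0)) (h1 : Tendsto F atTop (𝓝 1))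
    (hT : CdfTendsto W (fun n y => ((hitTime n y : ℝ) - g n) / n) F) {ε : ℝ} (hε : 0 < ε) :
    ∀ᶠ n : ℕ in atTop, g (n + 1) - g n < ε * n := by
  have hmeas : ∀ n : ℕ, Measurable fun y => ((hitTime n y : ℝ) - g n) / n := fun n =>
    ((measurable_natCast_comp (measurable_hitTime n)).sub_const _).div_const _
  have hone : Tendsto (fun n : ℕ => ((n + 1 : ℕ) : ℝ) / n) atTop (𝓝 1) := by
    have := (tendsto_inv_atTop_nhds_zero_nat (𝕜 := ℝ)).const_add 1
    rw [add_zero] at this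
    refine this.congr' ?_
    filter_upwards [eventually_ge_atTop 1] with k hk
    have hk : (0 : ℝ) < k := by exact_mod_cast hk
    push_cast
    field_simp
  have hsucc := (hT.comp (tendsto_add_atTop_nat 1)).mul_tendsto_one hF
    (fun n => hmeas (n + 1)) h0 h1 hone
  have hsmall : InProbZero W fun n y => (hitTime 1 (afterOne^[n] y) : ℝ) / n - 0 := by
    refine hW.inProbZero_iterate (M := fun _ => 1) (r := fun n => (n : ℝ)) ?_ fun n => n
    refine InProbZero.of_ae_tendsto (fun n =>
      ((measurable_natCast_comp (measurable_hitTime 1)).div_const _).sub_const _)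
      (Eventually.of_forall fun y => ?_)
    simpa using tendsto_const_div_atTop_nhds_zero_nat (hitTime 1 y : ℝ)
  have hd : CdfTendsto W (fun n y => ((hitTime n y : ℝ) - g n) / n - (g (n + 1) - g n) / n) F := by
    refine hsucc.perturb hF (hsmall.of_abs_le ?_)
    filter_upwards [eventually_ge_atTop 1] with n hn
    refine Eventually.of_forall fun y => le_of_eq ?_
    have hn : (0 : ℝ) < n := by exact_mod_cast hn
    rw [← abs_neg]
    congr 1
    rw [hitTime_add]
    push_cast
    field_simp
    ring
  filter_upwards [hT.eventually_translation_lt hd h0 h1 hε, eventually_ge_atTop 1] with n h2 hn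
  have hn : (0 : ℝ) < n := by exact_mod_cast hn
  rwa [div_lt_iff₀ hn] at h2

/-- A weak law of large numbers for the hitting times, with an `n log n` norming. -/
lemma inProbZero_hitTime_div_log (h0 : Tendsto F atBot (𝓝 0))
    (h1 : Tendsto F atTop (𝓝 1))
    (hT : CdfTendsto W (fun n y => ((hitTime n y : ℝ) - g n) / n) F)
    (hg : Tendsto (fun n : ℕ => g n / (n * Real.log n)) atTop (𝓝 A₁)) :
    InProbZero W fun n y => (hitTime n y : ℝ) / (n * Real.log n) - A₁ := by
  have hlog : Tendsto (fun n : ℕ => Real.log n) atTop atTop :=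
    Real.tendsto_log_atTop.comp tendsto_natCast_atTop_atTop
  have h2 := hT.mul_tendsto_zero (fun n =>
    ((measurable_natCast_comp (measurable_hitTime n)).sub_const _).div_const _) h0 h1
    hlog.inv_tendsto_atTop
  have h3 : Tendsto (fun n : ℕ => g n / (n * Real.log n) - A₁) atTop (𝓝 0) := by
    simpa using hg.sub_const A₁
  refine (h2.add (InProbZero.const h3)).of_abs_le ?_
  filter_upwards [eventually_ge_atTop 1, hlog.eventually_gt_atTop 0] with n hn hl
  refine Eventually.of_forall fun y => le_of_eq ?_
  have hn : (0 : ℝ) < n := by exact_mod_cast hn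
  congr 1
  simp only [Pi.inv_apply]
  field_simp
  ring

end CriticalWalk

section CriticalInverse

variable {g : ℕ → ℝ} {A₁ : ℝ}

lemma tendsto_log_log_div_log {t : ℕ → ℝ} (ht : Tendsto t atTop atTop) :
    Tendsto (fun n => Real.log (Real.log (t n)) / Real.log (t n)) atTop (𝓝 0) :=
  Real.isLittleO_log_id_atTop.tendsto_div_nhds_zero.comp (Real.tendsto_log_atTop.comp ht)

/-- An asymptotic inverse `δ` of a sequence `g(n) ∼ A₁ n log n` with increments at most `o(n)`: `δ(n)` is
the least `N` with `g(N) ≥ n`. -/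
lemma exists_asymptotic_inverse (hA₁ : 0 < A₁)
    (hg : Tendsto (fun n : ℕ => g n / (n * Real.log n)) atTop (𝓝 A₁))
    (hinc : ∀ ε : ℝ, 0 < ε → ∀ᶠ n : ℕ in atTop, g (n + 1) - g n < ε * n) :
    ∃ δ : ℕ → ℕ, Tendsto δ atTop atTop ∧
      Tendsto (fun n : ℕ => (g (δ n) - n) / δ n) atTop (𝓝 0) ∧
      Tendsto (fun n : ℕ => δ n * Real.log n / n) atTop (𝓝 A₁⁻¹) := by
  classical
  have hlog : Tendsto (fun n : ℕ => Real.log n) atTop atTop :=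
    Real.tendsto_log_atTop.comp tendsto_natCast_atTop_atTop
  have hnlog : Tendsto (fun n : ℕ => (n : ℝ) * Real.log n) atTop atTop :=
    tendsto_natCast_atTop_atTop.atTop_mul_atTop₀ hlog
  have hgt : Tendsto g atTop atTop := by
    refine (hg.pos_mul_atTop hA₁ hnlog).congr' ?_
    filter_upwards [hnlog.eventually_gt_atTop 0] with n hn
    rw [div_mul_cancel₀ _ hn.ne']
  have hex : ∀ n : ℕ, ∃ N, (n : ℝ) ≤ g N := fun n => (hgt.eventually_ge_atTop (n : ℝ)).exists
  set δ : ℕ → ℕ := fun n => Nat.find (hex n) with hδ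
  have hδt : Tendsto δ atTop atTop := by
    refine tendsto_atTop.mpr fun K => ?_
    have : ∀ᶠ n : ℕ in atTop, ∀ N ∈ Finset.range K, g N < n :=
      (Filter.eventually_all_finset _).mpr fun N _ =>
        tendsto_natCast_atTop_atTop.eventually_gt_atTop (g N)
    filter_upwards [this] with n hn
    by_contra hlt
    exact absurd (Nat.find_spec (hex n)) (not_le.mpr (hn _ (Finset.mem_range.mpr (not_le.mp hlt))))
  have hsmall : Tendsto (fun n : ℕ => (g (δ n) - n) / δ n) atTop (𝓝 0) := by
    refine tendsto_zero_of_forall_eventually_le (fun n => ?_) fun ε hε => ?_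
    · exact div_nonneg (sub_nonneg.mpr (Nat.find_spec (hex n))) (Nat.cast_nonneg _)
    · have hpred : Tendsto (fun n => δ n - 1) atTop atTop :=
        (tendsto_sub_atTop_nat 1).comp hδt
      filter_upwards [hpred.eventually (hinc ε hε), hδt.eventually_ge_atTop 1] with n h1 h2
      rw [Nat.sub_add_cancel h2] at h1
      have h3 : g (δ n - 1) < n := not_le.mp (Nat.find_min (hex n) (Nat.sub_lt h2 one_pos))
      have h4 : ((δ n - 1 : ℕ) : ℝ) ≤ δ n := by exact_mod_cast Nat.sub_le _ _
      have h5 : (0 : ℝ) < δ n := by exact_mod_cast h2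
      rw [div_le_iff₀ h5]
      nlinarith
  refine ⟨δ, hδt, hsmall, ?_⟩
  have hδr : Tendsto (fun n => (δ n : ℝ)) atTop atTop := tendsto_natCast_atTop_atTop.comp hδt
  have hn : Tendsto (fun n : ℕ => (n : ℝ) / (δ n * Real.log (δ n))) atTop (𝓝 A₁) := by
    have h1 := (hg.comp hδt).sub (hsmall.mul (hlog.comp hδt).inv_tendsto_atTop)
    rw [zero_mul, sub_zero] at h1
    refine h1.congr' ?_
    filter_upwards [hδr.eventually_gt_atTop 0, (hlog.comp hδt).eventually_gt_atTop 0] with n h2 h3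
    have h3 : 0 < Real.log (δ n) := h3
    simp only [Function.comp_apply, Pi.inv_apply]
    field_simp
    ring
  have hll : Tendsto (fun n : ℕ => Real.log n / Real.log (δ n)) atTop (𝓝 1) := by
    have h1 := (((hn.log hA₁.ne').mul (hlog.comp hδt).inv_tendsto_atTop).add
      (tendsto_log_log_div_log hδr)).const_add 1
    rw [mul_zero, add_zero, add_zero] at h1
    refine h1.congr' ?_
    filter_upwards [hδr.eventually_gt_atTop 0, (hlog.comp hδt).eventually_gt_atTop 0,
      eventually_ge_atTop 1] with n h2 h3 h4
    have h3 : 0 < Real.log (δ n) := h3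
    have h4 : (0 : ℝ) < n := by exact_mod_cast h4
    simp only [Function.comp_apply, Pi.inv_apply]
    rw [Real.log_div h4.ne' (by positivity), Real.log_mul h2.ne' h3.ne']
    field_simp
    ring
  have h1 := hll.div hn hA₁.ne'
  rw [one_div] at h1
  refine h1.congr' ?_
  filter_upwards [hδr.eventually_gt_atTop 0, (hlog.comp hδt).eventually_gt_atTop 0,
      eventually_ge_atTop 1] with n h2 h3 h4
  have h3 : 0 < Real.log (δ n) := h3
  have h4 : (0 : ℝ) < n := by exact_mod_cast h4
  rw [Pi.div_apply]
  field_simp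

lemma tendsto_div_log_sq : Tendsto (fun n : ℕ => (n : ℝ) / Real.log n ^ 2) atTop atTop := by
  have h1 : Tendsto (fun x : ℝ => Real.log x ^ 2 / x) atTop (𝓝 0) :=
    (Real.isLittleO_pow_log_id_atTop (n := 2)).tendsto_div_nhds_zero
  have h2 := h1.comp (tendsto_natCast_atTop_atTop (R := ℝ))
  have h3 : Tendsto (fun n : ℕ => Real.log n ^ 2 / (n : ℝ)) atTop (𝓝[>] 0) := by
    refine tendsto_nhdsWithin_iff.mpr ⟨h2, ?_⟩
    filter_upwards [eventually_gt_atTop 1] with n hn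
    have hn' : (1 : ℝ) < n := by exact_mod_cast hn
    have := Real.log_pos hn'
    exact div_pos (pow_pos this 2) (one_pos.trans hn')
  refine h3.inv_tendsto_nhdsGT_zero.congr fun n => ?_
  rw [Pi.inv_apply, inv_div]

/-- If `M ∼ u n / (log n)²` and `δ ∼ n / (A₁ log n)` then `M log M / δ → u A₁`. -/
lemma tendsto_mul_log_div {M δ : ℕ → ℕ} {u : ℝ} (hu : 0 < u) (hA₁ : 0 < A₁)
    (hM : Tendsto (fun n : ℕ => (M n : ℝ) / (n / Real.log n ^ 2)) atTop (𝓝 u))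
    (hδ : Tendsto (fun n : ℕ => δ n * Real.log n / n) atTop (𝓝 A₁⁻¹)) :
    Tendsto (fun n => M n * Real.log (M n) / δ n) atTop (𝓝 (u * A₁)) := by
  have hlog : Tendsto (fun n : ℕ => Real.log n) atTop atTop :=
    Real.tendsto_log_atTop.comp tendsto_natCast_atTop_atTop
  have hh := tendsto_div_log_sq
  have h1 := tendsto_log_div_log hu hh hM
  have h2 : Tendsto (fun n : ℕ => Real.log ((n : ℝ) / Real.log n ^ 2) / Real.log n) atTop (𝓝 1) := by
    have h3 := ((tendsto_log_log_div_log tendsto_natCast_atTop_atTop).const_mul 2).const_sub 1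
    rw [mul_zero, sub_zero] at h3
    refine h3.congr' ?_
    filter_upwards [hlog.eventually_gt_atTop 0, eventually_ge_atTop 1] with n h4 h5
    have h5 : (0 : ℝ) < n := by exact_mod_cast h5
    rw [Real.log_div h5.ne' (by positivity), Real.log_pow]
    field_simp
    push_cast
    ring
  have h3 := ((hM.mul h1).mul h2).div hδ (by positivity)
  have hval : u * 1 * 1 / A₁⁻¹ = u * A₁ := by field_simp
  rw [hval] at h3
  refine h3.congr' ?_
  filter_upwards [hlog.eventually_gt_atTop 0, eventually_ge_atTop 1,
    (Real.tendsto_log_atTop.comp hh).eventually_gt_atTop 0] with n h4 h5 h6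
  have h5 : (0 : ℝ) < n := by exact_mod_cast h5
  have h6 : Real.log ((n : ℝ) / Real.log n ^ 2) ≠ 0 := h6.ne'
  rw [Pi.div_apply]
  generalize Real.log ((n : ℝ) / Real.log n ^ 2) = l at h6
  field_simp

end CriticalInverse

section CriticalLaw

variable {P : Measure Env} {W : Measure (ℕ → ℤ)} [IsProbabilityMeasure W] {g : ℕ → ℝ} {A₁ : ℝ}
  {F : ℝ → ℝ}

/-- Compare `T_N` with `T_δ`, where `N - δ ∼ z n / (log n)²`: by the weak law of large numbers the
difference is `z A₁² δ + o(δ)` in probability. -/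
lemma AnnealedWalk.tendsto_hitTime_le (hW : AnnealedWalk P W) (hF : Continuous F)
    (h0 : Tendsto F atBot (𝓝 0)) (h1 : Tendsto F atTop (𝓝 1))
    (hT : CdfTendsto W (fun n y => ((hitTime n y : ℝ) - g n) / n) F) (hA₁ : 0 < A₁)
    (hg : Tendsto (fun n : ℕ => g n / (n * Real.log n)) atTop (𝓝 A₁)) {δ : ℕ → ℕ}
    (hδt : Tendsto δ atTop atTop)
    (hδg : Tendsto (fun n : ℕ => (g (δ n) - n) / δ n) atTop (𝓝 0))
    (hδ : Tendsto (fun n : ℕ => δ n * Real.log n / n) atTop (𝓝 A₁⁻¹))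
    {z L : ℝ} (hz : z ≠ 0) {N : ℕ → ℕ}
    (hN : ∀ᶠ n : ℕ in atTop, |(N n : ℝ) - (δ n + z * (n / Real.log n ^ 2))| ≤ L) :
    Tendsto (fun n => W.real {y | hitTime (N n) y ≤ n}) atTop (𝓝 (F (-(A₁ ^ 2 * z)))) := by
  have hh := tendsto_div_log_sq
  have hdiff : Tendsto (fun n : ℕ => ((N n : ℝ) - δ n) / (n / Real.log n ^ 2)) atTop (𝓝 z) := by
    have h2 : Tendsto (fun n : ℕ => ((N n : ℝ) - (δ n + z * (n / Real.log n ^ 2)))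
        / (n / Real.log n ^ 2)) atTop (𝓝 0) := by
      refine squeeze_zero_norm' ?_ (show Tendsto (fun n : ℕ => L * ((n : ℝ) / Real.log n ^ 2)⁻¹)
        atTop (𝓝 0) by simpa using hh.inv_tendsto_atTop.const_mul L)
      filter_upwards [hN, hh.eventually_gt_atTop 0] with n h3 h4
      rw [Real.norm_eq_abs, abs_div, abs_of_pos h4, div_eq_mul_inv]
      gcongr
    have h3 := h2.add_const z
    rw [zero_add] at h3
    refine h3.congr' ?_
    filter_upwards [hh.eventually_gt_atTop 0] with n h4
    rw [← sub_eq_zero]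
    generalize (n : ℝ) / Real.log n ^ 2 = t at h4
    field_simp
    ring
  set M : ℕ → ℕ := fun n => max (N n) (δ n) - min (N n) (δ n) with hMdef
  have hMabs : ∀ n, (M n : ℝ) = |(N n : ℝ) - δ n| := by
    intro n
    rw [hMdef]
    rcases le_total (N n) (δ n) with h | h
    · simp only [max_eq_right h, min_eq_left h]
      rw [Nat.cast_sub h, abs_sub_comm, abs_of_nonneg (sub_nonneg.mpr (by exact_mod_cast h))]
    · simp only [max_eq_left h, min_eq_right h]
      rw [Nat.cast_sub h, abs_of_nonneg (sub_nonneg.mpr (by exact_mod_cast h))]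
  have hM : Tendsto (fun n : ℕ => (M n : ℝ) / (n / Real.log n ^ 2)) atTop (𝓝 |z|) := by
    refine hdiff.abs.congr' ?_
    filter_upwards [hh.eventually_gt_atTop 0] with n h4
    rw [hMabs, abs_div, abs_of_pos h4]
  have hMt : Tendsto M atTop atTop := by
    refine (tendsto_natCast_atTop_iff (R := ℝ)).mp
      ((hM.pos_mul_atTop (abs_pos.mpr hz) hh).congr' ?_)
    filter_upwards [hh.eventually_gt_atTop 0] with n h4
    rw [div_mul_cancel₀ _ h4.ne']
  have hu := tendsto_mul_log_div (abs_pos.mpr hz) hA₁ hM hδ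
  have hinc : InProbZero W fun n y => (hitTime (M n) y : ℝ) / δ n - A₁ ^ 2 * |z| := by
    have h2 := ((inProbZero_hitTime_div_log h0 h1 hT hg).comp hMt).mul_tendsto hu
    have h3 : Tendsto (fun n => A₁ * (M n * Real.log (M n) / δ n - |z| * A₁)) atTop (𝓝 0) := by
      simpa using (hu.sub_const (|z| * A₁)).const_mul A₁
    refine (h2.add (InProbZero.const h3)).of_abs_le ?_
    have hMr : Tendsto (fun n => (M n : ℝ)) atTop atTop := tendsto_natCast_atTop_atTop.comp hMt
    filter_upwards [hδt.eventually_ge_atTop 1, hMr.eventually_gt_atTop 0,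
      (Real.tendsto_log_atTop.comp hMr).eventually_gt_atTop 0] with n h4 h5 h6
    refine Eventually.of_forall fun y => le_of_eq ?_
    have h4 : (0 : ℝ) < δ n := by exact_mod_cast h4
    have h6 : Real.log (M n) ≠ 0 := h6.ne'
    congr 1
    generalize Real.log (M n) = l at h6
    field_simp
    ring
  have hinc' := hW.inProbZero_iterate hinc fun n => min (N n) (δ n)
  have hsign : ∀ᶠ n in atTop, (0 < z ∧ δ n ≤ N n) ∨ (z < 0 ∧ N n ≤ δ n) := by
    rcases lt_or_gt_of_ne hz with hz | hz
    · filter_upwards [hdiff.eventually_lt_const hz, hh.eventually_gt_atTop 0] with n h2 h3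
      refine Or.inr ⟨hz, ?_⟩
      have : (N n : ℝ) ≤ δ n := by
        by_contra hlt
        have := div_nonneg (sub_nonneg.mpr (not_le.mp hlt).le) h3.le
        linarith
      exact_mod_cast this
    · filter_upwards [hdiff.eventually_const_lt hz, hh.eventually_gt_atTop 0] with n h2 h3
      refine Or.inl ⟨hz, ?_⟩
      have : (δ n : ℝ) ≤ N n := by
        by_contra hlt
        have := div_nonpos_of_nonpos_of_nonneg (sub_nonpos.mpr (not_le.mp hlt).le) h3.le
        linarith
      exact_mod_cast this
  have hY : CdfTendsto W (fun n y => ((hitTime (N n) y : ℝ) - n) / δ n - A₁ ^ 2 * z) F := by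
    refine (hT.comp hδt).perturb hF ?_
    have h2 : InProbZero W fun n y =>
        ((hitTime (N n) y : ℝ) - hitTime (δ n) y) / δ n - A₁ ^ 2 * z := by
      refine hinc'.of_abs_le ?_
      filter_upwards [hsign] with n h3
      refine Eventually.of_forall fun y => le_of_eq ?_
      rcases h3 with ⟨h3, h4⟩ | ⟨h3, h4⟩
      · have e1 : N n = δ n + M n := by
          simp only [hMdef, max_eq_left h4, min_eq_right h4]
          omega
        have e2 : (hitTime (N n) y : ℝ) = hitTime (δ n) y + hitTime (M n) (afterOne^[δ n] y) := by
          rw [e1, hitTime_add]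
          push_cast
          rfl
        rw [e2, abs_of_pos h3, min_eq_right h4, add_sub_cancel_left]
      · have e1 : δ n = N n + M n := by
          simp only [hMdef, max_eq_right h4, min_eq_left h4]
          omega
        have e2 : (hitTime (δ n) y : ℝ) = hitTime (N n) y + hitTime (M n) (afterOne^[N n] y) := by
          rw [e1, hitTime_add]
          push_cast
          rfl
        rw [e2, abs_of_neg h3, min_eq_left h4, ← abs_neg]
        congr 1
        ring
    refine (h2.add (InProbZero.const hδg)).of_abs_le ?_
    refine Eventually.of_forall fun n => Eventually.of_forall fun y => le_of_eq ?_
    congr 1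
    ring
  refine (hY (-(A₁ ^ 2 * z))).congr' ?_
  filter_upwards [hδt.eventually_ge_atTop 1] with n h4
  have h4 : (0 : ℝ) < δ n := by exact_mod_cast h4
  congr 1
  ext y
  change ((hitTime (N n) y : ℝ) - n) / δ n - A₁ ^ 2 * z ≤ -(A₁ ^ 2 * z) ↔ hitTime (N n) y ≤ n
  rw [sub_le_iff_le_add, neg_add_cancel, div_le_iff₀ h4, zero_mul, sub_nonpos, Nat.cast_le]

/-- The limit law of the walk when the hitting times have an `n log n` centering and norming `n`. -/
theorem AnnealedWalk.exists_critical_limit (hW : AnnealedWalk P W) (hF : Continuous F)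
    (h0 : Tendsto F atBot (𝓝 0)) (h1 : Tendsto F atTop (𝓝 1))
    (hT : CdfTendsto W (fun n y => ((hitTime n y : ℝ) - g n) / n) F) (hA₁ : 0 < A₁)
    (hg : Tendsto (fun n : ℕ => g n / (n * Real.log n)) atTop (𝓝 A₁)) :
    ∃ δ : ℕ → ℕ, Tendsto (fun n : ℕ => δ n * Real.log n / n) atTop (𝓝 A₁⁻¹) ∧
      ∀ z : ℝ, Tendsto (fun n : ℕ => W.real {y | (y n : ℝ) ≤ δ n + z * (n / Real.log n ^ 2)}) atTop
        (𝓝 (1 - F (-(A₁ ^ 2 * z)))) := by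
  obtain ⟨δ, hδt, hδg, hδ⟩ := exists_asymptotic_inverse hA₁ hg fun ε hε =>
    hW.eventually_centering_sub_le hF h0 h1 hT hε
  refine ⟨δ, hδ, ?_⟩
  have hh := tendsto_div_log_sq
  have hlog : Tendsto (fun n : ℕ => Real.log n) atTop atTop :=
    Real.tendsto_log_atTop.comp tendsto_natCast_atTop_atTop
  have hne : ∀ z : ℝ, z ≠ 0 → Tendsto (fun n : ℕ =>
      W.real {y | (y n : ℝ) ≤ δ n + z * (n / Real.log n ^ 2)}) atTop
        (𝓝 (1 - F (-(A₁ ^ 2 * z)))) := by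
    intro z hz
    have hc0 : ∀ᶠ n : ℕ in atTop, 0 ≤ (δ n : ℝ) + z * (n / Real.log n ^ 2) := by
      have h2 := hδ.add ((hlog.inv_tendsto_atTop).const_mul z)
      rw [mul_zero, add_zero] at h2
      filter_upwards [h2.eventually_const_lt (inv_pos.mpr hA₁), hlog.eventually_gt_atTop 0,
        eventually_ge_atTop 1] with n h3 h4 h5
      have h5 : (0 : ℝ) < n := by exact_mod_cast h5
      have h6 : (δ n : ℝ) + z * (n / Real.log n ^ 2)
          = (δ n * Real.log n / n + z * (Real.log n)⁻¹) * (n / Real.log n) := by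
        field_simp
      rw [h6]
      exact mul_nonneg h3.le (by positivity)
    have hmain := hW.tendsto_lt (N := fun n => ⌊(δ n : ℝ) + z * (n / Real.log n ^ 2)⌋₊ + 1)
      (q := F (-(A₁ ^ 2 * z))) fun ζ => by
        refine hW.tendsto_hitTime_le hF h0 h1 hT hA₁ hg hδt hδg hδ hz (L := 1 + ζ) ?_
        filter_upwards [hc0] with n hn
        have e1 : (⌊(δ n : ℝ) + z * (n / Real.log n ^ 2)⌋₊ : ℝ) ≤ δ n + z * (n / Real.log n ^ 2) :=
          Nat.floor_le hn
        have e2 := Nat.lt_floor_add_one ((δ n : ℝ) + z * (n / Real.log n ^ 2))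
        have e3 : (0 : ℝ) ≤ ζ := Nat.cast_nonneg ζ
        push_cast
        rw [abs_le]
        constructor <;> linarith
    refine hmain.congr' ?_
    filter_upwards [hc0] with n hn
    congr 1
    ext y
    change y n < ((⌊(δ n : ℝ) + z * (n / Real.log n ^ 2)⌋₊ + 1 : ℕ) : ℤ)
      ↔ (y n : ℝ) ≤ δ n + z * (n / Real.log n ^ 2)
    rw [← Int.le_floor, Nat.cast_succ, Int.lt_add_one_iff, Int.natCast_floor_eq_floor hn]
  intro z
  by_cases hz : z = 0
  · -- For `z = 0` the indices compared above need not drift apart, so monotonicity in `z` is used.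
    subst hz
    refine tendsto_of_monotone_of_forall_ne (G := fun z => 1 - F (-(A₁ ^ 2 * z)))
      (u := fun n z => W.real {y | (y n : ℝ) ≤ δ n + z * (n / Real.log n ^ 2)})
      (by fun_prop) (Eventually.of_forall fun n z z' hzz => measureReal_mono fun y hy => ?_) hne
    have hy : (y n : ℝ) ≤ δ n + z * (n / Real.log n ^ 2) := hy
    have : (0 : ℝ) ≤ n / Real.log n ^ 2 := by positivity
    change (y n : ℝ) ≤ δ n + z' * (n / Real.log n ^ 2)
    have := mul_le_mul_of_nonneg_right hzz this
    linarith
  · exact hne z hz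

end CriticalLaw

section CriticalScaling

variable {P : Measure Env} {W : Measure (ℕ → ℤ)} [IsProbabilityMeasure W] {μ c₁ : ℝ} {A : ℕ → ℝ}
  {F : ℝ → ℝ}

/-- The term `n` of the centering `n + 2 A` is negligible for `κ = 1`. -/
lemma tendsto_centering_div_log (hμ : 0 < μ) (hc₁ : 0 < c₁)
    (hA : Asymptotics.IsEquivalent atTop A (fun m : ℕ => c₁ * (m : ℝ) * Real.log m)) :
    Tendsto (fun n : ℕ => ((n : ℝ) + 2 * A ⌊(n : ℝ) / μ⌋₊) / (n * Real.log n)) atTop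
      (𝓝 (2 * c₁ / μ)) := by
  have hlog : Tendsto (fun n : ℕ => Real.log n) atTop atTop :=
    Real.tendsto_log_atTop.comp tendsto_natCast_atTop_atTop
  have hmt := tendsto_floor_div hμ
  have hm := tendsto_floor_div_natCast hμ
  have hmlog := tendsto_log_div_log (one_div_pos.mpr hμ) tendsto_natCast_atTop_atTop hm
  have hpos : ∀ᶠ m : ℕ in atTop, 0 < (m : ℝ) ∧ 0 < Real.log m := by
    filter_upwards [eventually_ge_atTop 1, hlog.eventually_gt_atTop 0] with m h1 h2
    exact ⟨by exact_mod_cast h1, h2⟩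
  have hA1 : Tendsto (fun m : ℕ => A m / (c₁ * (m : ℝ) * Real.log m)) atTop (𝓝 1) := by
    refine (Asymptotics.isEquivalent_iff_tendsto_one ?_).mp hA
    filter_upwards [hpos] with m h1
    exact (mul_pos (mul_pos hc₁ h1.1) h1.2).ne'
  have h1 := hlog.inv_tendsto_atTop.add
    ((((hA1.comp hmt).mul hm).mul hmlog).const_mul (2 * c₁))
  have hval : 0 + 2 * c₁ * (1 * (1 / μ) * 1) = 2 * c₁ / μ := by ring
  rw [hval] at h1
  refine h1.congr' ?_
  filter_upwards [hpos, hmt.eventually hpos] with n h2 h3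
  obtain ⟨h2, h4⟩ := h2
  obtain ⟨h3, h5⟩ := h3
  simp only [Function.comp_apply, Pi.inv_apply]
  generalize A ⌊(n : ℝ) / μ⌋₊ = x
  generalize Real.log (⌊(n : ℝ) / μ⌋₊ : ℕ) = l at h5
  generalize ((⌊(n : ℝ) / μ⌋₊ : ℕ) : ℝ) = k at h3
  field_simp

lemma cdfTendsto_hitTime_div (hμ : 0 < μ) (hF : Continuous F) (h0 : Tendsto F atBot (𝓝 0))
    (h1 : Tendsto F atTop (𝓝 1))
    (hT : CdfTendsto W (fun n y => ((hitTime n y : ℝ) - (n + 2 * A ⌊(n : ℝ) / μ⌋₊))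
      / (2 * normB 1 ⌊(n : ℝ) / μ⌋₊)) F) :
    CdfTendsto W (fun n y => ((hitTime n y : ℝ) - (n + 2 * A ⌊(n : ℝ) / μ⌋₊)) / n)
      fun x => F (μ / 2 * x) := by
  have hk : Tendsto (fun n : ℕ => ((⌊(n : ℝ) / μ⌋₊ : ℕ) : ℝ) / n * μ) atTop (𝓝 1) := by
    have := (tendsto_floor_div_natCast hμ).mul_const μ
    rwa [one_div_mul_cancel hμ.ne'] at this
  have h2 := hT.mul_tendsto_one hF (fun n =>
    ((measurable_natCast_comp (measurable_hitTime n)).sub_const _).div_const _) h0 h1 hk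
  intro x
  refine (h2 (μ / 2 * x)).congr' ?_
  filter_upwards [eventually_ge_atTop 1, (tendsto_floor_div hμ).eventually_ge_atTop 1] with n hn hm
  have hn : (0 : ℝ) < n := by exact_mod_cast hn
  have hm : (0 : ℝ) < (⌊(n : ℝ) / μ⌋₊ : ℕ) := by exact_mod_cast hm
  congr 1
  ext y
  rw [Set.mem_ofPred_eq, Set.mem_ofPred_eq, normB_of_ne (by norm_num), one_div_one, Real.rpow_one]
  have h3 : ((⌊(n : ℝ) / μ⌋₊ : ℕ) : ℝ) / n * μ * (((hitTime n y : ℝ) - (n + 2 * A ⌊(n : ℝ) / μ⌋₊))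
      / (2 * (⌊(n : ℝ) / μ⌋₊ : ℕ)))
      = μ / 2 * (((hitTime n y : ℝ) - (n + 2 * A ⌊(n : ℝ) / μ⌋₊)) / n) := by
    generalize A ⌊(n : ℝ) / μ⌋₊ = x
    generalize ((⌊(n : ℝ) / μ⌋₊ : ℕ) : ℝ) = k at hm
    field_simp
  rw [h3]
  exact mul_le_mul_iff_right₀ (by positivity)

end CriticalScaling

/-! ### The limit laws for the walk -/

section Walk

variable {P : Measure Env} {Ω' : Type*} [MeasurableSpace Ω'] {Pr : Measure Ω'} {env : Ω' → Env}
  {X : ℕ → Ω' → ℤ}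

lemma IsRWRE.measureReal_le (hX : IsRWRE Pr P env X) (n : ℕ) (c : ℝ) :
    Pr.real {a | (X n a : ℝ) ≤ c} = (Pr.map fun a n => X n a).real {y | (y n : ℝ) ≤ c} := by
  have hm : MeasurableSet {y : ℕ → ℤ | (y n : ℝ) ≤ c} :=
    measurableSet_le ((measurable_from_top (f := fun k : ℤ => (k : ℝ))).comp
      (measurable_pi_apply n)) measurable_const
  rw [map_measureReal_apply hX.measurable_path hm]
  rfl

/-- Rewrites the distribution function of the normalized position of the walk. -/
lemma IsRWRE.measureReal_mul_sub_le (hX : IsRWRE Pr P env X) (n : ℕ) {r s : ℝ} (hr : 0 < r)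
    (hs : s = r⁻¹) (c z : ℝ) :
    Pr.real {a | s * ((X n a : ℝ) - c) ≤ z}
      = (Pr.map fun a n => X n a).real {y | (y n : ℝ) ≤ c + z * r} := by
  rw [← hX.measureReal_le]
  congr 1
  ext a
  rw [Set.mem_ofPred_eq, Set.mem_ofPred_eq, hs, inv_mul_le_iff₀ hr, sub_le_iff_le_add', mul_comm]

variable [IsProbabilityMeasure Pr] {κ μ b : ℝ} {ν : ProbabilityMeasure ℝ} {A : ℕ → ℝ}

lemma IsRWRE.stableLimitLaws_of_lt_one (hX : IsRWRE Pr P env X)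
    (hW : AnnealedWalk P (Pr.map fun a n => X n a)) (h0 : 0 < κ) (h1 : κ < 1) (hμ : 0 < μ)
    (hb : 0 < b) (hν : IsStableLaw κ b ν) (hA : ∀ m, A m = 0)
    (hT : CdfTendsto (Pr.map fun a n => X n a)
      (fun n y => ((hitTime n y : ℝ) - (n + 2 * A ⌊(n : ℝ) / μ⌋₊))
        / (2 * normB κ ⌊(n : ℝ) / μ⌋₊)) (cdf (ν : Measure ℝ))) :
    StableLimitLaws Pr X κ := by
  have : IsProbabilityMeasure (Pr.map fun a n => X n a) :=
    Measure.isProbabilityMeasure_map hX.measurable_path.aemeasurable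
  have hF := continuous_cdf_of_singleton (hν.measure_singleton hb h0)
  have hc : 0 < μ ^ (1 / κ) / 2 := by positivity
  refine ⟨b * (μ ^ (1 / κ) / 2) ^ (-κ), by positivity, affineImage ν (μ ^ (1 / κ) / 2) 0,
    hν.affineImage_of_ne h1.ne hc, fun _ z hz => ?_, fun h => by linarith, fun h => by linarith,
    fun h => by linarith⟩
  rw [cdf_affineImage ν hc, add_zero]
  refine (hW.tendsto_le_of_lt_one h0 h1 hμ hF hT hA hz).congr' ?_
  filter_upwards [eventually_ge_atTop 1] with n hn
  have hn : (0 : ℝ) < n := by exact_mod_cast hn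
  have := hX.measureReal_mul_sub_le n (Real.rpow_pos_of_pos hn κ) (Real.rpow_neg hn.le κ) 0 z
  simp only [sub_zero, zero_add] at this
  exact this.symm

lemma IsRWRE.stableLimitLaws_of_one (hX : IsRWRE Pr P env X)
    (hW : AnnealedWalk P (Pr.map fun a n => X n a)) (hμ : 0 < μ)
    (hb : 0 < b) (hν : IsStableLaw 1 b ν) {c₁ : ℝ} (hc₁ : 0 < c₁)
    (hA : Asymptotics.IsEquivalent atTop A (fun m : ℕ => c₁ * (m : ℝ) * Real.log m))
    (hT : CdfTendsto (Pr.map fun a n => X n a)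
      (fun n y => ((hitTime n y : ℝ) - (n + 2 * A ⌊(n : ℝ) / μ⌋₊))
        / (2 * normB 1 ⌊(n : ℝ) / μ⌋₊)) (cdf (ν : Measure ℝ))) :
    StableLimitLaws Pr X 1 := by
  have : IsProbabilityMeasure (Pr.map fun a n => X n a) :=
    Measure.isProbabilityMeasure_map hX.measurable_path.aemeasurable
  have hF := continuous_cdf_of_singleton (hν.measure_singleton hb one_pos)
  have hA₁ : 0 < 2 * c₁ / μ := by positivity
  have hμ2 : 0 < μ / 2 := by positivity
  obtain ⟨δ, hδ, hlim⟩ := hW.exists_critical_limit (F := fun x => cdf (ν : Measure ℝ) (μ / 2 * x))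
    (hF.comp (continuous_const.mul continuous_id))
    ((tendsto_cdf_atBot _).comp (tendsto_id.const_mul_atBot hμ2))
    ((tendsto_cdf_atTop _).comp (tendsto_id.const_mul_atTop hμ2))
    (cdfTendsto_hitTime_div hμ hF (tendsto_cdf_atBot _) (tendsto_cdf_atTop _) hT) hA₁
    (tendsto_centering_div_log hμ hc₁ hA)
  set A₁ : ℝ := 2 * c₁ / μ
  set c : ℝ := A₁ ^ 2 * (μ / 2) with hc_def
  have hc : 0 < c := by positivity
  set a : ℝ := b / c * (2 / Real.pi) * Real.log c
  have hlog : Tendsto (fun n : ℕ => Real.log n) atTop atTop :=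
    Real.tendsto_log_atTop.comp tendsto_natCast_atTop_atTop
  -- The rescaled law is stable after a translation by `a`, which `δ` absorbs.
  refine ⟨b / c, by positivity, affineImage ν c a, hν.affineImage_one hc, fun h => by linarith,
    fun _ => ⟨A₁, hA₁, fun n => δ n - a * (n / Real.log n ^ 2), ?_, fun z => ?_⟩,
    fun h => by linarith, fun h => by linarith⟩
  · refine (Asymptotics.isEquivalent_iff_tendsto_one ?_).mpr ?_
    · filter_upwards [eventually_ge_atTop 1, hlog.eventually_gt_atTop 0] with n h1 h2
      have h1 : (0 : ℝ) < n := by exact_mod_cast h1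
      positivity
    · have h1 := (hδ.const_mul A₁).sub (hlog.inv_tendsto_atTop.const_mul (a * A₁))
      rw [mul_zero, sub_zero, mul_inv_cancel₀ hA₁.ne'] at h1
      refine h1.congr' ?_
      filter_upwards [eventually_ge_atTop 1, hlog.eventually_gt_atTop 0] with n h2 h3
      have h2 : (0 : ℝ) < n := by exact_mod_cast h2
      simp only [Pi.div_apply, Pi.inv_apply]
      field_simp
  · rw [cdf_affineImage ν hc]
    have h1 := hlim (z - a)
    rw [show μ / 2 * -(A₁ ^ 2 * (z - a)) = c * (-z + a) by rw [hc_def]; ring] at h1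
    refine h1.congr' ?_
    filter_upwards [eventually_ge_atTop 1, hlog.eventually_gt_atTop 0] with n h2 h3
    have h2 : (0 : ℝ) < n := by exact_mod_cast h2
    rw [hX.measureReal_mul_sub_le n (r := n / Real.log n ^ 2) (by positivity)
      (by rw [inv_div, inv_mul_eq_div])]
    congr 1
    ext y
    rw [Set.mem_ofPred_eq, Set.mem_ofPred_eq]
    ring_nf

lemma IsRWRE.stableLimitLaws_of_one_lt (hX : IsRWRE Pr P env X)
    (hW : AnnealedWalk P (Pr.map fun a n => X n a)) (h1 : 1 < κ) (h2 : κ ≤ 2) (hμ : 0 < μ)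
    (hfin : ∫⁻ y, (hitOne y : ℝ≥0∞) ∂(Pr.map fun a n => X n a) < ⊤)
    (hb : 0 < b) (hν : IsStableLaw κ b ν) {c₂ : ℝ} (hc₂ : 0 < c₂) (hA : ∀ m : ℕ, A m = c₂ * m)
    (hT : CdfTendsto (Pr.map fun a n => X n a)
      (fun n y => ((hitTime n y : ℝ) - (n + 2 * A ⌊(n : ℝ) / μ⌋₊))
        / (2 * normB κ ⌊(n : ℝ) / μ⌋₊)) (cdf (ν : Measure ℝ))) :
    StableLimitLaws Pr X κ := by
  have : IsProbabilityMeasure (Pr.map fun a n => X n a) :=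
    Measure.isProbabilityMeasure_map hX.measurable_path.aemeasurable
  have h0 : 0 < κ := by linarith
  have hF := continuous_cdf_of_singleton (hν.measure_singleton hb h0)
  set α : ℝ := 1 + 2 * c₂ / μ with hα
  have hα0 : 0 < α := by rw [hα]; positivity
  set c : ℝ := α / (2 * (α⁻¹ / μ) ^ (1 / κ)) with hc_def
  have hc : 0 < c := by positivity
  have hspeed : IsSpeed Pr X α⁻¹ := by
    have := hW.ae_tendsto_div hfin hα0 (AnnealedWalk.inProbZero_hitTime_div h1 hμ
      (tendsto_cdf_atBot _) (tendsto_cdf_atTop _) hT hA)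
    exact ae_of_ae_map hX.measurable_path.aemeasurable this
  have hlim : ∀ (s : ℕ → ℝ), (∀ᶠ n in atTop, s n = (normB κ n)⁻¹) → ∀ z : ℝ,
      Tendsto (fun n : ℕ => Pr.real {a | s n * ((X n a : ℝ) - (n : ℝ) * α⁻¹) ≤ z}) atTop
        (𝓝 (1 - cdf (affineImage ν c 0 : Measure ℝ) (-z))) := by
    intro s hs z
    rw [cdf_affineImage ν hc, add_zero, mul_neg]
    refine (hW.tendsto_le_of_one_lt h1 hμ hF hT hc₂ hA hα z).congr' ?_
    filter_upwards [hs, (tendsto_normB h0).eventually_gt_atTop 0] with n h3 h4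
    rw [hX.measureReal_mul_sub_le n h4 h3]
  have hstable := hν.affineImage_of_ne h1.ne' hc
  have hb' : 0 < b * c ^ (-κ) := by positivity
  refine ⟨b * c ^ (-κ), hb', affineImage ν c 0, hstable, fun h => by linarith, fun h => by linarith,
    fun _ h => ⟨α⁻¹, hspeed, hlim _ ?_⟩, fun h => ⟨α⁻¹, hspeed, fun z => ?_⟩⟩
  · refine Eventually.of_forall fun n => ?_
    rw [normB_of_ne h.ne, neg_div, Real.rpow_neg (Nat.cast_nonneg n)]
  · subst h
    -- For `κ = 2` the limit law is stated without reflection, by symmetry.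
    rw [← hstable.cdf_neg hb' z]
    refine hlim _ (Eventually.of_forall fun n => ?_) z
    rw [normB_two, neg_div, Real.rpow_neg (mul_nonneg (Nat.cast_nonneg n)
      (Real.log_natCast_nonneg n))]

end Walk

end RWRE

theorem theorem3p1
    -- the environment: its law `P` satisfies Conditions B and `C_κ`
    (P : Measure RWRE.Env) [IsProbabilityMeasure P] (κ : ℝ) (hκ : κ ≤ 2)
    (hB : RWRE.ConditionB P κ) (hC : RWRE.ConditionC P κ)
    -- a probability space carrying the environment, the walk and the branching process
    {Ω' : Type*} [m : MeasurableSpace Ω'] (Pr : Measure Ω') [IsProbabilityMeasure Pr]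
    (env : Ω' → RWRE.Env) (X : ℕ → Ω' → ℤ) (Z : ℕ → Ω' → ℕ)
    (hX : RWRE.IsRWRE Pr P env X) (hZ : RWRE.IsBranching Pr P env Z)
    -- the increasing sequence of stopping times for the augmented filtration
    (𝒢 : Filtration ℕ m) (h𝒢 : RWRE.IsAugmentation Pr env Z 𝒢)
    (η : ℕ → Ω' → WithTop ℕ)
    (hη : ∀ k, IsStoppingTime (RWRE.augFiltration Z hZ.measurable_branching 𝒢) (η k))
    (hη_zero : ∀ᵐ a ∂Pr, η 0 a = 0) (hη_mono : ∀ᵐ a ∂Pr, Monotone fun k => η k a)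
    (hη_fin : ∀ k, ∀ᵐ a ∂Pr, η k a ≠ ⊤)
    -- law of large numbers and central limit theorem for the stopping times
    (μ : ℝ) (hμ : 0 < μ) (σ : ℝ)
    (hLLN : ∀ᵐ a ∂Pr, Tendsto (fun k : ℕ => (((η k a).untopD 0 : ℕ) : ℝ) / (k : ℝ)) atTop (𝓝 μ))
    (hCLT : TendstoInDistribution
      (fun (k : ℕ) a => ((((η k a).untopD 0 : ℕ) : ℝ) - (k : ℝ) * μ) / √(k : ℝ)) atTop
      id (fun _ => Pr) (gaussianReal 0 (Real.toNNReal (σ ^ 2))))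
    -- stable limit law for the sums of the branching process up to the stopping times
    (b : ℝ) (hb : 0 < b) (ν : ProbabilityMeasure ℝ) (hν : RWRE.IsStableLaw κ b ν)
    (A : ℕ → ℝ) (hA : RWRE.IsCentering κ A)
    (hStable : TendstoInDistribution
      (fun (k : ℕ) a =>
        ((∑ i ∈ Finset.Icc 1 ((η k a).untopD 0), (Z i a : ℝ)) - A k) / RWRE.normB κ k) atTop
      id (fun _ => Pr) (ν : Measure ℝ)) :
    RWRE.StableLimitLaws Pr X κ := by
  have hW := hX.annealed hB
  have : IsProbabilityMeasure (Pr.map fun a n => X n a) :=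
    Measure.isProbabilityMeasure_map hX.measurable_path.aemeasurable
  have hT := hZ.cdfTendsto_hitTime hκ hB hμ (η := fun k a => (η k a).untopD 0) hCLT
    (hν.measure_singleton hb hB.kappa_pos) hStable hW
  rcases lt_trichotomy κ 1 with h | h | h
  · exact hX.stableLimitLaws_of_lt_one hW hB.kappa_pos h hμ hb hν (hA.1 h) hT
  · subst h
    obtain ⟨c₁, hc₁, hA₁⟩ := hA.2.1 rfl
    exact hX.stableLimitLaws_of_one hW hμ hb hν hc₁ hA₁ hT
  · obtain ⟨c₂, hc₂, hA₂⟩ := hA.2.2 h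
    exact hX.stableLimitLaws_of_one_lt hW h hκ hμ (hX.lintegral_hitOne_lt_top hB h) hb hν hc₂ hA₂ hT
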